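/- Let $\mathbb{F}$ be a field of characteristic $0$, and let $\mathcal{W}(1)$ be the Lie conformal algebra over $\mathbb{F}$ which is the free $\mathbb{F}[\partial]$-module on two generators $L,H$ with $\lambda$-bracket determined by $$[L_\lambda L]=(\partial+2\lambda)L,\quad [L_\lambda H]=\partial H,\quad [H_\lambda L]=-\partial H,\quad [H_\lambda H]=0 .$$ For a Lie conformal algebra $\mathcal{A}$ and an $\mathcal{A}$-module $M$, let $\widetilde C^q(\mathcal{A},M)$ $(q\ge 0)$ be the space of $\mathbb{F}$-linear maps $f:\mathcal{A}^{\otimes q}\to M[\lambda_1,\dots,\lambda_q]$ with $f_{\lambda_1,\dots,\lambda_q}(a_1,\dots,\partial a_i,\dots,a_q)=-\lambda_i f_{\lambda_1,\dots,\lambda_q}(a_1,\dots,a_q)$ that are skew-symmetric under simultaneous permutations of the $a_i$ and the $\lambda_i$ (so $\widetilde C^0=M$). The differential is $$(\mathbf d f)_{\lambda_1,\dots,\lambda_{q+1}}(a_1,\dots,a_{q+1})=\sum_{k}(-1)^{k+1}a_{k\,\lambda_k}f_{\dots,\hat\lambda_k,\dots}(\dots,\hat a_k,\dots)+\sum_{k<l}(-1)^{k+l}f_{\lambda_k+\lambda_l,\dots,\hat\lambda_k,\dots,\hat\lambda_l,\dots}([a_{k\,\lambda_k}a_l],\dots,\hat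 a_k,\dots,\hat a_l,\dots),$$ and $\partial$ acts by $(\partial f)_{\lambda_1,\dots,\lambda_q}=(\partial^M+\lambda_1+\dots+\lambda_q)f_{\lambda_1,\dots,\lambda_q}$. The basic cohomology $\widetilde{\mathrm H}^q(\mathcal{A},M)$ is the cohomology of the complex $\widetilde C^\bullet(\mathcal{A},M)$, and the reduced cohomology $\mathrm H^q(\mathcal{A},M)$ is the cohomology of the quotient complex $\widetilde C^\bullet(\mathcal{A},M)/\partial\widetilde C^\bullet(\mathcal{A},M)$. **Theorem.** For $\mathcal{W}(1)$ with coefficients in its adjoint module, $$\dim\widetilde{\mathrm H}^q(\mathcal{W}(1),\mathcal{W}(1))=\begin{cases}2,& q=2,3,\\ 0,&\text{otherwise,}\end{cases}\qquad \dim\mathrm H^q(\mathcal{W}(1),\mathcal{W}(1))=\begin{cases}2,& q=1,3,\\ 4,& q=2,\\ 0,&\text{otherwise.}\end{cases}$$ Moreover, consider the cochains given as follows, where each takes the value $0$ on all tensors $L^{\otimes s}\otimes H^{\otimes t}$ not listed: - $f_{11}:H\mapsto H$ and $f_{12}:L\mapsto -\lambda_1^2H$; - $f_{21}:L\otimes H\mapsto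 H$, $\;f_{22}:L\otimes L\mapsto(\lambda_1^2-\lambda_2^2)H$, $\;f_{23}:L\otimes H\mapsto(\partial+\lambda_2)H$, $\;f_{24}:L\otimes L\mapsto\lambda_1\lambda_2(\lambda_1-\lambda_2)H$; - $f_{31}:L\otimes L\otimes H\mapsto(\lambda_1-\lambda_2)H$ and $f_{32}:L\otimes L\otimes L\mapsto(\lambda_1-\lambda_2)(\lambda_1-\lambda_3)(\lambda_2-\lambda_3)H$. Then $f_{21},f_{22},f_{31},f_{32}$ are cocycles of the basic complex, the images of all eight cochains in the reduced complex are cocycles, and their classes form bases as follows: $\{[f_{21}],[f_{22}]\}$ of $\widetilde{\mathrm H}^2$, $\{[f_{31}],[f_{32}]\}$ of $\widetilde{\mathrm H}^3$, $\{[\bar f_{11}],[\bar f_{12}]\}$ of $\mathrm H^1$, $\{[\bar f_{21}],[\bar f_{22}],[\bar f_{23}],[\bar f_{24}]\}$ of $\mathrm H^2$, and $\{[\bar f_{31}],[\bar f_{32}]\}$ of $\mathrm H^3$, where $\bar f$ denotes the image of $f$ in the reduced complex. -/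

import Mathlib

open scoped TensorProduct Polynomial

namespace LieConformal

/-! ## Polynomials with coefficients in a vector space

`M[λ₁, …, λ_q]` is `P ⊗[F] M` with `P = MvPolynomial (Fin q) F`, and `M[λ]` is `F[X] ⊗[F] M`. -/

section Substitution

variable {F : Type*} [Field F] {A M : Type*} [AddCommGroup A] [Module F A]
  [AddCommGroup M] [Module F M]

/-- Substitution of variables `P[coefficients in M] → P'[coefficients in M]` along an algebra
homomorphism `P → P'`. -/
noncomputable def substVars {P P' : Type*} [CommRing P] [Algebra F P] [CommRing P'] [Algebra F P']
    (M : Type*) [AddCommGroup M] [Module F M] (e : P →ₐ[F] P') : P ⊗[F] M →ₗ[F] P' ⊗[F] M :=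
  LinearMap.rTensor M e.toLinearMap

/-- Substitution `λ := p` in an element of `M[λ]`. -/
noncomputable def evalAt {P : Type*} [CommRing P] [Algebra F P]
    (M : Type*) [AddCommGroup M] [Module F M] (p : P) : F[X] ⊗[F] M →ₗ[F] P ⊗[F] M :=
  substVars M (Polynomial.aeval p)

/-- Given `(a, m) ↦ a_λ m ∈ M[λ]`, the map `v ↦ a_p v`, extended `P`-linearly to `v ∈ P ⊗ M`. -/
noncomputable def actAt {P : Type*} [CommRing P] [Algebra F P]
    (φ : A →ₗ[F] M →ₗ[F] F[X] ⊗[F] M) (p : P) (a : A) : P ⊗[F] M →ₗ[P] P ⊗[F] M :=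
  LinearMap.liftBaseChange P (evalAt M p ∘ₗ φ a)

/-- Given `(a, m) ↦ a_λ m ∈ M[λ]`, the map `u ↦ u_p m`, extended `P`-linearly to `u ∈ P ⊗ A`. -/
noncomputable def actLeftAt {P : Type*} [CommRing P] [Algebra F P]
    (φ : A →ₗ[F] M →ₗ[F] F[X] ⊗[F] M) (p : P) (m : M) : P ⊗[F] A →ₗ[P] P ⊗[F] M :=
  LinearMap.liftBaseChange P (evalAt M p ∘ₗ φ.flip m)

/-- Multiplication by `-λ - ∂` on `A[λ]`, where `∂` acts on coefficients by `D`. -/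
noncomputable def negLamSubD (D : A →ₗ[F] A) : Module.End F (F[X] ⊗[F] A) :=
  -(LinearMap.lsmul F[X] (F[X] ⊗[F] A) Polynomial.X).restrictScalars F
    - (D.baseChange F[X]).restrictScalars F

/-- The substitution `λ := -λ - ∂` in an element of `A[λ]`: `λ ^ n ⊗ a ↦ (-λ - ∂) ^ n a`. -/
noncomputable def substNegLamSubD (D : A →ₗ[F] A) : F[X] ⊗[F] A →ₗ[F] F[X] ⊗[F] A :=
  TensorProduct.lift
    ((LinearMap.lcomp F (F[X] ⊗[F] A) (TensorProduct.mk F F[X] A 1)) ∘ₗ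
      (Polynomial.aeval (negLamSubD D)).toLinearMap)

end Substitution

/-! ## Lie conformal algebras and their modules -/

/-- A Lie conformal algebra over `F` with underlying vector space `A`. The `F[∂]`-module structure
is given by the endomorphism `D` by which `∂` acts; `bracket a b` is `[a_λ b] ∈ A[λ]`.
In the Jacobi identity `λ = X 0` and `μ = X 1`. -/
structure LieConformalAlgebra (F : Type*) [Field F] (A : Type*) [AddCommGroup A] [Module F A] where
  D : A →ₗ[F] A
  bracket : A →ₗ[F] A →ₗ[F] F[X] ⊗[F] A
  bracket_D_left : ∀ a b, bracket (D a) b = -((Polynomial.X : F[X]) • bracket a b)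
  bracket_D_right : ∀ a b,
    bracket a (D b) = D.baseChange F[X] (bracket a b) + (Polynomial.X : F[X]) • bracket a b
  skew : ∀ a b, bracket a b = -substNegLamSubD D (bracket b a)
  jacobi : ∀ a b c,
    actAt bracket (MvPolynomial.X 0 : MvPolynomial (Fin 2) F) a
        (evalAt A (MvPolynomial.X 1) (bracket b c)) =
      actLeftAt bracket (MvPolynomial.X 0 + MvPolynomial.X 1) c
        (evalAt A (MvPolynomial.X 0) (bracket a b)) +
      actAt bracket (MvPolynomial.X 1) b (evalAt A (MvPolynomial.X 0) (bracket a c))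

/-- A (conformal) module `M` over a Lie conformal algebra; `act a m` is `a_λ m ∈ M[λ]`. -/
structure LCModule {F : Type*} [Field F] {A : Type*} [AddCommGroup A] [Module F A]
    (𝒜 : LieConformalAlgebra F A) (M : Type*) [AddCommGroup M] [Module F M] where
  D : M →ₗ[F] M
  act : A →ₗ[F] M →ₗ[F] F[X] ⊗[F] M
  act_D_left : ∀ a m, act (𝒜.D a) m = -((Polynomial.X : F[X]) • act a m)
  act_D_right : ∀ a m,
    act a (D m) = D.baseChange F[X] (act a m) + (Polynomial.X : F[X]) • act a m
  act_act : ∀ a b m,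
    actAt act (MvPolynomial.X 0 : MvPolynomial (Fin 2) F) a
        (evalAt M (MvPolynomial.X 1) (act b m)) -
      actAt act (MvPolynomial.X 1) b (evalAt M (MvPolynomial.X 0) (act a m)) =
      actLeftAt act (MvPolynomial.X 0 + MvPolynomial.X 1) m
        (evalAt A (MvPolynomial.X 0) (𝒜.bracket a b))

/-- The adjoint module of a Lie conformal algebra. -/
noncomputable def LieConformalAlgebra.adjoint {F : Type*} [Field F] {A : Type*} [AddCommGroup A]
    [Module F A] (𝒜 : LieConformalAlgebra F A) : LCModule 𝒜 A where
  D := 𝒜.D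
  act := 𝒜.bracket
  act_D_left := 𝒜.bracket_D_left
  act_D_right := 𝒜.bracket_D_right
  act_act a b m := by rw [𝒜.jacobi]; abel

/-! ### Rules of calculation -/

section Rules

variable {F : Type*} [Field F] {A M : Type*} [AddCommGroup A] [Module F A]
  [AddCommGroup M] [Module F M]
  {P P' : Type*} [CommRing P] [Algebra F P] [CommRing P'] [Algebra F P']

theorem substVars_tmul (e : P →ₐ[F] P') (p : P) (m : M) :
    substVars M e (p ⊗ₜ m) = e p ⊗ₜ m := by
  simp [substVars]

theorem substVars_smul (e : P →ₐ[F] P') (p : P) (v : P ⊗[F] M) :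
    substVars M e (p • v) = e p • substVars M e v := by
  induction v with
  | zero => simp
  | add x y hx hy => simp only [smul_add, map_add, hx, hy]
  | tmul r m => simp [substVars_tmul, TensorProduct.smul_tmul']

theorem substVars_substVars {P'' : Type*} [CommRing P''] [Algebra F P''] (e : P →ₐ[F] P')
    (e' : P' →ₐ[F] P'') (v : P ⊗[F] M) :
    substVars M e' (substVars M e v) = substVars M (e'.comp e) v := by
  induction v with
  | zero => simp
  | add x y hx hy => simp only [map_add, hx, hy]
  | tmul r m => simp [substVars_tmul]

theorem substVars_baseChange (e : P →ₐ[F] P') (D : M →ₗ[F] M) (v : P ⊗[F] M) :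
    substVars M e (D.baseChange P v) = D.baseChange P' (substVars M e v) := by
  induction v with
  | zero => simp
  | add x y hx hy => simp only [map_add, hx, hy]
  | tmul r m => simp [substVars_tmul]

theorem evalAt_tmul (p : P) (r : F[X]) (m : M) :
    evalAt M p (r ⊗ₜ m) = Polynomial.aeval p r ⊗ₜ m := substVars_tmul _ _ _

theorem evalAt_X_smul (p : P) (v : F[X] ⊗[F] M) :
    evalAt M p ((Polynomial.X : F[X]) • v) = p • evalAt M p v := by
  simp [evalAt, substVars_smul]

theorem evalAt_baseChange (p : P) (D : M →ₗ[F] M) (v : F[X] ⊗[F] M) :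
    evalAt M p (D.baseChange F[X] v) = D.baseChange P (evalAt M p v) :=
  substVars_baseChange _ _ _

theorem substVars_evalAt (e : P →ₐ[F] P') (p : P) (v : F[X] ⊗[F] M) :
    substVars M e (evalAt M p v) = evalAt M (e p) v := by
  rw [evalAt, evalAt, substVars_substVars]
  congr 2
  ext
  simp

theorem actAt_tmul (φ : A →ₗ[F] M →ₗ[F] F[X] ⊗[F] M) (p : P) (a : A) (r : P) (m : M) :
    actAt φ p a (r ⊗ₜ m) = r • evalAt M p (φ a m) := by
  simp [actAt]

theorem actLeftAt_tmul (φ : A →ₗ[F] M →ₗ[F] F[X] ⊗[F] M) (p : P) (m : M) (r : P) (a : A) :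
    actLeftAt φ p m (r ⊗ₜ a) = r • evalAt M p (φ a m) := by
  simp [actLeftAt]

theorem actAt_add (φ : A →ₗ[F] M →ₗ[F] F[X] ⊗[F] M) (p : P) (a b : A) (v : P ⊗[F] M) :
    actAt φ p (a + b) v = actAt φ p a v + actAt φ p b v := by
  induction v with
  | zero => simp
  | add x y hx hy => simp only [map_add, hx, hy]; abel
  | tmul r m => simp [actAt_tmul]

theorem actAt_smul (φ : A →ₗ[F] M →ₗ[F] F[X] ⊗[F] M) (p : P) (c : F) (a : A) (v : P ⊗[F] M) :
    actAt φ p (c • a) v = c • actAt φ p a v := by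
  induction v with
  | zero => simp
  | add x y hx hy => simp only [map_add, hx, hy, smul_add]
  | tmul r m => simp [actAt_tmul, smul_comm r c]

theorem actLeftAt_add (φ : A →ₗ[F] M →ₗ[F] F[X] ⊗[F] M) (p : P) (m n : M) (v : P ⊗[F] A) :
    actLeftAt φ p (m + n) v = actLeftAt φ p m v + actLeftAt φ p n v := by
  induction v with
  | zero => simp
  | add x y hx hy => simp only [map_add, hx, hy]; abel
  | tmul r m => simp [actLeftAt_tmul]

theorem actLeftAt_smul (φ : A →ₗ[F] M →ₗ[F] F[X] ⊗[F] M) (p : P) (c : F) (m : M)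
    (v : P ⊗[F] A) : actLeftAt φ p (c • m) v = c • actLeftAt φ p m v := by
  induction v with
  | zero => simp
  | add x y hx hy => simp only [map_add, hx, hy, smul_add]
  | tmul r m => simp [actLeftAt_tmul, smul_comm r c]

theorem actAt_D {DA : A →ₗ[F] A} {φ : A →ₗ[F] M →ₗ[F] F[X] ⊗[F] M}
    (h : ∀ a m, φ (DA a) m = -((Polynomial.X : F[X]) • φ a m)) (p : P) (a : A) (v : P ⊗[F] M) :
    actAt φ p (DA a) v = -(p • actAt φ p a v) := by
  induction v with
  | zero => simp
  | add x y hx hy => simp only [map_add, hx, hy, smul_add]; abel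
  | tmul r m => simp only [actAt_tmul, h, map_neg, evalAt_X_smul, smul_neg, smul_comm r p]

theorem actAt_baseChange {D : M →ₗ[F] M} {φ : A →ₗ[F] M →ₗ[F] F[X] ⊗[F] M}
    (h : ∀ a m, φ a (D m) = D.baseChange F[X] (φ a m) + (Polynomial.X : F[X]) • φ a m)
    (p : P) (a : A) (v : P ⊗[F] M) :
    actAt φ p a (D.baseChange P v) = D.baseChange P (actAt φ p a v) + p • actAt φ p a v := by
  induction v with
  | zero => simp
  | add x y hx hy => simp only [map_add, hx, hy, smul_add]; abel
  | tmul r m =>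
    simp only [LinearMap.baseChange_tmul, actAt_tmul, h, map_add, evalAt_X_smul,
      evalAt_baseChange, smul_add, map_smul, smul_comm r p]

theorem actLeftAt_D {D : M →ₗ[F] M} {φ : A →ₗ[F] M →ₗ[F] F[X] ⊗[F] M}
    (h : ∀ a m, φ a (D m) = D.baseChange F[X] (φ a m) + (Polynomial.X : F[X]) • φ a m)
    (p : P) (m : M) (v : P ⊗[F] A) :
    actLeftAt φ p (D m) v = D.baseChange P (actLeftAt φ p m v) + p • actLeftAt φ p m v := by
  induction v with
  | zero => simp
  | add x y hx hy => simp only [map_add, hx, hy, smul_add]; abel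
  | tmul r m =>
    simp only [actLeftAt_tmul, h, map_add, evalAt_X_smul,
      evalAt_baseChange, smul_add, map_smul, smul_comm r p]

theorem actLeftAt_baseChange {DA : A →ₗ[F] A} {φ : A →ₗ[F] M →ₗ[F] F[X] ⊗[F] M}
    (h : ∀ a m, φ (DA a) m = -((Polynomial.X : F[X]) • φ a m)) (p : P) (m : M) (v : P ⊗[F] A) :
    actLeftAt φ p m (DA.baseChange P v) = -(p • actLeftAt φ p m v) := by
  induction v with
  | zero => simp
  | add x y hx hy => simp only [map_add, hx, hy, smul_add]; abel
  | tmul r a =>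
    simp only [LinearMap.baseChange_tmul, actLeftAt_tmul, h, map_neg, evalAt_X_smul, smul_neg,
      smul_comm r p]

theorem substVars_actAt (e : P →ₐ[F] P') (φ : A →ₗ[F] M →ₗ[F] F[X] ⊗[F] M) (p : P) (a : A)
    (v : P ⊗[F] M) :
    substVars M e (actAt φ p a v) = actAt φ (e p) a (substVars M e v) := by
  induction v with
  | zero => simp
  | add x y hx hy => simp only [map_add, hx, hy]
  | tmul r m => simp only [actAt_tmul, substVars_smul, substVars_evalAt, substVars_tmul]

theorem substNegLamSubD_tmul (D : A →ₗ[F] A) (p : F[X]) (a : A) :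
    substNegLamSubD D (p ⊗ₜ a) = Polynomial.aeval (negLamSubD D) p (1 ⊗ₜ a) := by
  simp [substNegLamSubD]

theorem negLamSubD_apply (D : A →ₗ[F] A) (v : F[X] ⊗[F] A) :
    negLamSubD D v = -((Polynomial.X : F[X]) • v) - D.baseChange F[X] v := by
  simp [negLamSubD]

theorem substNegLamSubD_X_smul (D : A →ₗ[F] A) (v : F[X] ⊗[F] A) :
    substNegLamSubD D ((Polynomial.X : F[X]) • v) =
      -((Polynomial.X : F[X]) • substNegLamSubD D v) - D.baseChange F[X] (substNegLamSubD D v) := by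
  rw [← negLamSubD_apply]
  induction v with
  | zero => simp
  | add x y hx hy => simp only [smul_add, map_add, hx, hy]
  | tmul r m =>
    simp [TensorProduct.smul_tmul', substNegLamSubD_tmul]

theorem negLamSubD_baseChange (D : A →ₗ[F] A) (v : F[X] ⊗[F] A) :
    negLamSubD D (D.baseChange F[X] v) = D.baseChange F[X] (negLamSubD D v) := by
  simp [negLamSubD_apply]

theorem substNegLamSubD_baseChange (D : A →ₗ[F] A) (v : F[X] ⊗[F] A) :
    substNegLamSubD D (D.baseChange F[X] v) = D.baseChange F[X] (substNegLamSubD D v) := by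
  induction v with
  | zero => simp
  | add x y hx hy => simp only [map_add, hx, hy]
  | tmul r m =>
    simp only [LinearMap.baseChange_tmul, substNegLamSubD_tmul]
    induction r using Polynomial.induction_on' with
    | add p q hp hq => simp only [map_add, LinearMap.add_apply, hp, hq]
    | monomial n c =>
      rw [← Polynomial.C_mul_X_pow_eq_monomial, ← Polynomial.smul_eq_C_mul]
      simp only [map_smul, LinearMap.smul_apply, map_pow, Polynomial.aeval_X]
      have key : ∀ n, (negLamSubD D ^ n) (1 ⊗ₜ[F] D m) =
          D.baseChange F[X] ((negLamSubD D ^ n) (1 ⊗ₜ[F] m)) := by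
        intro n
        induction n with
        | zero => simp
        | succ n ih => rw [pow_succ', Module.End.mul_apply, ih, negLamSubD_baseChange]; rfl
      rw [key]
      exact (((D.baseChange F[X]).restrictScalars F).map_smul c _).symm

end Rules


/-! ## The Lie conformal algebra `W(b)` -/

section WAlgebra

variable {F : Type*} [Field F]

/-- The free `F[∂]`-module on two generators `L = (1, 0)` and `H = (0, 1)`. -/
abbrev WSpace (F : Type*) [Field F] : Type _ := F[X] × F[X]

namespace WSpace

variable (F) in
/-- The generator `L`. -/
noncomputable def L : WSpace F := (1, 0)

variable (F) in
/-- The generator `H`. -/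
noncomputable def H : WSpace F := (0, 1)

variable (F) in
/-- The action of `∂`. -/
noncomputable def D : WSpace F →ₗ[F] WSpace F :=
  (LinearMap.lsmul F[X] (WSpace F) Polynomial.X).restrictScalars F

theorem D_apply (x : WSpace F) : D F x = (Polynomial.X : F[X]) • x := rfl

/-- Multiplication by `λ + ∂` on `A[λ]`. -/
noncomputable def lamAddD (F : Type*) [Field F] : Module.End F (F[X] ⊗[F] WSpace F) :=
  (LinearMap.lsmul F[X] (F[X] ⊗[F] WSpace F) Polynomial.X).restrictScalars F
    + ((D F).baseChange F[X]).restrictScalars F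

theorem lamAddD_apply (v : F[X] ⊗[F] WSpace F) :
    lamAddD F v = (D F).baseChange F[X] v + (Polynomial.X : F[X]) • v := by
  simp [lamAddD, add_comm]

/-- `(p, r) ↦ p(-λ) r(λ + ∂) c`, the sesquilinear extension of a bracket with value `c`
on a pair of generators. -/
noncomputable def sesq (c : F[X] ⊗[F] WSpace F) : F[X] →ₗ[F] F[X] →ₗ[F] F[X] ⊗[F] WSpace F :=
  LinearMap.mk₂ F
    (fun p r => (p.comp (-Polynomial.X)) • (Polynomial.aeval (lamAddD F) r c))
    (by intro p p' r; simp [add_smul])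
    (by intro k p r; simp [Polynomial.smul_comp])
    (by intro p r r'; simp)
    (by intro k p r; rw [map_smul, LinearMap.smul_apply, smul_comm])

theorem sesq_apply (c : F[X] ⊗[F] WSpace F) (p r : F[X]) :
    sesq c p r = (p.comp (-Polynomial.X)) • (Polynomial.aeval (lamAddD F) r c) := rfl

theorem sesq_X_left (c : F[X] ⊗[F] WSpace F) (p r : F[X]) :
    sesq c (Polynomial.X * p) r = -((Polynomial.X : F[X]) • sesq c p r) := by
  simp only [sesq_apply, Polynomial.mul_comp, Polynomial.X_comp, mul_smul, neg_smul]

theorem lamAddD_smul (p : F[X]) (v : F[X] ⊗[F] WSpace F) :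
    lamAddD F (p • v) = p • lamAddD F v := by
  simp only [lamAddD_apply, map_smul, smul_add, smul_comm p]

theorem sesq_X_right (c : F[X] ⊗[F] WSpace F) (p r : F[X]) :
    sesq c p (Polynomial.X * r) =
      (D F).baseChange F[X] (sesq c p r) + (Polynomial.X : F[X]) • sesq c p r := by
  rw [← lamAddD_apply]
  simp [sesq_apply, lamAddD_smul]

theorem sesq_one_one (c : F[X] ⊗[F] WSpace F) : sesq c 1 1 = c := by
  simp [sesq_apply]

/-- The `λ`-bracket of `W(b)`: the sesquilinear map with
`[L_λ L] = (∂ + 2 λ) L`, `[L_λ H] = (∂ + (1 - b) λ) H`, `[H_λ L] = (-b ∂ + (1 - b) λ) H`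
and `[H_λ H] = 0`. -/
noncomputable def bracket (b : F) :
    WSpace F →ₗ[F] WSpace F →ₗ[F] F[X] ⊗[F] WSpace F :=
  (sesq (1 ⊗ₜ D F (L F) + (2 * Polynomial.X) ⊗ₜ L F)).compl₁₂
      (LinearMap.fst F F[X] F[X]) (LinearMap.fst F F[X] F[X])
    + (sesq (1 ⊗ₜ D F (H F) + (Polynomial.C (1 - b) * Polynomial.X) ⊗ₜ H F)).compl₁₂
      (LinearMap.fst F F[X] F[X]) (LinearMap.snd F F[X] F[X])
    + (sesq (Polynomial.C (-b) ⊗ₜ D F (H F) +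
        (Polynomial.C (1 - b) * Polynomial.X) ⊗ₜ H F)).compl₁₂
      (LinearMap.snd F F[X] F[X]) (LinearMap.fst F F[X] F[X])

theorem bracket_L_L (b : F) :
    bracket b (L F) (L F) = 1 ⊗ₜ D F (L F) + (2 * Polynomial.X) ⊗ₜ L F := by
  simp [bracket, L, H, sesq_one_one]

theorem bracket_L_H (b : F) :
    bracket b (L F) (H F) = 1 ⊗ₜ D F (H F) + (Polynomial.C (1 - b) * Polynomial.X) ⊗ₜ H F := by
  simp [bracket, L, H, sesq_one_one]

theorem bracket_H_L (b : F) :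
    bracket b (H F) (L F) =
      Polynomial.C (-b) ⊗ₜ D F (H F) + (Polynomial.C (1 - b) * Polynomial.X) ⊗ₜ H F := by
  simp [bracket, L, H, sesq_one_one]

theorem bracket_H_H (b : F) : bracket b (H F) (H F) = 0 := by
  simp [bracket, H]

theorem bracket_D_left (b : F) (x y : WSpace F) :
    bracket b (D F x) y = -((Polynomial.X : F[X]) • bracket b x y) := by
  simp [bracket, D_apply, sesq_X_left]
  abel

theorem bracket_D_right (b : F) (x y : WSpace F) :
    bracket b x (D F y) =
      (D F).baseChange F[X] (bracket b x y) + (Polynomial.X : F[X]) • bracket b x y := by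
  simp [bracket, D_apply, sesq_X_right]
  abel

theorem induct {motive : WSpace F → Prop} (hL : motive (L F)) (hH : motive (H F))
    (hadd : ∀ x y, motive x → motive y → motive (x + y))
    (hsmul : ∀ (c : F) x, motive x → motive (c • x))
    (hD : ∀ x, motive x → motive (D F x)) (x : WSpace F) : motive x := by
  have key : ∀ (p : F[X]) (y : WSpace F), motive y → motive (p • y) := by
    intro p y hy
    induction p using Polynomial.induction_on' with
    | add p q hp hq => rw [add_smul]; exact hadd _ _ hp hq
    | monomial n c =>
      rw [← Polynomial.C_mul_X_pow_eq_monomial, ← Polynomial.smul_eq_C_mul, smul_assoc]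
      refine hsmul _ _ ?_
      induction n with
      | zero => simpa using hy
      | succ n ih => rw [pow_succ', mul_smul]; exact hD _ ih
  have hx : x = x.1 • L F + x.2 • H F := by ext <;> simp [L, H]
  rw [hx]
  exact hadd _ _ (key _ _ hL) (key _ _ hH)

variable (F) in
/-- The constant polynomial `L` in `A[λ]`. -/
noncomputable def cL (P : Type*) [CommRing P] [Algebra F P] : P ⊗[F] WSpace F := 1 ⊗ₜ L F

variable (F) in
/-- The constant polynomial `H` in `A[λ]`. -/
noncomputable def cH (P : Type*) [CommRing P] [Algebra F P] : P ⊗[F] WSpace F := 1 ⊗ₜ H F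

theorem bracket_L_L' (b : F) : bracket b (L F) (L F) =
    (D F).baseChange F[X] (cL F F[X]) +
      ((Polynomial.X : F[X]) • cL F F[X] + (Polynomial.X : F[X]) • cL F F[X]) := by
  rw [bracket_L_L, cL, LinearMap.baseChange_tmul, TensorProduct.smul_tmul', ← TensorProduct.add_tmul]
  congr 2
  simp [two_mul]

theorem bracket_L_H' (b : F) : bracket b (L F) (H F) =
    (D F).baseChange F[X] (cH F F[X]) + (1 - b) • (Polynomial.X : F[X]) • cH F F[X] := by
  rw [bracket_L_H, cH, LinearMap.baseChange_tmul, TensorProduct.smul_tmul', TensorProduct.smul_tmul',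
    Polynomial.smul_eq_C_mul]
  simp

theorem bracket_H_L' (b : F) : bracket b (H F) (L F) =
    (-b) • (D F).baseChange F[X] (cH F F[X]) + (1 - b) • (Polynomial.X : F[X]) • cH F F[X] := by
  rw [bracket_H_L, cH, LinearMap.baseChange_tmul, TensorProduct.smul_tmul', TensorProduct.smul_tmul',
    TensorProduct.smul_tmul', Polynomial.smul_eq_C_mul, Polynomial.smul_eq_C_mul]
  simp

theorem substNeg_cL : substNegLamSubD (D F) (cL F F[X]) = cL F F[X] := by
  simp [cL, substNegLamSubD_tmul]

theorem substNeg_cH : substNegLamSubD (D F) (cH F F[X]) = cH F F[X] := by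
  simp [cH, substNegLamSubD_tmul]

theorem skew (b : F) (x y : WSpace F) :
    bracket b x y = -substNegLamSubD (D F) (bracket b y x) := by
  induction x using induct generalizing y with
  | hadd x x' h h' => simp only [map_add, LinearMap.add_apply, h y, h' y]; abel
  | hsmul c x h => simp only [map_smul, LinearMap.smul_apply, h y, smul_neg]
  | hD x h =>
    rw [bracket_D_left, bracket_D_right, h y, map_add, substNegLamSubD_baseChange,
      substNegLamSubD_X_smul, smul_neg]
    abel
  | hL =>
    induction y using induct with
    | hadd y y' h h' => simp only [map_add, LinearMap.add_apply, h, h']; abel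
    | hsmul c x h => simp only [map_smul, LinearMap.smul_apply, h, smul_neg]
    | hD x h =>
      rw [bracket_D_left, bracket_D_right, h, map_neg, map_neg, substNegLamSubD_X_smul]
      simp only [smul_neg]
      abel
    | hL =>
      simp only [bracket_L_L', map_add, substNegLamSubD_baseChange,
        substNegLamSubD_X_smul, substNeg_cL]
      module
    | hH =>
      simp only [bracket_L_H', bracket_H_L', map_add, map_smul, substNegLamSubD_baseChange,
        substNegLamSubD_X_smul, substNeg_cH]
      module
  | hH =>
    induction y using induct with
    | hadd y y' h h' => simp only [map_add, LinearMap.add_apply, h, h']; abel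
    | hsmul c x h => simp only [map_smul, LinearMap.smul_apply, h, smul_neg]
    | hD x h =>
      rw [bracket_D_left, bracket_D_right, h, map_neg, map_neg, substNegLamSubD_X_smul]
      simp only [smul_neg]
      abel
    | hL =>
      simp only [bracket_L_H', bracket_H_L', map_add, map_smul, substNegLamSubD_baseChange,
        substNegLamSubD_X_smul, substNeg_cH]
      module
    | hH => simp [bracket_H_H]

/-- The Jacobi identity for a triple of elements, with values `λ = p` and `μ = r`. -/
def Jac {P : Type*} [CommRing P] [Algebra F P] (b : F) (p r : P) (x y z : WSpace F) : Prop :=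
  actAt (bracket b) p x (evalAt _ r (bracket b y z)) =
    actLeftAt (bracket b) (p + r) z (evalAt _ p (bracket b x y)) +
    actAt (bracket b) r y (evalAt _ p (bracket b x z))

section Jac

variable {P : Type*} [CommRing P] [Algebra F P] {b : F} {p r : P}

theorem Jac.right {x y : WSpace F} (hL : Jac b p r x y (L F)) (hH : Jac b p r x y (H F))
    (z : WSpace F) : Jac b p r x y z := by
  induction z using induct with
  | hL => exact hL
  | hH => exact hH
  | hadd z z' h h' =>
    simp only [Jac] at *
    simp only [map_add, actLeftAt_add, h, h']; abel
  | hsmul c z h =>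
    simp only [Jac] at *
    simp only [map_smul, LinearMap.map_smul_of_tower, actLeftAt_smul, h, smul_add]
  | hD z h =>
    simp only [Jac] at *
    simp only [bracket_D_right, map_add, map_smul, evalAt_X_smul, evalAt_baseChange,
      actAt_baseChange (bracket_D_right b), actLeftAt_D (bracket_D_right b), h]
    module

theorem Jac.mid {x : WSpace F} (hL : ∀ z, Jac b p r x (L F) z) (hH : ∀ z, Jac b p r x (H F) z)
    (y z : WSpace F) : Jac b p r x y z := by
  induction y using induct with
  | hL => exact hL z
  | hH => exact hH z
  | hadd y y' h h' =>
    simp only [Jac] at *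
    simp only [map_add, LinearMap.add_apply, actAt_add, h, h']; abel
  | hsmul c y h =>
    simp only [Jac] at *
    simp only [map_smul, LinearMap.smul_apply, LinearMap.map_smul_of_tower, actAt_smul, h, smul_add]
  | hD y h =>
    simp only [Jac] at *
    simp only [bracket_D_left, bracket_D_right, map_add, map_neg, map_smul, evalAt_X_smul,
      evalAt_baseChange, actAt_D (bracket_D_left b), actLeftAt_baseChange (bracket_D_left b), h]
    module

theorem Jac.left (hL : ∀ y z, Jac b p r (L F) y z) (hH : ∀ y z, Jac b p r (H F) y z)
    (x y z : WSpace F) : Jac b p r x y z := by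
  induction x using induct with
  | hL => exact hL y z
  | hH => exact hH y z
  | hadd x x' h h' =>
    simp only [Jac] at *
    simp only [map_add, LinearMap.add_apply, actAt_add, h, h']; abel
  | hsmul c x h =>
    simp only [Jac] at *
    simp only [map_smul, LinearMap.smul_apply, LinearMap.map_smul_of_tower, actAt_smul, h, smul_add]
  | hD x h =>
    simp only [Jac] at *
    simp only [bracket_D_left, map_neg, map_smul, evalAt_X_smul, actAt_D (bracket_D_left b), h]
    module

end Jac

theorem evalAt_cL {P : Type*} [CommRing P] [Algebra F P] (p : P) :
    evalAt (WSpace F) p (cL F F[X]) = cL F P := by simp [cL, evalAt_tmul]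

theorem evalAt_cH {P : Type*} [CommRing P] [Algebra F P] (p : P) :
    evalAt (WSpace F) p (cH F F[X]) = cH F P := by simp [cH, evalAt_tmul]

theorem jacobi {P : Type*} [CommRing P] [Algebra F P] (b : F) (p r : P) (x y z : WSpace F) :
    Jac b p r x y z := by
  have h1 : ∀ (p : P) (a : WSpace F),
      actAt (bracket b) p a (cL F P) = evalAt _ p (bracket b a (L F)) := by
    intro p a; simp [cL, actAt_tmul]
  have h2 : ∀ (p : P) (a : WSpace F),
      actAt (bracket b) p a (cH F P) = evalAt _ p (bracket b a (H F)) := by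
    intro p a; simp [cH, actAt_tmul]
  have h3 : ∀ (p : P) (a : WSpace F),
      actLeftAt (bracket b) p a (cL F P) = evalAt _ p (bracket b (L F) a) := by
    intro p a; simp [cL, actLeftAt_tmul]
  have h4 : ∀ (p : P) (a : WSpace F),
      actLeftAt (bracket b) p a (cH F P) = evalAt _ p (bracket b (H F) a) := by
    intro p a; simp [cH, actLeftAt_tmul]
  refine Jac.left (fun y z => Jac.mid (fun z => Jac.right ?_ ?_ z) (fun z => Jac.right ?_ ?_ z) y z)
    (fun y z => Jac.mid (fun z => Jac.right ?_ ?_ z) (fun z => Jac.right ?_ ?_ z) y z) x y z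
  all_goals
    simp only [Jac, bracket_L_L', bracket_L_H', bracket_H_L', bracket_H_H, map_add, map_smul, map_zero,
      LinearMap.map_smul_of_tower, evalAt_X_smul, evalAt_baseChange, evalAt_cL, evalAt_cH,
      actAt_baseChange (bracket_D_right b), actLeftAt_baseChange (bracket_D_left b), h1, h2, h3, h4]
    module

end WSpace

/-- The Lie conformal algebra `W(b)`. -/
noncomputable def WAlg (F : Type*) [Field F] (b : F) : LieConformalAlgebra F (WSpace F) where
  D := WSpace.D F
  bracket := WSpace.bracket b
  bracket_D_left := WSpace.bracket_D_left b
  bracket_D_right := WSpace.bracket_D_right b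
  skew := WSpace.skew b
  jacobi := WSpace.jacobi b _ _

end WAlgebra


/-! ## The basic and the reduced complex -/

/-- `F`-linear maps `A^{⊗ q} → M[λ₁, …, λ_q]`. -/
abbrev PreCochain (F : Type*) [Field F] (A : Type*) [AddCommGroup A] [Module F A]
    (M : Type*) [AddCommGroup M] [Module F M] (q : ℕ) : Type _ :=
  MultilinearMap F (fun _ : Fin q => A) (MvPolynomial (Fin q) F ⊗[F] M)

noncomputable instance PreCochain.addCommGroupSubmodule {F : Type*} [Field F] {A : Type*}
    [AddCommGroup A] [Module F A] {M : Type*} [AddCommGroup M] [Module F M] {q : ℕ}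
    (S : Submodule F (PreCochain F A M q)) : AddCommGroup S :=
  @Submodule.addCommGroup F (PreCochain F A M q) _ MultilinearMap.instAddCommGroup _ S

section Complex

variable {F : Type*} [Field F] {A : Type*} [AddCommGroup A] [Module F A]
  {𝒜 : LieConformalAlgebra F A} {M : Type*} [AddCommGroup M] [Module F M]

namespace LCModule

/-- The space of `q`-cochains of the basic complex: conformally antilinear and skew-symmetric
maps. The variables `λ_i` are permuted together with the arguments `a_i`. -/
noncomputable def cochains (_ℳ : LCModule 𝒜 M) (q : ℕ) : Submodule F (PreCochain F A M q) where
  carrier := {f |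
    (∀ (a : Fin q → A) (i : Fin q),
      f (Function.update a i (𝒜.D (a i))) = -((MvPolynomial.X i : MvPolynomial (Fin q) F) • f a)) ∧
    (∀ (σ : Equiv.Perm (Fin q)) (a : Fin q → A),
      substVars M (MvPolynomial.rename σ) (f (a ∘ σ)) = ((Equiv.Perm.sign σ : ℤ) : F) • f a)}
  zero_mem' := by constructor <;> simp
  add_mem' := by
    rintro f g ⟨hf, hf'⟩ ⟨hg, hg'⟩
    constructor
    · intro a i
      simp only [add_apply, hf, hg, smul_add, neg_add]
    · intro σ a
      simp only [add_apply, map_add, hf', hg', smul_add]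
  smul_mem' := by
    rintro c f ⟨hf, hf'⟩
    constructor
    · intro a i
      simp only [smul_apply, hf, smul_neg, smul_comm c]
    · intro σ a
      simp only [smul_apply, map_smul, hf', smul_comm c]

theorem cochains_D {ℳ : LCModule 𝒜 M} {q : ℕ} {f : PreCochain F A M q} (hf : f ∈ ℳ.cochains q)
    (a : Fin q → A) (i : Fin q) :
    f (Function.update a i (𝒜.D (a i))) = -((MvPolynomial.X i : MvPolynomial (Fin q) F) • f a) :=
  hf.1 a i

theorem cochains_skew {ℳ : LCModule 𝒜 M} {q : ℕ} {f : PreCochain F A M q} (hf : f ∈ ℳ.cochains q)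
    (σ : Equiv.Perm (Fin q)) (a : Fin q → A) :
    substVars M (MvPolynomial.rename σ) (f (a ∘ σ)) = ((Equiv.Perm.sign σ : ℤ) : F) • f a :=
  hf.2 σ a

/-! ### The first sum of the differential -/

/-- The map `f ↦ a_{k, λ_k} f_{λ_1, …, λ̂_k, …, λ_{q+1}}(a_1, …, â_k, …, a_{q+1})`. -/
noncomputable def actTerm (ℳ : LCModule 𝒜 M) {q : ℕ} (k : Fin (q + 1)) :
    PreCochain F A M q →ₗ[F] PreCochain F A M (q + 1) where
  toFun f := MultilinearMap.mk'
    (fun a => actAt ℳ.act (MvPolynomial.X k : MvPolynomial (Fin (q + 1)) F) (a k)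
      (substVars M (MvPolynomial.rename k.succAbove) (f (k.removeNth a))))
    (by
      intro a i x y
      rcases Fin.eq_self_or_eq_succAbove k i with rfl | ⟨j, rfl⟩
      · simp [actAt_add]
      · simp [Fin.removeNth_update_succAbove])
    (by
      intro a i c x
      rcases Fin.eq_self_or_eq_succAbove k i with rfl | ⟨j, rfl⟩
      · simp [actAt_smul]
      · simp [Fin.removeNth_update_succAbove, LinearMap.map_smul_of_tower])
  map_add' f g := by ext a; simp
  map_smul' c f := by ext a; simp [LinearMap.map_smul_of_tower]

theorem actTerm_apply (ℳ : LCModule 𝒜 M) {q : ℕ} (k : Fin (q + 1)) (f : PreCochain F A M q)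
    (a : Fin (q + 1) → A) :
    ℳ.actTerm k f a = actAt ℳ.act (MvPolynomial.X k : MvPolynomial (Fin (q + 1)) F) (a k)
      (substVars M (MvPolynomial.rename k.succAbove) (f (k.removeNth a))) := rfl

/-! ### The second sum of the differential -/

/-- `x ↦ f(x, v_1, …, v_r)`. -/
noncomputable def insertFirst {r : ℕ} (f : PreCochain F A M (r + 1)) (v : Fin r → A) :
    A →ₗ[F] MvPolynomial (Fin (r + 1)) F ⊗[F] M where
  toFun x := f (Fin.cons x v)
  map_add' x y := f.cons_add v x y
  map_smul' c x := f.cons_smul v c x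

/-- `u ↦ f(u, v_1, …, v_r)` with the variables of `f` substituted by `e`, extended `P`-linearly to
`u ∈ P ⊗ A`. -/
noncomputable def insertAt {P : Type*} [CommRing P] [Algebra F P] {r : ℕ}
    (e : MvPolynomial (Fin (r + 1)) F →ₐ[F] P) (f : PreCochain F A M (r + 1)) (v : Fin r → A) :
    P ⊗[F] A →ₗ[P] P ⊗[F] M :=
  LinearMap.liftBaseChange P (substVars M e ∘ₗ insertFirst f v)

section insertAt

variable {P : Type*} [CommRing P] [Algebra F P] {r : ℕ}
    (e : MvPolynomial (Fin (r + 1)) F →ₐ[F] P) (f : PreCochain F A M (r + 1)) (v : Fin r → A)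

theorem insertAt_tmul (p : P) (x : A) :
    insertAt e f v (p ⊗ₜ x) = p • substVars M e (f (Fin.cons x v)) := by
  simp [insertAt, insertFirst]

theorem insertAt_update_add (j : Fin r) (x y : A) (u : P ⊗[F] A) :
    insertAt e f (Function.update v j (x + y)) u =
      insertAt e f (Function.update v j x) u + insertAt e f (Function.update v j y) u := by
  induction u with
  | zero => simp
  | add u u' hu hu' => simp only [map_add, hu, hu']; abel
  | tmul p z => simp [insertAt_tmul, Fin.cons_update]

theorem insertAt_update_smul (j : Fin r) (c : F) (x : A) (u : P ⊗[F] A) :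
    insertAt e f (Function.update v j (c • x)) u =
      c • insertAt e f (Function.update v j x) u := by
  induction u with
  | zero => simp
  | add u u' hu hu' => simp only [map_add, hu, hu', smul_add]
  | tmul p z => simp [insertAt_tmul, Fin.cons_update, smul_comm p c]

theorem insertAt_add (g : PreCochain F A M (r + 1)) (u : P ⊗[F] A) :
    insertAt e (f + g) v u = insertAt e f v u + insertAt e g v u := by
  induction u with
  | zero => simp
  | add u u' hu hu' => simp only [map_add, hu, hu']; abel
  | tmul p z => simp [insertAt_tmul]

theorem insertAt_smul (c : F) (u : P ⊗[F] A) :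
    insertAt e (c • f) v u = c • insertAt e f v u := by
  induction u with
  | zero => simp
  | add u u' hu hu' => simp only [map_add, hu, hu', smul_add]
  | tmul p z => simp [insertAt_tmul, smul_comm p c]

end insertAt

/-- The substitution of variables `(λ_k + λ_l, λ_1, …, λ̂_k, …, λ̂_l, …, λ_{r+2})`, where the
index `k` is written as `l.succAbove k`. -/
noncomputable def pairVars (F : Type*) [Field F] {r : ℕ} (l : Fin (r + 2)) (k : Fin (r + 1)) :
    MvPolynomial (Fin (r + 1)) F →ₐ[F] MvPolynomial (Fin (r + 2)) F :=
  MvPolynomial.aeval (Fin.cons (MvPolynomial.X (l.succAbove k) + MvPolynomial.X l)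
    (fun j => MvPolynomial.X (l.succAbove (k.succAbove j))) : Fin (r + 1) → _)

/-- The map `f ↦ f_{λ_k + λ_l, λ_1, …, λ̂_k, …, λ̂_l, …}([a_{k, λ_k} a_l], a_1, …, â_k, …, â_l, …)`,
where the index `k` is written as `l.succAbove k`. -/
noncomputable def bracketTerm (_ℳ : LCModule 𝒜 M) {r : ℕ} (l : Fin (r + 2)) (k : Fin (r + 1)) :
    PreCochain F A M (r + 1) →ₗ[F] PreCochain F A M (r + 2) where
  toFun f := MultilinearMap.mk'
    (fun a => insertAt (pairVars F l k) f (k.removeNth (l.removeNth a))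
      (evalAt A (MvPolynomial.X (l.succAbove k) : MvPolynomial (Fin (r + 2)) F)
        (𝒜.bracket (a (l.succAbove k)) (a l))))
    (by
      intro a i x y
      rcases Fin.eq_self_or_eq_succAbove l i with rfl | ⟨i, rfl⟩
      · simp [Fin.succAbove_ne]
      · rcases Fin.eq_self_or_eq_succAbove k i with rfl | ⟨j, rfl⟩
        · simp [Fin.removeNth_update_succAbove, (Fin.succAbove_ne _ _).symm]
        · simp [Fin.removeNth_update_succAbove, insertAt_update_add,
            (Fin.succAbove_ne _ _).symm])
    (by
      intro a i c x
      rcases Fin.eq_self_or_eq_succAbove l i with rfl | ⟨i, rfl⟩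
      · simp [Fin.succAbove_ne, LinearMap.map_smul_of_tower]
      · rcases Fin.eq_self_or_eq_succAbove k i with rfl | ⟨j, rfl⟩
        · simp [Fin.removeNth_update_succAbove, (Fin.succAbove_ne _ _).symm,
            LinearMap.map_smul_of_tower]
        · simp [Fin.removeNth_update_succAbove, insertAt_update_smul,
            (Fin.succAbove_ne _ _).symm])
  map_add' f g := by ext a; simp [insertAt_add]
  map_smul' c f := by ext a; simp [insertAt_smul]

theorem bracketTerm_apply (ℳ : LCModule 𝒜 M) {r : ℕ} (l : Fin (r + 2)) (k : Fin (r + 1))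
    (f : PreCochain F A M (r + 1)) (a : Fin (r + 2) → A) :
    ℳ.bracketTerm l k f a = insertAt (pairVars F l k) f (k.removeNth (l.removeNth a))
      (evalAt A (MvPolynomial.X (l.succAbove k) : MvPolynomial (Fin (r + 2)) F)
        (𝒜.bracket (a (l.succAbove k)) (a l))) := rfl

/-- The second sum of the differential. A pair `k < l` of indices in `Fin (r + 2)` is written as
`k.castSucc < l` with `k : Fin (r + 1)`; then `l.succAbove k = k.castSucc`. -/
noncomputable def bracketSum (ℳ : LCModule 𝒜 M) : ∀ q : ℕ,
    PreCochain F A M q →ₗ[F] PreCochain F A M (q + 1)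
  | 0 => 0
  | r + 1 => ∑ l : Fin (r + 2), ∑ k : Fin (r + 1),
      if k.castSucc < l then ((-1 : F) ^ ((k : ℕ) + (l : ℕ))) • ℳ.bracketTerm l k else 0

/-- The differential, on all multilinear maps. Indices start at `0`, so the sign of the term with
index `k` in the first sum is `(-1) ^ k`, and that of the term `(k, l)` in the second is
`(-1) ^ (k + l)`. -/
noncomputable def preD (ℳ : LCModule 𝒜 M) (q : ℕ) :
    PreCochain F A M q →ₗ[F] PreCochain F A M (q + 1) :=
  (∑ k : Fin (q + 1), ((-1 : F) ^ (k : ℕ)) • ℳ.actTerm k) + ℳ.bracketSum q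

/-- `(∂ f)_{λ_1, …, λ_q} = (∂^M + λ_1 + … + λ_q) f_{λ_1, …, λ_q}`, on all multilinear maps. -/
noncomputable def preDel (ℳ : LCModule 𝒜 M) (q : ℕ) :
    PreCochain F A M q →ₗ[F] PreCochain F A M q where
  toFun f := ((ℳ.D.baseChange (MvPolynomial (Fin q) F) +
    LinearMap.lsmul (MvPolynomial (Fin q) F) _ (∑ k, MvPolynomial.X k)).restrictScalars
      F).compMultilinearMap f
  map_add' f g := by ext a; simp
  map_smul' c f := by ext a; simp

theorem preDel_apply (ℳ : LCModule 𝒜 M) {q : ℕ} (f : PreCochain F A M q) (a : Fin q → A) :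
    ℳ.preDel q f a = ℳ.D.baseChange (MvPolynomial (Fin q) F) (f a) +
      (∑ k, MvPolynomial.X k : MvPolynomial (Fin q) F) • f a := by
  simp [preDel, Finset.sum_smul]

/-! ### The differential and `∂` preserve cochains -/

/-- Every permutation restricts to the complement of a point. -/
theorem exists_perm_succAbove {n : ℕ} (σ : Equiv.Perm (Fin (n + 1))) (k : Fin (n + 1)) :
    ∃ τ : Equiv.Perm (Fin n), (∀ j, σ (k.succAbove j) = (σ k).succAbove (τ j)) ∧
      (Equiv.Perm.sign σ : ℤ) = (-1) ^ (k : ℕ) * (-1) ^ (σ k : ℕ) * (Equiv.Perm.sign τ : ℤ) := by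
  obtain ⟨⟨p, τ⟩, h⟩ := Equiv.Perm.decomposeFin.symm.surjective
    ((σ k).cycleRange * σ * k.cycleRange⁻¹)
  have hp : p = 0 := by
    have := congrArg (fun ρ => ρ 0) h
    simpa [Equiv.Perm.inv_def] using this
  subst hp
  refine ⟨τ, fun j => ?_, ?_⟩
  · have := congrArg (fun ρ => (σ k).cycleRange.symm (ρ j.succ)) h
    simpa [Equiv.Perm.inv_def] using this.symm
  · have := congrArg (fun ρ => (Equiv.Perm.sign ρ : ℤ)) h
    simp only [Equiv.Perm.decomposeFin.symm_sign, Equiv.Perm.sign_mul, Equiv.Perm.sign_inv,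
      Fin.sign_cycleRange, if_true, one_mul] at this
    rw [this]
    push_cast
    have h1 : ((-1 : ℤ) ^ (k : ℕ)) * (-1) ^ (k : ℕ) = 1 := by rw [← mul_pow]; simp
    have h2 : ((-1 : ℤ) ^ (σ k : ℕ)) * (-1) ^ (σ k : ℕ) = 1 := by rw [← mul_pow]; simp
    linear_combination (-(Equiv.Perm.sign σ : ℤ) * (-1) ^ (σ k : ℕ) * (-1) ^ (σ k : ℕ)) * h1 -
      (Equiv.Perm.sign σ : ℤ) * h2

theorem actAt_smul_coeff {P : Type*} [CommRing P] [Algebra F P]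
    (φ : A →ₗ[F] M →ₗ[F] F[X] ⊗[F] M) (p : P) (a : A) (c : P) (v : P ⊗[F] M) :
    actAt φ p a (c • v) = c • actAt φ p a v := LinearMap.map_smul _ _ _

theorem baseChange_smul_coeff {P : Type*} [CommRing P] [Algebra F P]
    (D : M →ₗ[F] M) (c : P) (v : P ⊗[F] M) :
    D.baseChange P (c • v) = c • D.baseChange P v := LinearMap.map_smul _ _ _

theorem actAt_smul_scalar {P : Type*} [CommRing P] [Algebra F P]
    (φ : A →ₗ[F] M →ₗ[F] F[X] ⊗[F] M) (p : P) (a : A) (c : F) (v : P ⊗[F] M) :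
    actAt φ p a (c • v) = c • actAt φ p a v := LinearMap.map_smul_of_tower _ _ _

theorem substVars_smul_scalar {P P' : Type*} [CommRing P] [Algebra F P] [CommRing P']
    [Algebra F P'] (e : P →ₐ[F] P') (c : F) (v : P ⊗[F] M) :
    substVars M e (c • v) = c • substVars M e v := LinearMap.map_smul _ _ _

theorem actTerm_D (ℳ : LCModule 𝒜 M) {q : ℕ} (k : Fin (q + 1)) {f : PreCochain F A M q}
    (hf : f ∈ ℳ.cochains q) (a : Fin (q + 1) → A) (i : Fin (q + 1)) :
    ℳ.actTerm k f (Function.update a i (𝒜.D (a i))) =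
      -((MvPolynomial.X i : MvPolynomial (Fin (q + 1)) F) • ℳ.actTerm k f a) := by
  rcases Fin.eq_self_or_eq_succAbove k i with rfl | ⟨j, rfl⟩
  · simp [actTerm_apply, actAt_D ℳ.act_D_left]
  · have h := cochains_D hf (k.removeNth a) j
    simp only [actTerm_apply, Fin.removeNth_update_succAbove]
    rw [show 𝒜.D (a (k.succAbove j)) = 𝒜.D (k.removeNth a j) from rfl, h]
    rw [Function.update_of_ne (Fin.succAbove_ne _ _).symm, map_neg, map_neg, substVars_smul,
      actAt_smul_coeff, MvPolynomial.rename_X]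

theorem actTerm_skew (ℳ : LCModule 𝒜 M) {q : ℕ} (k : Fin (q + 1)) {f : PreCochain F A M q}
    (hf : f ∈ ℳ.cochains q) (σ : Equiv.Perm (Fin (q + 1))) (a : Fin (q + 1) → A) :
    substVars M (MvPolynomial.rename σ) (((-1 : F) ^ (k : ℕ)) • ℳ.actTerm k f (a ∘ σ)) =
      ((Equiv.Perm.sign σ : ℤ) : F) • ((-1 : F) ^ (σ k : ℕ)) • ℳ.actTerm (σ k) f a := by
  obtain ⟨τ, hτ, hs⟩ := exists_perm_succAbove σ k
  have h1 : k.removeNth (a ∘ σ) = (σ k).removeNth a ∘ τ := by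
    funext j; simp [Fin.removeNth, hτ]
  have h2 : (MvPolynomial.rename (R := F) σ).comp (MvPolynomial.rename k.succAbove) =
      (MvPolynomial.rename (σ k).succAbove).comp (MvPolynomial.rename τ) := by
    ext j; simp [hτ]
  rw [substVars_smul_scalar, actTerm_apply, substVars_actAt, h1, substVars_substVars, h2, ← substVars_substVars,
    cochains_skew hf, substVars_smul_scalar, actAt_smul_scalar, hs,
    smul_smul (M := F), smul_smul (M := F)]
  simp only [Function.comp_apply, MvPolynomial.rename_X, actTerm_apply]
  congr 1
  push_cast
  have h2 : ((-1 : F) ^ (σ k : ℕ)) * (-1) ^ (σ k : ℕ) = 1 := by rw [← mul_pow]; simp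
  linear_combination (-(-1 : F) ^ (k : ℕ) * (Equiv.Perm.sign τ : ℤ)) * h2

section insertAt

variable {P : Type*} [CommRing P] [Algebra F P] {r : ℕ}
    (e : MvPolynomial (Fin (r + 1)) F →ₐ[F] P) {f : PreCochain F A M (r + 1)} (v : Fin r → A)

theorem insertAt_D {ℳ : LCModule 𝒜 M} (hf : f ∈ ℳ.cochains (r + 1)) (j : Fin r)
    (u : P ⊗[F] A) :
    insertAt e f (Function.update v j (𝒜.D (v j))) u =
      -(e (MvPolynomial.X j.succ) • insertAt e f v u) := by
  induction u with
  | zero => simp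
  | add u u' hu hu' => simp only [map_add, hu, hu', smul_add, neg_add]
  | tmul p z =>
    have h := cochains_D hf (Fin.cons z v : Fin (r + 1) → A) j.succ
    rw [← Fin.cons_update, Fin.cons_succ] at h
    rw [insertAt_tmul, h, insertAt_tmul, map_neg, substVars_smul, smul_neg, smul_comm p]

theorem insertAt_baseChange {ℳ : LCModule 𝒜 M} (hf : f ∈ ℳ.cochains (r + 1))
    (u : P ⊗[F] A) :
    insertAt e f v (𝒜.D.baseChange P u) = -(e (MvPolynomial.X 0) • insertAt e f v u) := by
  induction u with
  | zero => simp
  | add u u' hu hu' => simp only [map_add, hu, hu', smul_add, neg_add]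
  | tmul p z =>
    have h := cochains_D hf (Fin.cons z v : Fin (r + 1) → A) 0
    rw [Fin.update_cons_zero, Fin.cons_zero] at h
    rw [LinearMap.baseChange_tmul, insertAt_tmul, h, insertAt_tmul, map_neg, substVars_smul,
      smul_neg, smul_comm p]

theorem insertAt_substNeg {ℳ : LCModule 𝒜 M} (hf : f ∈ ℳ.cochains (r + 1)) {p s : P}
    (hps : p + s = e (MvPolynomial.X 0)) (w : F[X] ⊗[F] A) :
    insertAt e f v (evalAt A p (substNegLamSubD 𝒜.D w)) = insertAt e f v (evalAt A s w) := by
  have hX : ∀ w : F[X] ⊗[F] A,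
      insertAt e f v (evalAt A p (substNegLamSubD 𝒜.D w)) = insertAt e f v (evalAt A s w) →
      insertAt e f v (evalAt A p (substNegLamSubD 𝒜.D ((Polynomial.X : F[X]) • w))) =
        insertAt e f v (evalAt A s ((Polynomial.X : F[X]) • w)) := by
    intro w h
    simp only [substNegLamSubD_X_smul, map_sub, map_neg, evalAt_X_smul, evalAt_baseChange,
      insertAt_baseChange e v hf, map_smul, h, ← hps]
    module
  induction w with
  | zero => simp
  | add u u' hu hu' => simp only [map_add, hu, hu']
  | tmul g z =>
    induction g using Polynomial.induction_on' with
    | add g g' hg hg' => simp only [TensorProduct.add_tmul, map_add, hg, hg']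
    | monomial n c =>
      rw [← Polynomial.C_mul_X_pow_eq_monomial, ← Polynomial.smul_eq_C_mul]
      rw [← TensorProduct.smul_tmul']
      simp only [map_smul, LinearMap.map_smul_of_tower]
      congr 1
      induction n with
      | zero => simp [substNegLamSubD_tmul, evalAt_tmul]
      | succ n ih => rw [pow_succ', ← smul_eq_mul, ← TensorProduct.smul_tmul']; exact hX _ ih

theorem substVars_insertAt {P' : Type*} [CommRing P'] [Algebra F P'] (e' : P →ₐ[F] P')
    (u : P ⊗[F] A) :
    substVars M e' (insertAt e f v u) = insertAt (e'.comp e) f v (substVars A e' u) := by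
  induction u with
  | zero => simp
  | add u u' hu hu' => simp only [map_add, hu, hu']
  | tmul p z => simp only [insertAt_tmul, substVars_smul, substVars_substVars, substVars_tmul]

theorem insertAt_perm {ℳ : LCModule 𝒜 M} (hf : f ∈ ℳ.cochains (r + 1)) (τ : Equiv.Perm (Fin r))
    (u : P ⊗[F] A) :
    insertAt (e.comp (MvPolynomial.rename (Equiv.Perm.decomposeFin.symm (0, τ)))) f (v ∘ τ) u =
      ((Equiv.Perm.sign τ : ℤ) : F) • insertAt e f v u := by
  induction u with
  | zero => simp
  | add u u' hu hu' => simp only [map_add, hu, hu', smul_add]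
  | tmul p z =>
    have h := cochains_skew hf (Equiv.Perm.decomposeFin.symm (0, τ))
      (Fin.cons z v : Fin (r + 1) → A)
    have h2 : (Fin.cons z v : Fin (r + 1) → A) ∘ (Equiv.Perm.decomposeFin.symm (0, τ)) =
        Fin.cons z (v ∘ τ) := by
      funext j
      refine Fin.cases ?_ (fun j => ?_) j <;> simp
    rw [h2] at h
    rw [insertAt_tmul, insertAt_tmul, ← substVars_substVars, h]
    simp [smul_comm p]

end insertAt

theorem pairVars_zero {r : ℕ} (l : Fin (r + 2)) (k : Fin (r + 1)) :
    pairVars F l k (MvPolynomial.X 0) = MvPolynomial.X (l.succAbove k) + MvPolynomial.X l := by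
  simp [pairVars]

theorem pairVars_succ {r : ℕ} (l : Fin (r + 2)) (k : Fin (r + 1)) (j : Fin r) :
    pairVars F l k (MvPolynomial.X j.succ) = MvPolynomial.X (l.succAbove (k.succAbove j)) := by
  simp [pairVars]

theorem bracketTerm_D (ℳ : LCModule 𝒜 M) {r : ℕ} (l : Fin (r + 2)) (k : Fin (r + 1))
    {f : PreCochain F A M (r + 1)} (hf : f ∈ ℳ.cochains (r + 1)) (a : Fin (r + 2) → A)
    (i : Fin (r + 2)) :
    ℳ.bracketTerm l k f (Function.update a i (𝒜.D (a i))) =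
      -((MvPolynomial.X i : MvPolynomial (Fin (r + 2)) F) • ℳ.bracketTerm l k f a) := by
  rcases Fin.eq_self_or_eq_succAbove l i with rfl | ⟨i, rfl⟩
  · simp only [bracketTerm_apply, Fin.removeNth_update, Function.update_self,
      Function.update_of_ne (Fin.succAbove_ne _ _), 𝒜.bracket_D_right, map_add,
      evalAt_X_smul, evalAt_baseChange, map_smul, insertAt_baseChange _ _ hf, pairVars_zero]
    module
  · rcases Fin.eq_self_or_eq_succAbove k i with rfl | ⟨j, rfl⟩
    · simp only [bracketTerm_apply, Fin.removeNth_update_succAbove, Fin.removeNth_update,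
        Function.update_self,
        Function.update_of_ne (Fin.succAbove_ne _ _).symm, 𝒜.bracket_D_left, map_neg,
        evalAt_X_smul, map_smul]
    · have h := insertAt_D (pairVars F l k) (k.removeNth (l.removeNth a)) hf j
        (evalAt A (MvPolynomial.X (l.succAbove k) : MvPolynomial (Fin (r + 2)) F)
          (𝒜.bracket (a (l.succAbove k)) (a l)))
      rw [pairVars_succ] at h
      rw [bracketTerm_apply, bracketTerm_apply, ← h]
      have h3 : l.succAbove k ≠ l.succAbove (k.succAbove j) := by simp
      rw [Function.update_of_ne h3, Function.update_of_ne (Fin.succAbove_ne _ _).symm,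
        Fin.removeNth_update_succAbove, Fin.removeNth_update_succAbove]
      rfl

/-- Exchanging the two indices `k` and `l` in the second sum. -/
theorem bracketTerm_swap (ℳ : LCModule 𝒜 M) {r : ℕ} (l : Fin (r + 2)) (k : Fin (r + 1))
    {f : PreCochain F A M (r + 1)} (hf : f ∈ ℳ.cochains (r + 1)) (a : Fin (r + 2) → A) :
    ℳ.bracketTerm (l.succAbove k) (k.predAbove l) f a = -ℳ.bracketTerm l k f a := by
  have h1 : (k.predAbove l).removeNth ((l.succAbove k).removeNth a) =
      k.removeNth (l.removeNth a) := by
    funext j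
    simp [Fin.removeNth, Fin.succAbove_succAbove_succAbove_predAbove]
  have h2 : pairVars F (l.succAbove k) (k.predAbove l) = pairVars F l k := by
    ext j
    refine Fin.cases ?_ (fun j => ?_) j
    · rw [pairVars_zero, pairVars_zero, Fin.succAbove_succAbove_predAbove,
        add_comm (MvPolynomial.X l)]
    · simp [pairVars_succ, Fin.succAbove_succAbove_succAbove_predAbove]
  rw [bracketTerm_apply, bracketTerm_apply, h1, h2, Fin.succAbove_succAbove_predAbove,
    𝒜.skew, map_neg, map_neg,
    insertAt_substNeg _ _ hf (s := MvPolynomial.X (l.succAbove k))]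
  rw [pairVars_zero, add_comm (MvPolynomial.X l)]

theorem bracketTerm_skew (ℳ : LCModule 𝒜 M) {r : ℕ} (l : Fin (r + 2)) (k : Fin (r + 1))
    {f : PreCochain F A M (r + 1)} (hf : f ∈ ℳ.cochains (r + 1))
    (σ : Equiv.Perm (Fin (r + 2))) (σl : Equiv.Perm (Fin (r + 1)))
    (hσl : ∀ j, σ (l.succAbove j) = (σ l).succAbove (σl j))
    (hs : (Equiv.Perm.sign σ : ℤ) = (-1) ^ (l : ℕ) * (-1) ^ (σ l : ℕ) * (Equiv.Perm.sign σl : ℤ))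
    (a : Fin (r + 2) → A) :
    substVars M (MvPolynomial.rename σ)
        (((-1 : F) ^ ((k : ℕ) + (l : ℕ))) • ℳ.bracketTerm l k f (a ∘ σ)) =
      ((Equiv.Perm.sign σ : ℤ) : F) • ((-1 : F) ^ ((σl k : ℕ) + (σ l : ℕ))) •
        ℳ.bracketTerm (σ l) (σl k) f a := by
  obtain ⟨τ, hτ, hs'⟩ := exists_perm_succAbove σl k
  have h1 : k.removeNth (l.removeNth (a ∘ σ)) =
      (σl k).removeNth ((σ l).removeNth a) ∘ τ := by
    funext j; simp [Fin.removeNth, hσl, hτ]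
  have h2 : (MvPolynomial.rename (R := F) σ).comp (pairVars F l k) =
      (pairVars F (σ l) (σl k)).comp
        (MvPolynomial.rename (Equiv.Perm.decomposeFin.symm (0, τ))) := by
    ext j
    refine Fin.cases ?_ (fun j => ?_) j
    · simp [pairVars_zero, hσl]
    · simp [pairVars_succ, hσl, hτ]
  rw [map_smul, bracketTerm_apply, substVars_insertAt, h1, h2, insertAt_perm _ _ hf,
    substVars_evalAt, hs, hs', smul_smul, smul_smul]
  simp only [Function.comp_apply, MvPolynomial.rename_X, bracketTerm_apply, hσl]
  congr 1
  push_cast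
  have h3 : ((-1 : F) ^ (σ l : ℕ)) * (-1) ^ (σ l : ℕ) = 1 := by rw [← mul_pow]; simp
  have h4 : ((-1 : F) ^ (σl k : ℕ)) * (-1) ^ (σl k : ℕ) = 1 := by rw [← mul_pow]; simp
  rw [pow_add, pow_add]
  linear_combination (-(-1 : F) ^ (k : ℕ) * (-1) ^ (l : ℕ) * (Equiv.Perm.sign τ : ℤ)) * h3 -
    (((-1 : F) ^ (k : ℕ) * (-1) ^ (l : ℕ) * (Equiv.Perm.sign τ : ℤ)) *
      ((-1) ^ (σ l : ℕ) * (-1) ^ (σ l : ℕ))) * h4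

/-- Twice the second sum is the sum over all pairs of distinct indices. -/
theorem two_smul_bracketSum (ℳ : LCModule 𝒜 M) {r : ℕ}
    {f : PreCochain F A M (r + 1)} (hf : f ∈ ℳ.cochains (r + 1)) (a : Fin (r + 2) → A) :
    (2 : F) • ℳ.bracketSum (r + 1) f a = ∑ p : Fin (r + 2) × Fin (r + 1),
      ((-1 : F) ^ ((p.2 : ℕ) + (p.1 : ℕ))) • ℳ.bracketTerm p.1 p.2 f a := by
  set T : Fin (r + 2) × Fin (r + 1) → MvPolynomial (Fin (r + 2)) F ⊗[F] M := fun p =>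
    ((-1 : F) ^ ((p.2 : ℕ) + (p.1 : ℕ))) • ℳ.bracketTerm p.1 p.2 f a with hT
  let ι : Fin (r + 2) × Fin (r + 1) → Fin (r + 2) × Fin (r + 1) :=
    fun p => (p.1.succAbove p.2, p.2.predAbove p.1)
  have hι : Function.Involutive ι := by
    rintro ⟨l, k⟩
    simp [ι, Fin.succAbove_succAbove_predAbove, Fin.predAbove_predAbove_succAbove]
  have hTι : ∀ p, T (ι p) = T p := by
    rintro ⟨l, k⟩
    simp only [hT, ι]
    rw [bracketTerm_swap ℳ l k hf, add_comm ((k.predAbove l : Fin (r + 1)) : ℕ),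
      Fin.neg_one_pow_succAbove_add_predAbove]
    simp [pow_add, mul_comm]
  have hlt : ∀ p, ((ι p).2.castSucc < (ι p).1) ↔ ¬ (p.2.castSucc < p.1) := by
    rintro ⟨l, k⟩
    simp only [ι]
    by_cases h : k.castSucc < l
    · rw [Fin.succAbove_of_castSucc_lt _ _ h, Fin.predAbove_of_castSucc_lt _ _ h]
      simp only [h, not_true_eq_false, iff_false]
      have h2 : (k : ℕ) < l := h
      change ¬ ((l : ℕ) - 1 < (k : ℕ))
      omega
    · have h' : l ≤ k.castSucc := not_lt.mp h
      rw [Fin.succAbove_of_le_castSucc _ _ h', Fin.predAbove_of_le_castSucc _ _ h']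
      simp only [h, not_false_eq_true, iff_true]
      have h2 : (l : ℕ) ≤ k := h'
      change (l : ℕ) < (k : ℕ) + 1
      omega
  have hS : ℳ.bracketSum (r + 1) f a = ∑ p, if p.2.castSucc < p.1 then T p else 0 := by
    rw [Fintype.sum_prod_type]
    simp only [bracketSum, LinearMap.sum_apply, sum_apply]
    refine Finset.sum_congr rfl fun l _ => Finset.sum_congr rfl fun k _ => ?_
    split_ifs <;> simp [hT]
  have hS' : ℳ.bracketSum (r + 1) f a = ∑ p, if p.2.castSucc < p.1 then 0 else T p := by
    rw [hS, ← Equiv.sum_comp (hι.toPerm ι)]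
    refine Finset.sum_congr rfl fun p _ => ?_
    simp only [Function.Involutive.coe_toPerm, hlt, hTι]
    by_cases h : p.2.castSucc < p.1 <;> simp [h]
  rw [two_smul]
  nth_rewrite 1 [hS]
  rw [hS', ← Finset.sum_add_distrib]
  refine Finset.sum_congr rfl fun p _ => ?_
  by_cases h : p.2.castSucc < p.1 <;> simp [h]

theorem bracketSum_skew [CharZero F] (ℳ : LCModule 𝒜 M) {q : ℕ} {f : PreCochain F A M q}
    (hf : f ∈ ℳ.cochains q) (σ : Equiv.Perm (Fin (q + 1))) (a : Fin (q + 1) → A) :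
    substVars M (MvPolynomial.rename σ) (ℳ.bracketSum q f (a ∘ σ)) =
      ((Equiv.Perm.sign σ : ℤ) : F) • ℳ.bracketSum q f a := by
  cases q with
  | zero => simp [bracketSum]
  | succ r =>
    choose τ hτ hs using fun l => exists_perm_succAbove σ l
    have h2 : (2 : F) ≠ 0 := two_ne_zero
    have key : (2 : F) • substVars M (MvPolynomial.rename σ) (ℳ.bracketSum (r + 1) f (a ∘ σ)) =
        (2 : F) • (((Equiv.Perm.sign σ : ℤ) : F) • ℳ.bracketSum (r + 1) f a) := by
      calc _ = substVars M (MvPolynomial.rename σ)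
              ((2 : F) • ℳ.bracketSum (r + 1) f (a ∘ σ)) :=
            (LinearMap.map_smul (substVars M (MvPolynomial.rename (R := F) σ)) _ _).symm
        _ = ∑ l : Fin (r + 2), ∑ k : Fin (r + 1), substVars M (MvPolynomial.rename σ)
              (((-1 : F) ^ ((k : ℕ) + (l : ℕ))) • ℳ.bracketTerm l k f (a ∘ σ)) := by
            rw [two_smul_bracketSum ℳ hf, map_sum, Fintype.sum_prod_type]
        _ = ∑ l : Fin (r + 2), ∑ k : Fin (r + 1), ((Equiv.Perm.sign σ : ℤ) : F) •
              ((-1 : F) ^ ((τ l k : ℕ) + (σ l : ℕ))) • ℳ.bracketTerm (σ l) (τ l k) f a :=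
            Finset.sum_congr rfl fun l _ => Finset.sum_congr rfl fun k _ =>
              bracketTerm_skew ℳ l k hf σ (τ l) (hτ l) (hs l) a
        _ = ∑ l : Fin (r + 2), ∑ k : Fin (r + 1), ((Equiv.Perm.sign σ : ℤ) : F) •
              ((-1 : F) ^ ((k : ℕ) + (σ l : ℕ))) • ℳ.bracketTerm (σ l) k f a :=
            Finset.sum_congr rfl fun l _ => Equiv.sum_comp (τ l)
              (fun k : Fin (r + 1) => ((Equiv.Perm.sign σ : ℤ) : F) •
                ((-1 : F) ^ ((k : ℕ) + (σ l : ℕ))) • ℳ.bracketTerm (σ l) k f a)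
        _ = ∑ l : Fin (r + 2), ∑ k : Fin (r + 1), ((Equiv.Perm.sign σ : ℤ) : F) •
              ((-1 : F) ^ ((k : ℕ) + (l : ℕ))) • ℳ.bracketTerm l k f a :=
            Equiv.sum_comp σ (fun l : Fin (r + 2) => ∑ k : Fin (r + 1), ((Equiv.Perm.sign σ : ℤ) : F) •
              ((-1 : F) ^ ((k : ℕ) + (l : ℕ))) • ℳ.bracketTerm l k f a)
        _ = ((Equiv.Perm.sign σ : ℤ) : F) • ((2 : F) • ℳ.bracketSum (r + 1) f a) := by
            rw [two_smul_bracketSum ℳ hf, Finset.smul_sum, Fintype.sum_prod_type]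
        _ = _ := smul_comm _ _ _
    have := congrArg (fun x => (2 : F)⁻¹ • x) key
    simpa only [inv_smul_smul₀ h2] using this

theorem preD_mem [CharZero F] (ℳ : LCModule 𝒜 M) (q : ℕ) (f : PreCochain F A M q)
    (hf : f ∈ ℳ.cochains q) : ℳ.preD q f ∈ ℳ.cochains (q + 1) := by
  constructor
  · intro a i
    have h1 : ∀ k : Fin (q + 1), ((-1 : F) ^ (k : ℕ)) • ℳ.actTerm k f (Function.update a i (𝒜.D (a i))) =
        -((MvPolynomial.X i : MvPolynomial (Fin (q + 1)) F) •
          (((-1 : F) ^ (k : ℕ)) • ℳ.actTerm k f a)) := by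
      intro k
      rw [actTerm_D ℳ k hf, smul_neg, smul_comm]
    have h2 : ℳ.bracketSum q f (Function.update a i (𝒜.D (a i))) =
        -((MvPolynomial.X i : MvPolynomial (Fin (q + 1)) F) • ℳ.bracketSum q f a) := by
      cases q with
      | zero => simp [bracketSum]
      | succ r =>
        simp only [bracketSum, LinearMap.sum_apply, sum_apply, Finset.smul_sum,
          ← Finset.sum_neg_distrib]
        refine Finset.sum_congr rfl fun l _ => Finset.sum_congr rfl fun k _ => ?_
        split_ifs
        · simp only [LinearMap.smul_apply, smul_apply, bracketTerm_D ℳ l k hf, smul_neg]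
          rw [smul_comm]
        · simp
    simp only [preD, LinearMap.add_apply, add_apply, LinearMap.sum_apply,
      sum_apply, LinearMap.smul_apply, smul_apply, h1, h2, smul_add, Finset.smul_sum,
      neg_add, Finset.sum_neg_distrib]
  · intro σ a
    simp only [preD, LinearMap.add_apply, add_apply, LinearMap.sum_apply,
      sum_apply, LinearMap.smul_apply, smul_apply, map_add, map_sum,
      bracketSum_skew ℳ hf, actTerm_skew ℳ _ hf, smul_add, Finset.smul_sum]
    congr 1
    exact Equiv.sum_comp σ (fun k => ((Equiv.Perm.sign σ : ℤ) : F) •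
      ((-1 : F) ^ (k : ℕ)) • ℳ.actTerm k f a)

theorem preDel_mem (ℳ : LCModule 𝒜 M) (q : ℕ) (f : PreCochain F A M q)
    (hf : f ∈ ℳ.cochains q) : ℳ.preDel q f ∈ ℳ.cochains q := by
  constructor
  · intro a i
    simp only [preDel_apply, cochains_D hf, map_neg, map_smul]
    module
  · intro σ a
    simp only [preDel_apply, map_add, substVars_smul, substVars_baseChange, cochains_skew hf,
      map_sum, MvPolynomial.rename_X, LinearMap.map_smul_of_tower, smul_add]
    rw [Equiv.sum_comp σ (fun k => (MvPolynomial.X k : MvPolynomial (Fin q) F)), smul_comm]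

theorem preD_preDel (ℳ : LCModule 𝒜 M) (q : ℕ) (f : PreCochain F A M q)
    (hf : f ∈ ℳ.cochains q) : ℳ.preD q (ℳ.preDel q f) = ℳ.preDel (q + 1) (ℳ.preD q f) := by
  have h1 : ∀ k, ℳ.actTerm k (ℳ.preDel q f) = ℳ.preDel (q + 1) (ℳ.actTerm k f) := by
    intro k
    ext a
    simp only [actTerm_apply, preDel_apply, map_add, substVars_smul, substVars_baseChange,
      actAt_baseChange ℳ.act_D_right, actAt_smul_coeff, map_sum, MvPolynomial.rename_X,
      Fin.sum_univ_succAbove _ k]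
    module
  have h2 : ℳ.bracketSum q (ℳ.preDel q f) = ℳ.preDel (q + 1) (ℳ.bracketSum q f) := by
    cases q with
    | zero => simp [bracketSum]
    | succ r =>
      have h : ∀ l k, ℳ.bracketTerm l k (ℳ.preDel (r + 1) f) =
          ℳ.preDel (r + 2) (ℳ.bracketTerm l k f) := by
        intro l k
        ext a
        have hsum : (∑ k, MvPolynomial.X k : MvPolynomial (Fin (r + 2)) F) =
            MvPolynomial.X l + (MvPolynomial.X (l.succAbove k) +
              ∑ j, MvPolynomial.X (l.succAbove (k.succAbove j))) := by
          rw [Fin.sum_univ_succAbove _ l, Fin.sum_univ_succAbove _ k]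
        have key : ∀ (v : Fin r → A) (u : MvPolynomial (Fin (r + 2)) F ⊗[F] A),
            insertAt (pairVars F l k) (ℳ.preDel (r + 1) f) v u =
              ℳ.D.baseChange (MvPolynomial (Fin (r + 2)) F) (insertAt (pairVars F l k) f v u) +
              (∑ k, MvPolynomial.X k : MvPolynomial (Fin (r + 2)) F) •
                insertAt (pairVars F l k) f v u := by
          intro v u
          induction u with
          | zero => simp
          | add u u' hu hu' => simp only [map_add, hu, hu']; module
          | tmul p z =>
            simp only [insertAt_tmul, preDel_apply, map_add, substVars_smul, substVars_baseChange,
              baseChange_smul_coeff, map_sum, hsum, Fin.sum_univ_succ (n := r), pairVars_zero,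
              pairVars_succ]
            module
        rw [bracketTerm_apply, key, preDel_apply, bracketTerm_apply]
      simp only [bracketSum, LinearMap.sum_apply, map_sum]
      refine Finset.sum_congr rfl fun l _ => Finset.sum_congr rfl fun k _ => ?_
      split_ifs
      · simp only [LinearMap.smul_apply, map_smul, h]
      · simp
  simp only [preD, LinearMap.add_apply, LinearMap.sum_apply, LinearMap.smul_apply, map_add, map_sum,
    map_smul, h1, h2]

variable [CharZero F]

/-- The differential `d : C̃^q(𝒜, M) → C̃^{q+1}(𝒜, M)`. -/
noncomputable def d (ℳ : LCModule 𝒜 M) (q : ℕ) : ℳ.cochains q →ₗ[F] ℳ.cochains (q + 1) :=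
  (ℳ.preD q).restrict (ℳ.preD_mem q)

/-- The action of `∂` on `C̃^q(𝒜, M)`. -/
noncomputable def del (ℳ : LCModule 𝒜 M) (q : ℕ) : ℳ.cochains q →ₗ[F] ℳ.cochains q :=
  (ℳ.preDel q).restrict (ℳ.preDel_mem q)

theorem d_del (ℳ : LCModule 𝒜 M) (q : ℕ) (f : ℳ.cochains q) :
    ℳ.d q (ℳ.del q f) = ℳ.del (q + 1) (ℳ.d q f) :=
  Subtype.ext (ℳ.preD_preDel q f.1 f.2)

/-- The coboundaries of degree `q` of the basic complex. -/
noncomputable def coboundaries (ℳ : LCModule 𝒜 M) : ∀ q : ℕ, Submodule F (ℳ.cochains q)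
  | 0 => ⊥
  | q + 1 => LinearMap.range (ℳ.d q)

/-- The basic cohomology `H̃^q(𝒜, M)`: cocycles modulo coboundaries. -/
abbrev BasicCohomology (ℳ : LCModule 𝒜 M) (q : ℕ) : Type _ :=
  LinearMap.ker (ℳ.d q) ⧸ (ℳ.coboundaries q).submoduleOf (LinearMap.ker (ℳ.d q))

/-- The reduced cochains `C^q(𝒜, M) = C̃^q(𝒜, M) / ∂ C̃^q(𝒜, M)`. -/
abbrev ReducedCochains (ℳ : LCModule 𝒜 M) (q : ℕ) : Type _ :=
  ℳ.cochains q ⧸ LinearMap.range (ℳ.del q)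

/-- The differential of the reduced complex, induced by `d`. -/
noncomputable def dRed (ℳ : LCModule 𝒜 M) (q : ℕ) :
    ℳ.ReducedCochains q →ₗ[F] ℳ.ReducedCochains (q + 1) :=
  Submodule.mapQ _ _ (ℳ.d q) (by
    rintro _ ⟨f, rfl⟩
    exact ⟨ℳ.d q f, (ℳ.d_del q f).symm⟩)

/-- The coboundaries of degree `q` of the reduced complex. -/
noncomputable def coboundariesRed (ℳ : LCModule 𝒜 M) :
    ∀ q : ℕ, Submodule F (ℳ.ReducedCochains q)
  | 0 => ⊥
  | q + 1 => LinearMap.range (ℳ.dRed q)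

/-- The reduced cohomology `H^q(𝒜, M)`: the cohomology of the reduced complex. -/
abbrev ReducedCohomology (ℳ : LCModule 𝒜 M) (q : ℕ) : Type _ :=
  LinearMap.ker (ℳ.dRed q) ⧸ (ℳ.coboundariesRed q).submoduleOf (LinearMap.ker (ℳ.dRed q))

/-- `f` is a basic cocycle and `x` is its class in `H̃^q(𝒜, M)`. -/
def HasBasicClass (ℳ : LCModule 𝒜 M) {q : ℕ} (f : ℳ.cochains q) (x : ℳ.BasicCohomology q) :
    Prop :=
  ∃ h : f ∈ LinearMap.ker (ℳ.d q), Submodule.Quotient.mk ⟨f, h⟩ = x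

/-- The image of `f` in the reduced complex is a cocycle and `x` is its class in `H^q(𝒜, M)`. -/
def HasReducedClass (ℳ : LCModule 𝒜 M) {q : ℕ} (f : ℳ.cochains q) (x : ℳ.ReducedCohomology q) :
    Prop :=
  ∃ h : (Submodule.Quotient.mk f : ℳ.ReducedCochains q) ∈ LinearMap.ker (ℳ.dRed q),
    Submodule.Quotient.mk ⟨Submodule.Quotient.mk f, h⟩ = x

end LCModule

end Complex

/-- The adjoint module of `W(b)`. -/
noncomputable abbrev adjW (F : Type*) [Field F] (b : F) : LCModule (WAlg F b) (WSpace F) :=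
  (WAlg F b).adjoint

end LieConformal

/-! Evaluating the variables `λ_i` at scalars turns a cochain into a function of points `(a_i, λ_i)`
in `A × F`, and nothing is lost because `F` is infinite (`pointEval_injective`). With the bracket
`([a_λ b], λ + μ)` of points and the action `a_λ m`, the differential becomes the
Chevalley–Eilenberg differential (`pointEval_preD`). Cartan calculus then gives d² = 0 (`d_d`).
Taking the coefficient of `t ^ n` in the contraction with `(a, t)` gives a Cartan formula for ι_n,
the contraction with the n-th mode of `a` (`hasCoeff_lieDeriv`).

Two modes of `L` matter. Mode 1 gives the weight operator W = d ι_1 + ι_1 d. It is diagonal on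
coefficients (`coord_genCoeff_weightOp`): a value `∂^k L` contributes k + 2, a value `∂^k H`
contributes k, an argument `L` with exponent m contributes m - 1, and an argument `H` with exponent
m contributes m + 1. A cochain has finitely many weights and W is null-homotopic, so only weight
zero counts (`exists_weight_zero_cocycle`, `exists_weight_zero_of_d`). By skew-symmetry the pairs
(generator, exponent) of the arguments are distinct. The only pair of negative weight is (L, 0) and
the only one of weight zero is (L, 1), so the weight-zero complex is tiny
(`card_add_le_of_totalWeight`): its dimensions in degrees 0, 1, 2, 3 are 1, 2, 3, 2, and it vanishes
from degree 4 on.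

In that complex `dH` contains `∂H`, and the cochain U given by `L ↦ λ_1 H` has dU ≠ 0; hence there
is no cohomology in degrees 0 and 1. In degree 3 everything is closed. If f has weight zero and
degree 3, then 0 = W f = d ι_1 f, so ι_1 f is a 2-cocycle (`weightOp_contract`). Applied to f₃₁ and
f₃₂ this gives, up to sign, f₂₁ and f₂₂, which together with dU span degree 2. So the differential
from degree 2 to degree 3 is zero in weight zero, and two classes remain in each of these degrees.

Mode 0 of `L` acts as ∂, so ∂ = d ι_0 + ι_0 d (`cartan_zero_eq_del`), and ∂ is injective on cochains
(`del_eq_zero`). The long exact sequence of 0 → C̃ → C̃ → C → 0 therefore breaks into 0 → H̃^q → H^q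
→ H̃^{q+1} → 0. It is split by ι_0, because d ι_0 f = ∂f for a cocycle f
(`IsCohomologyBasis.exists_basis_reduced`). The remaining representatives are f₁₁ = ι_0 f₂₁, f₁₂ =
ι_0 f₂₂, f₂₃ = ι_0 f₃₁ + ∂f₂₁ and f₂₄ = ι_0 f₃₂. -/

namespace LieConformal

/-! ## The Chevalley–Eilenberg differential on functions

For a set `Z` with a bracket and an action on `M`, functions `Z^q → M` carry a differential defined
recursively by Cartan's formula. -/

section ChevalleyEilenberg

variable {Z M : Type*} [AddCommGroup M] (β : Z → Z → Z) (α : Z → M →+ M)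

/-- The Lie derivative `(θ_z φ)(v) = z φ(v) - ∑ i, φ(v_1, …, [z, v_i], …, v_q)`. -/
def lieDeriv {q : ℕ} (z : Z) (φ : (Fin q → Z) → M) : (Fin q → Z) → M :=
  fun v => α z (φ v) - ∑ i, φ (Function.update v i (β z (v i)))

/-- The Chevalley–Eilenberg differential, defined by `ι_z d = θ_z - d ι_z`. -/
def ceD : ∀ {q : ℕ}, ((Fin q → Z) → M) → (Fin (q + 1) → Z) → M
  | 0, φ, w => lieDeriv β α (w 0) φ (Fin.tail w)
  | _ + 1, φ, w => lieDeriv β α (w 0) φ (Fin.tail w) -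
      ceD (fun v => φ (Fin.cons (w 0) v)) (Fin.tail w)

variable {β α}

theorem ceD_zero_cons (φ : (Fin 0 → Z) → M) (z : Z) (v : Fin 0 → Z) :
    ceD β α φ (Fin.cons z v) = lieDeriv β α z φ v := by
  simp [ceD]

theorem ceD_succ_cons {q : ℕ} (φ : (Fin (q + 1) → Z) → M) (z : Z) (v : Fin (q + 1) → Z) :
    ceD β α φ (Fin.cons z v) =
      lieDeriv β α z φ v - ceD β α (fun u => φ (Fin.cons z u)) v := by
  simp [ceD]

theorem lieDeriv_sub {q : ℕ} (z : Z) (φ ψ : (Fin q → Z) → M) :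
    lieDeriv β α z (φ - ψ) = lieDeriv β α z φ - lieDeriv β α z ψ := by
  funext v
  simp only [lieDeriv, Pi.sub_apply, map_sub, Finset.sum_sub_distrib]
  abel

theorem ceD_sub {q : ℕ} (φ ψ : (Fin q → Z) → M) :
    ceD β α (φ - ψ) = ceD β α φ - ceD β α ψ := by
  induction q with
  | zero =>
    funext w
    simp only [ceD, lieDeriv_sub, Pi.sub_apply]
  | succ q ih =>
    funext w
    simp only [ceD, lieDeriv_sub, Pi.sub_apply]
    have := congrFun (ih (fun v => φ (Fin.cons (w 0) v)) (fun v => ψ (Fin.cons (w 0) v)))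
      (Fin.tail w)
    simp only [Pi.sub_apply] at this
    rw [show (fun v => φ (Fin.cons (w 0) v) - ψ (Fin.cons (w 0) v)) =
      (fun v => φ (Fin.cons (w 0) v)) - (fun v => ψ (Fin.cons (w 0) v)) from rfl, ih]
    simp only [Pi.sub_apply]
    abel

/-- `φ` is compatible with the Jacobi identity for the bracket in each argument. -/
def RespectsJacobi (β : Z → Z → Z) {q : ℕ} (φ : (Fin q → Z) → M) : Prop :=
  ∀ (v : Fin q → Z) (i : Fin q) (z w y : Z), φ (Function.update v i (β z (β w y))) =
    φ (Function.update v i (β (β z w) y)) + φ (Function.update v i (β w (β z y)))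

theorem RespectsJacobi.cons {q : ℕ} {φ : (Fin (q + 1) → Z) → M} (h : RespectsJacobi β φ) (z : Z) :
    RespectsJacobi β (fun v => φ (Fin.cons z v)) := by
  intro v i x w y
  simpa only [Fin.cons_update] using h (Fin.cons z v) i.succ x w y

/-- Terms in which the two brackets hit different arguments are symmetric in `z` and `w` and cancel.
Those hitting the same argument combine by Jacobi, those on values by `hα`. `Z` has no addition, so
the Jacobi identity can only be imposed through `φ`. -/
theorem lieDeriv_lieDeriv
    (hα : ∀ z w m, α z (α w m) - α w (α z m) = α (β z w) m)
    {q : ℕ} {φ : (Fin q → Z) → M} (h : RespectsJacobi β φ) (z w : Z) :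
    lieDeriv β α z (lieDeriv β α w φ) - lieDeriv β α w (lieDeriv β α z φ) =
      lieDeriv β α (β z w) φ := by
  funext v
  -- Expansion with the diagonal terms, where one argument is bracketed twice, split off from the
  -- mixed ones.
  have key : ∀ z w : Z, lieDeriv β α z (lieDeriv β α w φ) v =
      α z (α w (φ v)) - (∑ i, α z (φ (Function.update v i (β w (v i)))) +
        ∑ i, α w (φ (Function.update v i (β z (v i))))) +
      (∑ i, φ (Function.update v i (β w (β z (v i)))) + ∑ i, ∑ j ∈ Finset.univ.erase i,
        φ (Function.update (Function.update v i (β z (v i))) j (β w (v j)))) := by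
    intro z w
    simp only [lieDeriv, map_sub, map_sum, Finset.sum_sub_distrib]
    have : ∀ i, ∑ j, φ (Function.update (Function.update v i (β z (v i))) j
          (β w (Function.update v i (β z (v i)) j))) =
        φ (Function.update v i (β w (β z (v i)))) + ∑ j ∈ Finset.univ.erase i,
        φ (Function.update (Function.update v i (β z (v i))) j (β w (v j))) := by
      intro i
      rw [← Finset.add_sum_erase _ _ (Finset.mem_univ i)]
      congr 1
      · simp
      · refine Finset.sum_congr rfl fun j hj => ?_
        rw [Function.update_of_ne (Finset.ne_of_mem_erase hj)]
    simp only [this, Finset.sum_add_distrib]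
    abel
  have hsymm : (∑ i, ∑ j ∈ Finset.univ.erase i,
        φ (Function.update (Function.update v i (β z (v i))) j (β w (v j)))) =
      ∑ i, ∑ j ∈ Finset.univ.erase i,
        φ (Function.update (Function.update v i (β w (v i))) j (β z (v j))) := by
    rw [Finset.sum_comm' (t' := Finset.univ) (s' := fun j => Finset.univ.erase j)
      (by intro x y; simp [eq_comm])]
    refine Finset.sum_congr rfl fun j _ => Finset.sum_congr rfl fun i hi => ?_
    rw [Function.update_comm (Finset.ne_of_mem_erase hi)]
  rw [Pi.sub_apply, key, key, hsymm]
  simp only [lieDeriv, ← hα]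
  have hJ : ∑ i, φ (Function.update v i (β z (β w (v i)))) =
      ∑ i, φ (Function.update v i (β (β z w) (v i))) +
        ∑ i, φ (Function.update v i (β w (β z (v i)))) := by
    rw [← Finset.sum_add_distrib]
    exact Finset.sum_congr rfl fun i _ => h v i z w (v i)
  rw [hJ]
  abel

/-- The Cartan relation ι_y θ_z = θ_z ι_y - ι_{[z, y]}: the extra term is the one in which `z`
brackets the argument `y` itself. -/
theorem cons_lieDeriv {q : ℕ} (φ : (Fin (q + 1) → Z) → M) (z y : Z) :
    (fun v => lieDeriv β α z φ (Fin.cons y v)) =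
      lieDeriv β α z (fun v => φ (Fin.cons y v)) - fun v => φ (Fin.cons (β z y) v) := by
  funext v
  simp only [lieDeriv, Pi.sub_apply, Fin.sum_univ_succ, Fin.cons_zero, Fin.update_cons_zero,
    Fin.cons_succ, ← Fin.cons_update]
  abel

/-- Induction on the degree after contracting with `y`: ι_y d = θ_y - d ι_y reduces the claim to
[θ_z, θ_y] = θ_{[z, y]}, the relation `cons_lieDeriv`, and the claim for ι_y φ. -/
theorem ceD_lieDeriv (hα : ∀ z w m, α z (α w m) - α w (α z m) = α (β z w) m)
    {q : ℕ} {φ : (Fin q → Z) → M} (h : RespectsJacobi β φ) (z : Z) :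
    ceD β α (lieDeriv β α z φ) = lieDeriv β α z (ceD β α φ) := by
  induction q with
  | zero =>
    funext w
    obtain ⟨y, v, rfl⟩ : ∃ y v, w = Fin.cons y v := ⟨w 0, Fin.tail w, (Fin.cons_self_tail w).symm⟩
    have h1 := congrFun (cons_lieDeriv (β := β) (α := α) (ceD β α φ) z y) v
    have h2 := congrFun (lieDeriv_lieDeriv hα h z y) v
    simp only [ceD_zero_cons, Pi.sub_apply] at h1 h2 ⊢
    rw [h1, ← h2]
    abel
  | succ q ih =>
    funext w
    obtain ⟨y, v, rfl⟩ : ∃ y v, w = Fin.cons y v := ⟨w 0, Fin.tail w, (Fin.cons_self_tail w).symm⟩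
    have h1 := congrFun (cons_lieDeriv (β := β) (α := α) (ceD β α φ) z y) v
    have h2 := congrFun (lieDeriv_lieDeriv hα h z y) v
    have h3 : (fun v => ceD β α φ (Fin.cons y v)) =
        lieDeriv β α y φ - ceD β α (fun u => φ (Fin.cons y u)) := by
      funext v; rw [ceD_succ_cons, Pi.sub_apply]
    have h4 := congrFun (ih (h.cons y)) v
    rw [h3, lieDeriv_sub] at h1
    rw [h1, ceD_succ_cons, cons_lieDeriv, ceD_sub]
    simp only [ceD_succ_cons, Pi.sub_apply] at h2 ⊢
    rw [← h2, h4]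
    abel

/-- ι_y d d φ = θ_y d φ - d (θ_y φ - d ι_y φ) = d d ι_y φ, since θ_y commutes with d; this vanishes
by induction on the degree. -/
theorem ceD_ceD (hα : ∀ z w m, α z (α w m) - α w (α z m) = α (β z w) m)
    {q : ℕ} {φ : (Fin q → Z) → M} (h : RespectsJacobi β φ) :
    ceD β α (ceD β α φ) = 0 := by
  induction q with
  | zero =>
    funext w
    obtain ⟨y, v, rfl⟩ : ∃ y v, w = Fin.cons y v := ⟨w 0, Fin.tail w, (Fin.cons_self_tail w).symm⟩
    have h3 : (fun v => ceD β α φ (Fin.cons y v)) = lieDeriv β α y φ := by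
      funext v; rw [ceD_zero_cons]
    rw [ceD_succ_cons, h3, ceD_lieDeriv hα h]
    simp
  | succ q ih =>
    funext w
    obtain ⟨y, v, rfl⟩ : ∃ y v, w = Fin.cons y v := ⟨w 0, Fin.tail w, (Fin.cons_self_tail w).symm⟩
    have h3 : (fun v => ceD β α φ (Fin.cons y v)) =
        lieDeriv β α y φ - ceD β α (fun u => φ (Fin.cons y u)) := by
      funext v; rw [ceD_succ_cons, Pi.sub_apply]
    rw [ceD_succ_cons, h3, ceD_sub, ceD_lieDeriv hα h, ih (h.cons y)]
    simp

/-- The second sum of the differential; a pair `k < l` of indices is written as in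
`LCModule.bracketSum`. -/
def ceBracketSum (β : Z → Z → Z) : ∀ {q : ℕ}, ((Fin q → Z) → M) → (Fin (q + 1) → Z) → M
  | 0, _, _ => 0
  | r + 1, φ, w => ∑ l : Fin (r + 2), ∑ k : Fin (r + 1),
      if k.castSucc < l then ((-1 : ℤ) ^ ((k : ℕ) + (l : ℕ))) •
        φ (Fin.cons (β (w (l.succAbove k)) (w l)) (k.removeNth (l.removeNth w))) else 0

/-- The first sum of the differential. -/
def ceActSum (α : Z → M →+ M) {q : ℕ} (φ : (Fin q → Z) → M) (w : Fin (q + 1) → Z) : M :=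
  ∑ k : Fin (q + 1), ((-1 : ℤ) ^ (k : ℕ)) • α (w k) (φ (k.removeNth w))

/-- A function that changes by the sign under permutations of its arguments. -/
def IsAlternating {q : ℕ} (φ : (Fin q → Z) → M) : Prop :=
  ∀ (σ : Equiv.Perm (Fin q)) (v : Fin q → Z), φ (v ∘ σ) = (Equiv.Perm.sign σ : ℤ) • φ v

theorem IsAlternating.cons {q : ℕ} {φ : (Fin (q + 1) → Z) → M} (h : IsAlternating φ) (z : Z) :
    IsAlternating (fun v => φ (Fin.cons z v)) := by
  intro τ v
  have h2 : (Fin.cons z v : Fin (q + 1) → Z) ∘ (Equiv.Perm.decomposeFin.symm (0, τ)) =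
      Fin.cons z (v ∘ τ) := by
    funext j
    refine Fin.cases ?_ (fun j => ?_) j <;> simp
  have := h (Equiv.Perm.decomposeFin.symm (0, τ)) (Fin.cons z v)
  rw [h2] at this
  simpa using this

theorem IsAlternating.cons_cons {q : ℕ} {φ : (Fin (q + 2) → Z) → M} (h : IsAlternating φ)
    (x y : Z) (v : Fin q → Z) : φ (Fin.cons x (Fin.cons y v)) = -φ (Fin.cons y (Fin.cons x v)) := by
  have h2 : (Fin.cons y (Fin.cons x v) : Fin (q + 2) → Z) ∘ (Equiv.swap 0 1) =
      Fin.cons x (Fin.cons y v) := by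
    funext j
    refine Fin.cases ?_ (fun j => Fin.cases ?_ (fun j => ?_) j) j
    · simp
    · simp
    · rw [Function.comp_apply, Equiv.swap_apply_of_ne_of_ne (Fin.succ_ne_zero _)]
      · simp
      · rw [← Fin.succ_zero_eq_one]
        exact fun h => Fin.succ_ne_zero j (Fin.succ_injective _ h)
  have := h (Equiv.swap 0 1) (Fin.cons y (Fin.cons x v))
  rw [h2] at this
  simpa [Equiv.Perm.sign_swap] using this

/-- Moving `x` from the front to position `l` is a cycle of sign `(-1) ^ l`. -/
theorem IsAlternating.cons_removeNth {q : ℕ} {φ : (Fin (q + 1) → Z) → M} (h : IsAlternating φ)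
    (x : Z) (v : Fin (q + 1) → Z) (l : Fin (q + 1)) :
    φ (Fin.cons x (l.removeNth v)) = ((-1 : ℤ) ^ (l : ℕ)) • φ (Function.update v l x) := by
  have h2 : Function.update v l x ∘ l.cycleRange.symm = Fin.cons x (l.removeNth v) := by
    funext j
    refine Fin.cases ?_ (fun j => ?_) j
    · simp
    · simp [Fin.removeNth]
  have := h l.cycleRange.symm (Function.update v l x)
  rw [h2] at this
  rw [this]
  simp [Fin.sign_cycleRange, Equiv.Perm.sign_symm]

/-- The recursive form brackets an argument in place, while the explicit form puts the bracket in
front. Alternation reconciles them, by induction on the degree, separating the terms that involve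
the first argument. -/
theorem ceD_eq_sum {q : ℕ} {φ : (Fin q → Z) → M} (h : IsAlternating φ) (w : Fin (q + 1) → Z) :
    ceD β α φ w = ceActSum α φ w + ceBracketSum β φ w := by
  induction q with
  | zero =>
    simp only [ceD, lieDeriv, ceActSum, ceBracketSum]
    simp [Fin.removeNth_zero]
  | succ q ih =>
    obtain ⟨z, v, rfl⟩ : ∃ y v, w = Fin.cons y v := ⟨w 0, Fin.tail w, (Fin.cons_self_tail w).symm⟩
    rw [ceD_succ_cons, ih (h.cons z)]
    have h1 : ceActSum α φ (Fin.cons z v : Fin (q + 2) → Z) =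
        α z (φ v) - ceActSum α (fun u => φ (Fin.cons z u)) v := by
      rw [ceActSum, Fin.sum_univ_succ, ceActSum, sub_eq_add_neg, ← Finset.sum_neg_distrib]
      congr 1
      · simp [Fin.removeNth_zero]
      · refine Finset.sum_congr rfl fun k _ => ?_
        rw [Fin.cons_succ, Fin.val_succ, pow_succ]
        have : k.succ.removeNth (Fin.cons z v : Fin (q + 2) → Z) =
            Fin.cons z (k.removeNth v) := by
          funext j
          refine Fin.cases ?_ (fun j => ?_) j <;> simp [Fin.removeNth]
        rw [this]
        simp
    -- Pairs containing index 0 give the sum in the Lie derivative by `z`; the other pairs give the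
    -- bracket sum of ι_z φ.
    have h2 : ceBracketSum β φ (Fin.cons z v : Fin (q + 2) → Z) =
        -(∑ i, φ (Function.update v i (β z (v i)))) -
          ceBracketSum β (fun u => φ (Fin.cons z u)) v := by
      rw [ceBracketSum, Fin.sum_univ_succ]
      have h0 : ∀ k : Fin (q + 1), ¬ (k.castSucc < (0 : Fin (q + 2))) := fun k => by simp
      have h3 : ∀ l : Fin (q + 1), (if (0 : Fin (q + 1)).castSucc < l.succ then
          ((-1 : ℤ) ^ (((0 : Fin (q + 1)) : ℕ) + (l.succ : ℕ))) •
            φ (Fin.cons (β ((Fin.cons z v : Fin (q + 2) → Z) (l.succ.succAbove 0))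
              ((Fin.cons z v : Fin (q + 2) → Z) l.succ))
              ((0 : Fin (q + 1)).removeNth (l.succ.removeNth (Fin.cons z v : Fin (q + 2) → Z))))
          else 0) = -φ (Function.update v l (β z (v l))) := by
        intro l
        have : (0 : Fin (q + 1)).removeNth (l.succ.removeNth (Fin.cons z v : Fin (q + 2) → Z)) =
            l.removeNth v := by
          funext j; simp [Fin.removeNth]
        rw [this, Fin.succ_succAbove_zero, Fin.cons_zero, Fin.cons_succ, h.cons_removeNth,
          smul_smul, if_pos (by simp)]
        simp only [Fin.val_zero, Fin.val_succ, zero_add, pow_succ, mul_neg, mul_one, neg_mul]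
        rw [← mul_pow]
        simp
      simp only [h0, if_false, Finset.sum_const_zero, zero_add]
      conv_lhs => enter [2, l]; rw [Fin.sum_univ_succ, h3]
      rw [Finset.sum_add_distrib, Finset.sum_neg_distrib, sub_eq_add_neg]
      congr 1
      cases q with
      | zero => simp [ceBracketSum]
      | succ q =>
        simp only [ceBracketSum, ← Finset.sum_neg_distrib]
        refine Finset.sum_congr rfl fun l _ => Finset.sum_congr rfl fun k _ => ?_
        have hk : (k.succ.castSucc < l.succ) ↔ (k.castSucc < l) := by
          simp only [Fin.lt_def, Fin.val_castSucc, Fin.val_succ]; omega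
        have : k.succ.removeNth (l.succ.removeNth (Fin.cons z v : Fin (q + 3) → Z)) =
            Fin.cons z (k.removeNth (l.removeNth v)) := by
          funext j
          refine Fin.cases ?_ (fun j => ?_) j <;> simp [Fin.removeNth]
        -- Both indices rise by one, so the sign is unchanged; the minus comes from exchanging `z`
        -- with the bracket.
        rw [this, Fin.succ_succAbove_succ, Fin.cons_succ, Fin.cons_succ, h.cons_cons]
        simp only [hk]
        split_ifs
        · simp only [Fin.val_succ]
          rw [show (k : ℕ) + 1 + ((l : ℕ) + 1) = k + l + 2 by ring, pow_add]
          simp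
        · simp
    rw [h1, h2, lieDeriv]
    abel

end ChevalleyEilenberg

end LieConformal

namespace LieConformal

/-! ## Evaluation of the variables at scalars -/

section Evaluation

variable {F : Type*} [Field F] {A M : Type*} [AddCommGroup A] [Module F A]
  [AddCommGroup M] [Module F M]

/-- The element of `M` obtained from `x ∈ M[λ_i]` by evaluating the variables at scalars. -/
noncomputable def evalVars {σ : Type*} (M : Type*) [AddCommGroup M] [Module F M] (v : σ → F) :
    MvPolynomial σ F ⊗[F] M →ₗ[F] M :=
  (TensorProduct.lid F M).toLinearMap ∘ₗ substVars M (MvPolynomial.aeval v)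

theorem evalVars_tmul {σ : Type*} (v : σ → F) (p : MvPolynomial σ F) (m : M) :
    evalVars M v (p ⊗ₜ m) = MvPolynomial.eval v p • m := by
  simp [evalVars, substVars_tmul, MvPolynomial.aeval_eq_eval]

theorem evalVars_smul {σ : Type*} (v : σ → F) (p : MvPolynomial σ F)
    (x : MvPolynomial σ F ⊗[F] M) :
    evalVars M v (p • x) = MvPolynomial.eval v p • evalVars M v x := by
  simp [evalVars, substVars_smul, MvPolynomial.aeval_eq_eval]

theorem evalVars_X_smul {σ : Type*} (v : σ → F) (i : σ) (x : MvPolynomial σ F ⊗[F] M) :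
    evalVars M v ((MvPolynomial.X i : MvPolynomial σ F) • x) = v i • evalVars M v x := by
  rw [evalVars_smul, MvPolynomial.eval_X]

theorem evalVars_baseChange {σ : Type*} (v : σ → F) (D : M →ₗ[F] M)
    (x : MvPolynomial σ F ⊗[F] M) :
    evalVars M v (D.baseChange _ x) = D (evalVars M v x) := by
  induction x with
  | zero => simp
  | add x y hx hy => simp only [map_add, hx, hy]
  | tmul p m => simp [evalVars_tmul]

theorem evalVars_rename {σ τ : Type*} (f : σ → τ) (v : τ → F) (x : MvPolynomial σ F ⊗[F] M) :
    evalVars M v (substVars M (MvPolynomial.rename f) x) = evalVars M (v ∘ f) x := by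
  induction x with
  | zero => simp
  | add x y hx hy => simp only [map_add, hx, hy]
  | tmul p m => simp [evalVars_tmul, substVars_tmul, MvPolynomial.eval_rename]

/-- In coordinates with respect to a basis of `M` this is the fact that a polynomial over an
infinite field is determined by its values. -/
theorem evalVars_injective [Infinite F] {σ : Type*} {x y : MvPolynomial σ F ⊗[F] M}
    (h : ∀ v, evalVars M v x = evalVars M v y) : x = y := by
  classical
  let b := Module.Basis.ofVectorSpace F M
  apply (TensorProduct.equivFinsuppOfBasisRight (M := MvPolynomial σ F) b).injective
  ext1 i
  apply MvPolynomial.funext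
  intro v
  have key : ∀ x : MvPolynomial σ F ⊗[F] M,
      MvPolynomial.eval v (TensorProduct.equivFinsuppOfBasisRight b x i) =
        b.repr (evalVars M v x) i := by
    intro x
    induction x with
    | zero => simp
    | add x y hx hy => simp only [map_add, Finsupp.add_apply, hx, hy]
    | tmul p m =>
      rw [TensorProduct.equivFinsuppOfBasisRight_apply_tmul_apply, evalVars_tmul]
      simp [mul_comm]
  rw [key, key, h v]

/-- The element of `M` obtained from `x ∈ M[λ]` by evaluating `λ` at `t`. -/
noncomputable def evalVar (M : Type*) [AddCommGroup M] [Module F M] (t : F) :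
    F[X] ⊗[F] M →ₗ[F] M :=
  (TensorProduct.lid F M).toLinearMap ∘ₗ evalAt M t

theorem evalVar_tmul (t : F) (p : F[X]) (m : M) :
    evalVar M t (p ⊗ₜ m) = p.eval t • m := by
  simp [evalVar, evalAt_tmul, Polynomial.aeval_def, Polynomial.eval₂_eq_eval_map]

theorem evalVar_X_smul (t : F) (x : F[X] ⊗[F] M) :
    evalVar M t ((Polynomial.X : F[X]) • x) = t • evalVar M t x := by
  simp [evalVar, evalAt_X_smul]

theorem evalVar_baseChange (t : F) (D : M →ₗ[F] M) (x : F[X] ⊗[F] M) :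
    evalVar M t (D.baseChange _ x) = D (evalVar M t x) := by
  induction x with
  | zero => simp
  | add x y hx hy => simp only [map_add, hx, hy]
  | tmul p m => simp [evalVar_tmul]

theorem evalVars_evalAt {σ : Type*} (v : σ → F) (p : MvPolynomial σ F) (x : F[X] ⊗[F] M) :
    evalVars M v (evalAt M p x) = evalVar M (MvPolynomial.eval v p) x := by
  rw [evalVars, LinearMap.comp_apply, substVars_evalAt, MvPolynomial.aeval_eq_eval]
  rfl

/-- The product `a_t m` for a scalar `t`. -/
noncomputable def prodAt (φ : A →ₗ[F] M →ₗ[F] F[X] ⊗[F] M) (t : F) : A →ₗ[F] M →ₗ[F] M :=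
  φ.compr₂ (evalVar M t)

theorem prodAt_apply (φ : A →ₗ[F] M →ₗ[F] F[X] ⊗[F] M) (t : F) (a : A) (m : M) :
    prodAt φ t a m = evalVar M t (φ a m) := rfl

theorem evalVars_actAt {σ : Type*} (v : σ → F) (φ : A →ₗ[F] M →ₗ[F] F[X] ⊗[F] M)
    (p : MvPolynomial σ F) (a : A) (x : MvPolynomial σ F ⊗[F] M) :
    evalVars M v (actAt φ p a x) = prodAt φ (MvPolynomial.eval v p) a (evalVars M v x) := by
  induction x with
  | zero => simp
  | add x y hx hy => simp only [map_add, hx, hy]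
  | tmul r m => rw [actAt_tmul, evalVars_smul, evalVars_evalAt, evalVars_tmul, map_smul,
      prodAt_apply]

theorem evalVars_actLeftAt {σ : Type*} (v : σ → F) (φ : A →ₗ[F] M →ₗ[F] F[X] ⊗[F] M)
    (p : MvPolynomial σ F) (m : M) (x : MvPolynomial σ F ⊗[F] A) :
    evalVars M v (actLeftAt φ p m x) = prodAt φ (MvPolynomial.eval v p) (evalVars A v x) m := by
  induction x with
  | zero => simp
  | add x y hx hy => simp only [map_add, LinearMap.add_apply, hx, hy]
  | tmul r m => rw [actLeftAt_tmul, evalVars_smul, evalVars_evalAt, evalVars_tmul, map_smul,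
      LinearMap.smul_apply, prodAt_apply]

theorem evalVars_insertAt {σ : Type*} (v : σ → F) {r : ℕ}
    (e : MvPolynomial (Fin (r + 1)) F →ₐ[F] MvPolynomial σ F) (f : PreCochain F A M (r + 1))
    (a : Fin r → A) (u : MvPolynomial σ F ⊗[F] A) :
    evalVars M v (LCModule.insertAt e f a u) =
      evalVars M (fun i => MvPolynomial.eval v (e (MvPolynomial.X i)))
        (f (Fin.cons (evalVars A v u) a)) := by
  induction u with
  | zero =>
    have := f.map_coord_zero (m := Fin.cons (0 : A) a) 0 rfl
    simp [this]
  | add x y hx hy => simp only [map_add, hx, hy, MultilinearMap.cons_add]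
  | tmul p x =>
    rw [LCModule.insertAt_tmul, evalVars_tmul, evalVars_smul, MultilinearMap.cons_smul, map_smul]
    congr 1
    generalize f (Fin.cons x a) = y
    induction y with
    | zero => simp
    | add x y hx hy => simp only [map_add, hx, hy]
    | tmul q m =>
      rw [substVars_tmul, evalVars_tmul, evalVars_tmul]
      congr 1
      have : ((MvPolynomial.aeval v).comp e : MvPolynomial (Fin (r + 1)) F →ₐ[F] F) =
          MvPolynomial.aeval (fun i => MvPolynomial.eval v (e (MvPolynomial.X i))) := by
        ext i; simp [MvPolynomial.aeval_eq_eval]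
      have := congrArg (fun g => g q) this
      simpa [MvPolynomial.aeval_eq_eval] using this

end Evaluation

/-! ### Cochains as functions of points `(a, λ)` -/

section Model

variable {F : Type*} [Field F] {A : Type*} [AddCommGroup A] [Module F A]
  {M : Type*} [AddCommGroup M] [Module F M]

/-- The bracket `[(a, λ), (b, μ)] = ([a_λ b], λ + μ)`. -/
noncomputable def LieConformalAlgebra.pointBracket (𝒜 : LieConformalAlgebra F A)
    (z w : A × F) : A × F :=
  (prodAt 𝒜.bracket z.2 z.1 w.1, z.2 + w.2)

namespace LCModule

variable {𝒜 : LieConformalAlgebra F A}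

/-- The action `(a, λ) m = a_λ m`. -/
noncomputable def pointAct (ℳ : LCModule 𝒜 M) (z : A × F) : M →+ M :=
  (prodAt ℳ.act z.2 z.1).toAddMonoidHom

theorem pointAct_apply (ℳ : LCModule 𝒜 M) (z : A × F) (m : M) :
    ℳ.pointAct z m = prodAt ℳ.act z.2 z.1 m := rfl

theorem pointAct_pointBracket (ℳ : LCModule 𝒜 M) (z w : A × F) (m : M) :
    ℳ.pointAct z (ℳ.pointAct w m) - ℳ.pointAct w (ℳ.pointAct z m) =
      ℳ.pointAct (𝒜.pointBracket z w) m := by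
  have := congrArg (evalVars M ![z.2, w.2]) (ℳ.act_act z.1 w.1 m)
  simpa [evalVars_actAt, evalVars_actLeftAt, evalVars_evalAt, ← prodAt_apply, pointAct_apply,
    LieConformalAlgebra.pointBracket] using this

theorem prodAt_jacobi (𝒜 : LieConformalAlgebra F A) (s t : F) (a b c : A) :
    prodAt 𝒜.bracket s a (prodAt 𝒜.bracket t b c) =
      prodAt 𝒜.bracket (s + t) (prodAt 𝒜.bracket s a b) c +
        prodAt 𝒜.bracket t b (prodAt 𝒜.bracket s a c) := by
  have := congrArg (evalVars A ![s, t]) (𝒜.jacobi a b c)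
  simpa [evalVars_actAt, evalVars_actLeftAt, evalVars_evalAt, ← prodAt_apply] using this

/-- The function `(a_i, λ_i) ↦ f_{λ_1, …, λ_q}(a_1, …, a_q)` on scalars `λ_i`. -/
noncomputable def pointEval {q : ℕ} (f : PreCochain F A M q) (z : Fin q → A × F) : M :=
  evalVars M (fun i => (z i).2) (f fun i => (z i).1)

theorem pointEval_injective [Infinite F] {q : ℕ} {f g : PreCochain F A M q}
    (h : pointEval f = pointEval g) : f = g := by
  ext a
  exact evalVars_injective fun v => congrFun h fun i => (a i, v i)

theorem pointEval_update {q : ℕ} (f : PreCochain F A M q) (z : Fin q → A × F) (i : Fin q)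
    (a : A) (t : F) : pointEval f (Function.update z i (a, t)) =
      evalVars M (Function.update (fun i => (z i).2) i t)
        (f (Function.update (fun i => (z i).1) i a)) := by
  have h1 : (fun j => (Function.update z i (a, t) j).2) =
      Function.update (fun i => (z i).2) i t := by
    funext j; rcases eq_or_ne j i with rfl | h <;> simp [*]
  have h2 : (fun j => (Function.update z i (a, t) j).1) =
      Function.update (fun i => (z i).1) i a := by
    funext j; rcases eq_or_ne j i with rfl | h <;> simp [*]
  rw [pointEval, h1, h2]

/-- The three iterated brackets have the same scalar component, and at fixed scalars `f` is additive
in the vector component, so the Jacobi identity of the algebra carries over. -/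
theorem pointEval_respectsJacobi (𝒜 : LieConformalAlgebra F A) {q : ℕ} (f : PreCochain F A M q) :
    RespectsJacobi 𝒜.pointBracket (pointEval f) := by
  intro v i z w y
  simp only [LieConformalAlgebra.pointBracket, pointEval_update, prodAt_jacobi 𝒜 z.2 w.2,
    MultilinearMap.map_update_add, map_add, add_assoc, add_left_comm w.2 z.2]

theorem pointEval_isAlternating {ℳ : LCModule 𝒜 M} {q : ℕ} {f : PreCochain F A M q}
    (hf : f ∈ ℳ.cochains q) : IsAlternating (pointEval f) := by
  intro σ z
  have := congrArg (evalVars M (fun i => (z i).2)) (cochains_skew hf σ (fun i => (z i).1))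
  rw [evalVars_rename, map_smul] at this
  rw [pointEval, pointEval]
  refine this.trans ?_
  rw [Int.cast_smul_eq_zsmul]

theorem pointEval_D {ℳ : LCModule 𝒜 M} {q : ℕ} {f : PreCochain F A M q}
    (hf : f ∈ ℳ.cochains q) (z : Fin q → A × F) (i : Fin q) (a : A) (t : F) :
    pointEval f (Function.update z i (𝒜.D a, t)) =
      -(t • pointEval f (Function.update z i (a, t))) := by
  have := congrArg (evalVars M (Function.update (fun i => (z i).2) i t))
    (cochains_D hf (Function.update (fun i => (z i).1) i a) i)
  simpa [pointEval_update, evalVars_X_smul] using this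

/-- The bridge to the Chevalley–Eilenberg differential: both are explicit sums and agree term by
term, the substitution `λ_k + λ_l` being the scalar component of the bracket of points. -/
theorem pointEval_preD {ℳ : LCModule 𝒜 M} {q : ℕ} {f : PreCochain F A M q}
    (hf : f ∈ ℳ.cochains q) :
    pointEval (ℳ.preD q f) = ceD 𝒜.pointBracket ℳ.pointAct (pointEval f) := by
  funext z
  rw [ceD_eq_sum (pointEval_isAlternating hf), preD, LinearMap.add_apply, pointEval,
    add_apply, map_add]
  congr 1
  · simp only [ceActSum, LinearMap.sum_apply, sum_apply, map_sum]
    refine Finset.sum_congr rfl fun k _ => ?_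
    rw [LinearMap.smul_apply, smul_apply, map_smul, actTerm_apply, evalVars_actAt,
      evalVars_rename, MvPolynomial.eval_X, pointAct_apply,
      show ((-1 : F) ^ (k : ℕ)) = (((-1 : ℤ) ^ (k : ℕ) : ℤ) : F) by simp,
      Int.cast_smul_eq_zsmul]
    rfl
  · cases q with
    | zero => simp [bracketSum, ceBracketSum]
    | succ r =>
      simp only [ceBracketSum, bracketSum, LinearMap.sum_apply, sum_apply, map_sum]
      refine Finset.sum_congr rfl fun l _ => Finset.sum_congr rfl fun k _ => ?_
      split_ifs
      · rw [LinearMap.smul_apply, smul_apply, map_smul, bracketTerm_apply,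
          evalVars_insertAt, evalVars_evalAt, MvPolynomial.eval_X,
          show ((-1 : F) ^ ((k : ℕ) + (l : ℕ))) = (((-1 : ℤ) ^ ((k : ℕ) + (l : ℕ)) : ℤ) : F) by simp,
          Int.cast_smul_eq_zsmul, pointEval]
        congr 2
        · congr 1
          funext i
          refine Fin.cases ?_ (fun i => ?_) i
          · simp [pairVars_zero, LieConformalAlgebra.pointBracket]
          · simp [pairVars_succ, Fin.removeNth]
        · congr 1
          funext i
          refine Fin.cases ?_ (fun i => ?_) i
          · simp [LieConformalAlgebra.pointBracket, prodAt_apply]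
          · simp [Fin.removeNth]
      · simp

/-- Characteristic zero makes `F` infinite, so the identity may be checked on points, where it is
`ceD_ceD`. -/
theorem d_d [CharZero F] (ℳ : LCModule 𝒜 M) (q : ℕ) (f : ℳ.cochains q) :
    ℳ.d (q + 1) (ℳ.d q f) = 0 := by
  apply Subtype.ext
  apply pointEval_injective
  change pointEval (ℳ.preD (q + 1) (ℳ.preD q f.1)) = _
  rw [pointEval_preD (ℳ.preD_mem q f.1 f.2), pointEval_preD f.2,
    ceD_ceD ℳ.pointAct_pointBracket (pointEval_respectsJacobi 𝒜 f.1)]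
  funext z
  simp [pointEval]

end LCModule

end Model

end LieConformal

namespace LieConformal

/-! ## Coefficients of functions depending polynomially on a scalar -/

section Coefficients

variable {F : Type*} [Field F] {M : Type*} [AddCommGroup M] [Module F M]

/-- The coefficient of `λ ^ n` in an element of `M[λ]`. -/
noncomputable def polyCoeff (M : Type*) [AddCommGroup M] [Module F M] (n : ℕ) :
    F[X] ⊗[F] M →ₗ[F] M :=
  (TensorProduct.lid F M).toLinearMap ∘ₗ LinearMap.rTensor M (Polynomial.lcoeff F n)

theorem polyCoeff_tmul (n : ℕ) (p : F[X]) (m : M) :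
    polyCoeff M n (p ⊗ₜ m) = p.coeff n • m := by
  simp [polyCoeff]

theorem evalVar_zero (x : F[X] ⊗[F] M) : evalVar M 0 x = polyCoeff M 0 x := by
  induction x with
  | zero => simp
  | add x y hx hy => simp only [map_add, hx, hy]
  | tmul p m => rw [evalVar_tmul, polyCoeff_tmul, Polynomial.coeff_zero_eq_eval_zero]

theorem evalVar_injective [Infinite F] {x y : F[X] ⊗[F] M}
    (h : ∀ t, evalVar M t x = evalVar M t y) : x = y := by
  classical
  let b := Module.Basis.ofVectorSpace F M
  apply (TensorProduct.equivFinsuppOfBasisRight (M := F[X]) b).injective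
  ext1 i
  apply Polynomial.funext
  intro t
  have key : ∀ x : F[X] ⊗[F] M,
      (TensorProduct.equivFinsuppOfBasisRight b x i).eval t = b.repr (evalVar M t x) i := by
    intro x
    induction x with
    | zero => simp
    | add x y hx hy => simp only [map_add, Finsupp.add_apply, Polynomial.eval_add, hx, hy]
    | tmul p m =>
      rw [TensorProduct.equivFinsuppOfBasisRight_apply_tmul_apply, evalVar_tmul]
      simp [mul_comm]
  rw [key, key, h t]

/-- `φ` is a polynomial function of a scalar, with `n`-th coefficient `m`. -/
def HasCoeff (n : ℕ) (φ : F → M) (m : M) : Prop :=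
  ∃ p : F[X] ⊗[F] M, (∀ t, evalVar M t p = φ t) ∧ polyCoeff M n p = m

/-- Over an infinite field the function determines the polynomial, hence its coefficients. -/
theorem HasCoeff.unique [Infinite F] {n : ℕ} {φ : F → M} {m m' : M} (h : HasCoeff n φ m)
    (h' : HasCoeff n φ m') : m = m' := by
  obtain ⟨p, hp, rfl⟩ := h
  obtain ⟨p', hp', rfl⟩ := h'
  rw [evalVar_injective fun t => (hp t).trans (hp' t).symm]

theorem HasCoeff.eq_apply_zero {φ : F → M} {m : M} (h : HasCoeff 0 φ m) : m = φ 0 := by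
  obtain ⟨p, hp, rfl⟩ := h
  rw [← hp, evalVar_zero]

theorem hasCoeff_zero (n : ℕ) : HasCoeff n (fun _ : F => (0 : M)) 0 := ⟨0, by simp, by simp⟩

theorem HasCoeff.add {n : ℕ} {φ ψ : F → M} {m m' : M} (h : HasCoeff n φ m)
    (h' : HasCoeff n ψ m') : HasCoeff n (fun t => φ t + ψ t) (m + m') := by
  obtain ⟨p, hp, rfl⟩ := h
  obtain ⟨p', hp', rfl⟩ := h'
  exact ⟨p + p', by simp [hp, hp'], by simp⟩

theorem HasCoeff.linear {N : Type*} [AddCommGroup N] [Module F N] {n : ℕ} {φ : F → M} {m : M}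
    (h : HasCoeff n φ m) (ℓ : M →ₗ[F] N) : HasCoeff n (fun t => ℓ (φ t)) (ℓ m) := by
  obtain ⟨p, hp, rfl⟩ := h
  have key : ∀ p : F[X] ⊗[F] M, (∀ t, evalVar N t (LinearMap.lTensor F[X] ℓ p) = ℓ (evalVar M t p)) ∧
      polyCoeff N n (LinearMap.lTensor F[X] ℓ p) = ℓ (polyCoeff M n p) := by
    intro p
    induction p with
    | zero => simp
    | add x y hx hy => simp only [map_add, hx, hy, implies_true, and_self]
    | tmul p m => simp [evalVar_tmul, polyCoeff_tmul]
  exact ⟨LinearMap.lTensor F[X] ℓ p, fun t => by rw [(key p).1, hp], (key p).2⟩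

theorem HasCoeff.neg {n : ℕ} {φ : F → M} {m : M} (h : HasCoeff n φ m) :
    HasCoeff n (fun t => -φ t) (-m) := h.linear (-LinearMap.id)

theorem HasCoeff.sub {n : ℕ} {φ ψ : F → M} {m m' : M} (h : HasCoeff n φ m)
    (h' : HasCoeff n ψ m') : HasCoeff n (fun t => φ t - ψ t) (m - m') := by
  simpa only [sub_eq_add_neg] using h.add h'.neg

theorem HasCoeff.sum {ι : Type*} (s : Finset ι) {n : ℕ} {φ : ι → F → M} {m : ι → M}
    (h : ∀ i ∈ s, HasCoeff n (φ i) (m i)) :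
    HasCoeff n (fun t => ∑ i ∈ s, φ i t) (∑ i ∈ s, m i) := by
  classical
  induction s using Finset.induction_on with
  | empty => simpa using hasCoeff_zero n
  | insert i s hi ih =>
    simp only [Finset.sum_insert hi]
    exact (h i (by simp)).add (ih fun j hj => h j (by simp [hj]))

theorem hasCoeff_eval (n : ℕ) (p : F[X]) (m : M) :
    HasCoeff n (fun t => p.eval t • m) (p.coeff n • m) :=
  ⟨p ⊗ₜ m, fun t => evalVar_tmul t p m, polyCoeff_tmul n p m⟩

theorem hasCoeff_evalVar (n : ℕ) (p : F[X] ⊗[F] M) :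
    HasCoeff n (fun t => evalVar M t p) (polyCoeff M n p) := ⟨p, fun _ => rfl, rfl⟩

/-- The coefficient of `λ_1 ^ n` in an element of `M[λ_1, …, λ_{q+1}]`. -/
noncomputable def firstCoeff (M : Type*) [AddCommGroup M] [Module F M] {q : ℕ} (n : ℕ) :
    MvPolynomial (Fin (q + 1)) F ⊗[F] M →ₗ[F] MvPolynomial (Fin q) F ⊗[F] M :=
  LinearMap.rTensor M (((Polynomial.lcoeff (MvPolynomial (Fin q) F) n).restrictScalars F) ∘ₗ
    (MvPolynomial.finSuccEquiv F q).toLinearMap)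

theorem firstCoeff_tmul {q : ℕ} (n : ℕ) (p : MvPolynomial (Fin (q + 1)) F) (m : M) :
    firstCoeff M n (p ⊗ₜ m) = (MvPolynomial.finSuccEquiv F q p).coeff n ⊗ₜ m := by
  simp [firstCoeff]

theorem firstCoeff_X_succ_smul {q : ℕ} (n : ℕ) (i : Fin q)
    (x : MvPolynomial (Fin (q + 1)) F ⊗[F] M) :
    firstCoeff M n ((MvPolynomial.X i.succ : MvPolynomial (Fin (q + 1)) F) • x) =
      (MvPolynomial.X i : MvPolynomial (Fin q) F) • firstCoeff M n x := by
  induction x with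
  | zero => simp
  | add x y hx hy => simp only [smul_add, map_add, hx, hy]
  | tmul p m => simp [TensorProduct.smul_tmul', firstCoeff_tmul, MvPolynomial.finSuccEquiv_X_succ]

/-- The permutation `decomposeFin.symm (0, τ)` fixes the first index, so the variable whose
coefficient is extracted is untouched. -/
theorem firstCoeff_rename {q : ℕ} (n : ℕ) (τ : Equiv.Perm (Fin q))
    (x : MvPolynomial (Fin (q + 1)) F ⊗[F] M) :
    firstCoeff M n (substVars M
      (MvPolynomial.rename (Equiv.Perm.decomposeFin.symm (0, τ))) x) =
      substVars M (MvPolynomial.rename τ) (firstCoeff M n x) := by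
  induction x with
  | zero => simp
  | add x y hx hy => simp only [map_add, hx, hy]
  | tmul p m =>
    simp only [substVars_tmul, firstCoeff_tmul]
    congr 1
    have : ((MvPolynomial.finSuccEquiv F q).toAlgHom.comp
        (MvPolynomial.rename (Equiv.Perm.decomposeFin.symm (0, τ)))) =
        (Polynomial.mapAlgHom (MvPolynomial.rename (R := F) τ)).comp
          (MvPolynomial.finSuccEquiv F q).toAlgHom := by
      ext1 i
      refine Fin.cases ?_ (fun i => ?_) i
      · simp [MvPolynomial.finSuccEquiv_X_zero]
      · simp [MvPolynomial.finSuccEquiv_X_succ]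
    have := congrArg (fun g => (g p).coeff n) this
    simpa using this

theorem hasCoeff_evalVars_cons {q : ℕ} (n : ℕ) (v : Fin q → F)
    (x : MvPolynomial (Fin (q + 1)) F ⊗[F] M) :
    HasCoeff n (fun t => evalVars M (Fin.cons t v : Fin (q + 1) → F) x)
      (evalVars M v (firstCoeff M n x)) := by
  induction x with
  | zero => simpa using hasCoeff_zero n
  | add x y hx hy => simpa only [map_add] using hx.add hy
  | tmul p m =>
    have := hasCoeff_eval n (Polynomial.map (MvPolynomial.eval v) (MvPolynomial.finSuccEquiv F q p)) m
    simpa only [evalVars_tmul, firstCoeff_tmul, Polynomial.coeff_map,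
      ← MvPolynomial.eval_eq_eval_mv_eval'] using this

/-- The differential only applies linear maps to values and takes finite sums, so it commutes with
extracting a coefficient in a parameter `t`. This passes from contraction with `(a, t)` to
contraction with a mode of `a`. -/
theorem HasCoeff.ceD {Z : Type*} (β : Z → Z → Z) (α : Z → M →+ M)
    (hα : ∀ z, ∃ ℓ : M →ₗ[F] M, ∀ m, α z m = ℓ m) {n q : ℕ}
    {φ : F → (Fin q → Z) → M} {ψ : (Fin q → Z) → M}
    (h : ∀ v, HasCoeff n (fun t => φ t v) (ψ v)) (w : Fin (q + 1) → Z) :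
    HasCoeff n (fun t => LieConformal.ceD β α (φ t) w) (LieConformal.ceD β α ψ w) := by
  have hθ : ∀ {q : ℕ} {φ : F → (Fin q → Z) → M} {ψ : (Fin q → Z) → M}
      (_ : ∀ v, HasCoeff n (fun t => φ t v) (ψ v)) (z : Z) (v : Fin q → Z),
      HasCoeff n (fun t => lieDeriv β α z (φ t) v) (lieDeriv β α z ψ v) := by
    intro q φ ψ h z v
    obtain ⟨ℓ, hℓ⟩ := hα z
    simp only [lieDeriv, hℓ]
    exact ((h v).linear ℓ).sub (HasCoeff.sum _ fun i _ => h _)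
  induction q with
  | zero => exact hθ h _ _
  | succ q ih => exact (hθ h _ _).sub (ih (fun v => h _) _)

end Coefficients

/-! ## Contractions -/

namespace LCModule

variable {F : Type*} [Field F] {A : Type*} [AddCommGroup A] [Module F A]
  {𝒜 : LieConformalAlgebra F A} {M : Type*} [AddCommGroup M] [Module F M]

/-- The coefficient of `λ_1 ^ n` in `f_{λ_1, …, λ_{q+1}}(a, a_2, …, a_{q+1})`. -/
noncomputable def preContract (a : A) (n : ℕ) {q : ℕ} :
    PreCochain F A M (q + 1) →ₗ[F] PreCochain F A M q where
  toFun f := (firstCoeff M n).compMultilinearMap (f.curryLeft a)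
  map_add' f g := by ext v; simp
  map_smul' c f := by ext v; simp

theorem preContract_apply (a : A) (n : ℕ) {q : ℕ} (f : PreCochain F A M (q + 1)) (v : Fin q → A) :
    preContract a n f v = firstCoeff M n (f (Fin.cons a v)) := rfl

theorem preContract_mem (ℳ : LCModule 𝒜 M) (a : A) (n q : ℕ) (f : PreCochain F A M (q + 1))
    (hf : f ∈ ℳ.cochains (q + 1)) : preContract a n f ∈ ℳ.cochains q := by
  constructor
  · intro v i
    have := cochains_D hf (Fin.cons a v) i.succ
    rw [Fin.cons_succ, ← Fin.cons_update] at this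
    rw [preContract_apply, this, map_neg, firstCoeff_X_succ_smul, preContract_apply]
  · intro τ v
    have h := cochains_skew hf (Equiv.Perm.decomposeFin.symm (0, τ))
      (Fin.cons a v : Fin (q + 1) → A)
    have h2 : (Fin.cons a v : Fin (q + 1) → A) ∘ (Equiv.Perm.decomposeFin.symm (0, τ)) =
        Fin.cons a (v ∘ τ) := by
      funext j
      refine Fin.cases ?_ (fun j => ?_) j <;> simp
    rw [h2] at h
    rw [preContract_apply, ← firstCoeff_rename, h, map_smul, preContract_apply]
    simp

/-- The contraction of cochains with the `n`-th mode of `a`. -/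
noncomputable def contract (ℳ : LCModule 𝒜 M) (a : A) (n q : ℕ) :
    ℳ.cochains (q + 1) →ₗ[F] ℳ.cochains q :=
  (preContract a n).restrict (ℳ.preContract_mem a n q)

theorem contract_apply (ℳ : LCModule 𝒜 M) (a : A) (n q : ℕ) (f : ℳ.cochains (q + 1))
    (v : Fin q → A) : (ℳ.contract a n q f).1 v = firstCoeff M n (f.1 (Fin.cons a v)) := rfl

/-- Contraction with a mode is a coefficient, in `t`, of contraction with the point `(a, t)`;
identities for points can thus be read off mode by mode. -/
theorem hasCoeff_pointEval_cons (a : A) (n : ℕ) {q : ℕ} (f : PreCochain F A M (q + 1))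
    (z : Fin q → A × F) : HasCoeff n (fun t => pointEval f (Fin.cons (a, t) z))
      (pointEval (preContract a n f) z) := by
  have := hasCoeff_evalVars_cons n (fun i => (z i).2) (f (Fin.cons a fun i => (z i).1))
  convert this using 2 with t
  · rw [pointEval]
    congr 1
    · congr 1
      funext i
      refine Fin.cases ?_ (fun i => ?_) i <;> simp
    · congr 1
      funext i
      refine Fin.cases ?_ (fun i => ?_) i <;> simp
  · rfl

variable [CharZero F]

/-- The anticommutator of `d` with the contraction by the `n`-th mode of `a`. -/
noncomputable def cartan (ℳ : LCModule 𝒜 M) (a : A) (n : ℕ) :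
    ∀ q, ℳ.cochains q →ₗ[F] ℳ.cochains q
  | 0 => ℳ.contract a n 0 ∘ₗ ℳ.d 0
  | q + 1 => ℳ.d q ∘ₗ ℳ.contract a n q + ℳ.contract a n (q + 1) ∘ₗ ℳ.d (q + 1)

/-- Both sides reduce to d ι d because d² = 0. -/
theorem cartan_d (ℳ : LCModule 𝒜 M) (a : A) (n q : ℕ) (f : ℳ.cochains q) :
    ℳ.cartan a n (q + 1) (ℳ.d q f) = ℳ.d q (ℳ.cartan a n q f) := by
  cases q <;> simp [cartan, d_d]

/-- Cartan's formula. -/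
theorem hasCoeff_lieDeriv (ℳ : LCModule 𝒜 M) (a : A) (n q : ℕ) (f : ℳ.cochains q)
    (z : Fin q → A × F) :
    HasCoeff n (fun t => lieDeriv 𝒜.pointBracket ℳ.pointAct (a, t) (pointEval f.1) z)
      (pointEval (ℳ.cartan a n q f).1 z) := by
  have h1 := hasCoeff_pointEval_cons a n (ℳ.preD q f.1) z
  rw [pointEval_preD f.2] at h1
  cases q with
  | zero =>
    simp only [ceD_zero_cons] at h1
    exact h1
  | succ q =>
    have h2 := HasCoeff.ceD 𝒜.pointBracket ℳ.pointAct
      (fun z => ⟨prodAt ℳ.act z.2 z.1, fun m => rfl⟩) (hasCoeff_pointEval_cons a n f.1) z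
    rw [← pointEval_preD (ℳ.preContract_mem a n q f.1 f.2)] at h2
    have h3 := h2.add h1
    -- On points ι d = θ - d ι, so adding d ι leaves the Lie derivative alone.
    simp only [ceD_succ_cons, add_sub_cancel] at h3
    convert h3 using 1
    exact map_add (evalVars M _) _ _

/-- The coefficient of `t ^ 0` is the value at `t = 0`. There `(a, 0)` acts by ∂ on values and
replaces each `a_i` by `∂ a_i`, which amounts to the factor `-λ_i`; the Lie derivative subtracts
these terms. -/
theorem cartan_zero_eq_del (ℳ : LCModule 𝒜 M) {a : A}
    (hA : ∀ b, prodAt 𝒜.bracket 0 a b = 𝒜.D b) (hM : ∀ m, prodAt ℳ.act 0 a m = ℳ.D m)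
    (q : ℕ) : ℳ.cartan a 0 q = ℳ.del q := by
  refine LinearMap.ext fun f => Subtype.ext (pointEval_injective (funext fun z => ?_))
  rw [(ℳ.hasCoeff_lieDeriv a 0 q f z).eq_apply_zero, lieDeriv, pointAct_apply, hM]
  change _ = pointEval (ℳ.preDel q f.1) z
  simp only [pointEval, preDel_apply, map_add, evalVars_baseChange, evalVars_smul,
    map_sum, MvPolynomial.eval_X, Finset.sum_smul]
  rw [sub_eq_add_neg, ← Finset.sum_neg_distrib]
  congr 1
  refine Finset.sum_congr rfl fun i _ => ?_
  have := pointEval_D f.2 z i (z i).1 (z i).2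
  rw [LieConformalAlgebra.pointBracket, hA, zero_add]
  rw [show (((z i).1, (z i).2) : A × F) = z i from rfl, Function.update_eq_self] at this
  exact neg_eq_iff_eq_neg.mpr this

end LCModule

end LieConformal

namespace LieConformal

/-! ## The weight operator -/

/-! ### Monomial coefficients, partial derivatives and Taylor expansion in one variable -/

section VarCoeff

variable {F : Type*} [Field F] {M : Type*} [AddCommGroup M] [Module F M]

/-- The coefficient of a monomial in an element of `M[λ_i]`. -/
noncomputable def varCoeff {σ : Type*} (M : Type*) [AddCommGroup M] [Module F M] (m : σ →₀ ℕ) :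
    MvPolynomial σ F ⊗[F] M →ₗ[F] M :=
  (TensorProduct.lid F M).toLinearMap ∘ₗ LinearMap.rTensor M (MvPolynomial.lcoeff F m)

theorem varCoeff_tmul {σ : Type*} (m : σ →₀ ℕ) (p : MvPolynomial σ F) (x : M) :
    varCoeff M m (p ⊗ₜ x) = MvPolynomial.coeff m p • x := by
  simp [varCoeff]

theorem varCoeff_injective {σ : Type*} {x y : MvPolynomial σ F ⊗[F] M}
    (h : ∀ m, varCoeff M m x = varCoeff M m y) : x = y := by
  classical
  apply (TensorProduct.equivFinsuppOfBasisLeft (N := M)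
    (MvPolynomial.basisMonomials σ F)).injective
  ext1 m
  have key : ∀ x : MvPolynomial σ F ⊗[F] M,
      TensorProduct.equivFinsuppOfBasisLeft (MvPolynomial.basisMonomials σ F) x m =
        varCoeff M m x := by
    intro x
    induction x with
    | zero => simp
    | add x y hx hy => simp only [map_add, Finsupp.add_apply, hx, hy]
    | tmul p x =>
      rw [TensorProduct.equivFinsuppOfBasisLeft_apply_tmul_apply, varCoeff_tmul]
      rfl
  rw [key, key, h m]

theorem varCoeff_rename {σ τ : Type*} {f : σ → τ} (hf : Function.Injective f) (m : σ →₀ ℕ)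
    (x : MvPolynomial σ F ⊗[F] M) :
    varCoeff M (m.mapDomain f) (substVars M (MvPolynomial.rename f) x) = varCoeff M m x := by
  induction x with
  | zero => simp
  | add x y hx hy => simp only [map_add, hx, hy]
  | tmul p x => rw [substVars_tmul, varCoeff_tmul, varCoeff_tmul,
      MvPolynomial.coeff_rename_mapDomain _ hf]

/-- The partial derivative of an element of `M[λ_i]`. -/
noncomputable def partialDeriv {σ : Type*} (i : σ) :
    MvPolynomial σ F ⊗[F] M →ₗ[F] MvPolynomial σ F ⊗[F] M :=
  LinearMap.rTensor M (MvPolynomial.pderiv i : Derivation F _ _).toLinearMap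

theorem partialDeriv_tmul {σ : Type*} (i : σ) (p : MvPolynomial σ F) (x : M) :
    partialDeriv i (p ⊗ₜ[F] x) = MvPolynomial.pderiv i p ⊗ₜ x := by
  simp [partialDeriv]

theorem coeff_X_mul_pderiv {σ : Type*} (i : σ) (p : MvPolynomial σ F) (m : σ →₀ ℕ) :
    MvPolynomial.coeff m (MvPolynomial.X i * MvPolynomial.pderiv i p) =
      m i * MvPolynomial.coeff m p := by
  classical
  induction p using MvPolynomial.induction_on' with
  | add p q hp hq => simp only [map_add, mul_add, MvPolynomial.coeff_add, hp, hq]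
  | monomial u a =>
    rw [MvPolynomial.pderiv_monomial, MvPolynomial.X, MvPolynomial.monomial_mul, one_mul,
      MvPolynomial.coeff_monomial, MvPolynomial.coeff_monomial]
    -- If `u i = 0` the truncated subtraction in the exponent is not undone by adding `single i 1`,
    -- but the factor `u i` kills the term.
    by_cases hu : u i = 0
    · rw [hu]
      rcases eq_or_ne u m with rfl | h
      · simp [hu]
      · simp [h]
    · have : Finsupp.single i 1 + (u - Finsupp.single i 1) = u := by
        apply add_tsub_cancel_of_le
        simpa using Nat.one_le_iff_ne_zero.mpr hu
      rw [this]
      split_ifs with h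
      · rw [h, mul_comm]
      · simp

theorem varCoeff_X_smul_partialDeriv {σ : Type*} (m : σ →₀ ℕ) (i : σ)
    (x : MvPolynomial σ F ⊗[F] M) :
    varCoeff M m ((MvPolynomial.X i : MvPolynomial σ F) • partialDeriv i x) =
      (m i : F) • varCoeff M m x := by
  induction x with
  | zero => simp
  | add x y hx hy => simp only [map_add, smul_add, hx, hy]
  | tmul p x => rw [partialDeriv_tmul, TensorProduct.smul_tmul', varCoeff_tmul, varCoeff_tmul,
      smul_eq_mul, coeff_X_mul_pderiv, mul_smul]

theorem varCoeff_lTensor {σ : Type*} (m : σ →₀ ℕ) (ℓ : M →ₗ[F] M)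
    (x : MvPolynomial σ F ⊗[F] M) :
    varCoeff M m (LinearMap.lTensor _ ℓ x) = ℓ (varCoeff M m x) := by
  induction x with
  | zero => simp
  | add x y hx hy => simp only [map_add, hx, hy]
  | tmul p x => simp [varCoeff_tmul]

theorem evalVars_lTensor {σ : Type*} (v : σ → F) (ℓ : M →ₗ[F] M)
    (x : MvPolynomial σ F ⊗[F] M) :
    evalVars M v (LinearMap.lTensor _ ℓ x) = ℓ (evalVars M v x) := by
  induction x with
  | zero => simp
  | add x y hx hy => simp only [map_add, hx, hy]
  | tmul p x => simp [evalVars_tmul]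

variable {σ : Type*} [DecidableEq σ]

/-- The Taylor expansion of a polynomial in the direction of one of the variables. -/
noncomputable def taylorAt (v : σ → F) (i : σ) : MvPolynomial σ F →ₐ[F] F[X] :=
  MvPolynomial.aeval (Function.update (fun j => Polynomial.C (v j)) i
    (Polynomial.X + Polynomial.C (v i)))

theorem eval_taylorAt (v : σ → F) (i : σ) (p : MvPolynomial σ F) (t : F) :
    (taylorAt v i p).eval t = MvPolynomial.eval (Function.update v i (t + v i)) p := by
  have : (Polynomial.aeval t).comp (taylorAt v i) =
      MvPolynomial.aeval (Function.update v i (t + v i)) := by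
    ext j
    rcases eq_or_ne j i with rfl | h <;> simp [taylorAt, *]
  have := congrArg (fun g => g p) this
  simpa [MvPolynomial.aeval_eq_eval, Polynomial.coe_aeval_eq_eval] using this

theorem coeff_zero_taylorAt (v : σ → F) (i : σ) (p : MvPolynomial σ F) :
    (taylorAt v i p).coeff 0 = MvPolynomial.eval v p := by
  rw [Polynomial.coeff_zero_eq_eval_zero, eval_taylorAt, zero_add, Function.update_eq_self]

theorem coeff_one_taylorAt (v : σ → F) (i : σ) (p : MvPolynomial σ F) :
    (taylorAt v i p).coeff 1 = MvPolynomial.eval v (MvPolynomial.pderiv i p) := by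
  induction p using MvPolynomial.induction_on with
  | C a => simp [taylorAt, Polynomial.algebraMap_eq]
  | add p q hp hq => simp only [map_add, Polynomial.coeff_add, hp, hq]
  | mul_X p j hp =>
    rw [map_mul, Polynomial.mul_coeff_one, hp, coeff_zero_taylorAt, coeff_zero_taylorAt,
      Derivation.leibniz, map_add]
    rcases eq_or_ne j i with rfl | h
    · simp [taylorAt]; ring
    · simp [taylorAt, Function.update_of_ne h, MvPolynomial.pderiv_X_of_ne h]; ring

/-- Bracketing with `(L, t)` turns a generator of weight Δ at `λ_i` into `∂ + Δ t` applied to it, at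
`λ_i + t`. As ∂ contributes `-(λ_i + t)`, the factor is `-((1 - Δ) t + λ_i)`. With `s = 1 - Δ`, the
linear term in `t` gives `s` plus the Euler operator in `λ_i`. -/
theorem hasCoeff_smul_evalVars_update (s : F) (v : σ → F) (i : σ)
    (x : MvPolynomial σ F ⊗[F] M) :
    HasCoeff 1 (fun t => (s * t + v i) • evalVars M (Function.update v i (t + v i)) x)
      (evalVars M v (s • x + (MvPolynomial.X i : MvPolynomial σ F) • partialDeriv i x)) := by
  induction x with
  | zero => simpa using hasCoeff_zero 1
  | add x y hx hy =>
    convert hx.add hy using 2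
    · simp
    · rw [← map_add]; congr 1; simp only [map_add, smul_add]; abel
  | tmul p x =>
    convert hasCoeff_eval 1 ((Polynomial.C s * Polynomial.X + Polynomial.C (v i)) *
      taylorAt v i p) x using 2 with t
    · rw [evalVars_tmul, smul_smul, Polynomial.eval_mul, eval_taylorAt]; simp
    · rw [Polynomial.mul_coeff_one, coeff_zero_taylorAt, coeff_one_taylorAt, partialDeriv_tmul,
        map_add, map_smul, evalVars_X_smul, evalVars_tmul, evalVars_tmul, smul_smul, smul_smul,
        ← add_smul]
      congr 1
      simp; ring

end VarCoeff

/-! ### The grading of `W(1)` by the first mode of `L` -/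

namespace WSpace

variable {F : Type*} [Field F]

/-- The generators: `L` for `false` and `H` for `true`. -/
noncomputable def gen (F : Type*) [Field F] : Bool → WSpace F
  | false => L F
  | true => H F

/-- The action of the first mode of `L`. -/
noncomputable def modeOne (F : Type*) [Field F] : WSpace F →ₗ[F] WSpace F :=
  polyCoeff (WSpace F) 1 ∘ₗ bracket 1 (L F)

/-- True on generators for every `b`, and at `λ = 0` the operator `L_λ` commutes with ∂. -/
theorem prodAt_zero_L (b : F) (x : WSpace F) : prodAt (bracket b) 0 (L F) x = D F x := by
  rw [prodAt_apply]
  induction x using induct with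
  | hL => simp [bracket_L_L, evalVar_tmul]
  | hH => simp [bracket_L_H, evalVar_tmul]
  | hadd x y hx hy => simp only [map_add, hx, hy]
  | hsmul c x hx => simp only [map_smul, hx]
  | hD x hx => rw [bracket_D_right, map_add, evalVar_baseChange, evalVar_X_smul, hx, zero_smul,
      add_zero]

theorem polyCoeff_succ_X_smul {M : Type*} [AddCommGroup M] [Module F M] (n : ℕ)
    (x : F[X] ⊗[F] M) : polyCoeff M (n + 1) ((Polynomial.X : F[X]) • x) = polyCoeff M n x := by
  induction x with
  | zero => simp
  | add x y hx hy => simp only [map_add, smul_add, hx, hy]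
  | tmul p m => simp [TensorProduct.smul_tmul', polyCoeff_tmul]

theorem polyCoeff_baseChange {M : Type*} [AddCommGroup M] [Module F M] (n : ℕ) (D : M →ₗ[F] M)
    (x : F[X] ⊗[F] M) : polyCoeff M n (D.baseChange _ x) = D (polyCoeff M n x) := by
  induction x with
  | zero => simp
  | add x y hx hy => simp only [map_add, hx, hy]
  | tmul p m => simp [polyCoeff_tmul]

/-- The extra term is the linear coefficient of `λ (L_λ x)`, namely `L_λ x` at `λ = 0`, which is
`∂x`. -/
theorem modeOne_D (x : WSpace F) : modeOne F (D F x) = D F (modeOne F x) + D F x := by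
  rw [modeOne, LinearMap.comp_apply, bracket_D_right, map_add, polyCoeff_baseChange,
    polyCoeff_succ_X_smul, ← evalVar_zero, ← prodAt_apply, prodAt_zero_L]
  rfl

/-- By `modeOne_D` each ∂ raises the eigenvalue by one, starting from 2 on `L` and 0 on `H`. -/
theorem modeOne_coeff (x : WSpace F) (k : ℕ) :
    (modeOne F x).1.coeff k = (k + 2) * x.1.coeff k ∧
      (modeOne F x).2.coeff k = k * x.2.coeff k := by
  induction x using induct generalizing k with
  | hL =>
    have : modeOne F (L F) = (2 : F) • L F := by
      simp [modeOne, bracket_L_L, polyCoeff_tmul, Polynomial.coeff_one]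
    rw [this]
    rcases eq_or_ne k 0 with rfl | h <;> simp [L, Polynomial.coeff_one, *]
  | hH =>
    have : modeOne F (H F) = 0 := by
      simp [modeOne, bracket_L_H, polyCoeff_tmul, Polynomial.coeff_one]
    rw [this]
    rcases eq_or_ne k 0 with rfl | h <;> simp [H, Polynomial.coeff_one, *]
  | hadd x y hx hy => simp [hx, hy, mul_add]
  | hsmul c x hx => simp [hx, mul_left_comm]
  | hD x hx =>
    rw [modeOne_D]
    cases k with
    | zero => simp [D_apply]
    | succ k =>
      simp only [D_apply, Prod.fst_add, Prod.snd_add, Prod.smul_fst, Prod.smul_snd, smul_eq_mul,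
        Polynomial.coeff_add, Polynomial.coeff_X_mul, hx]
      push_cast
      constructor <;> ring

end WSpace

end LieConformal

namespace LieConformal

/-! ## The kernel of the weight operator -/

namespace WSpace

variable {F : Type*} [Field F]

/-- The coefficient of `∂ ^ k L` or `∂ ^ k H` in an element of `W(b)`. -/
noncomputable def coord (F : Type*) [Field F] : Bool → ℕ → WSpace F →ₗ[F] F
  | false, k => Polynomial.lcoeff F k ∘ₗ LinearMap.fst F F[X] F[X]
  | true, k => Polynomial.lcoeff F k ∘ₗ LinearMap.snd F F[X] F[X]

theorem coord_injective {x y : WSpace F} (h : ∀ j k, coord F j k x = coord F j k y) : x = y :=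
  Prod.ext (Polynomial.ext fun k => h false k) (Polynomial.ext fun k => h true k)

/-- The weights of the generators. -/
def confWeight : Bool → ℤ
  | false => 2
  | true => 0

theorem coord_modeOne (j : Bool) (k : ℕ) (x : WSpace F) :
    coord F j k (modeOne F x) = ((k + confWeight j : ℤ) : F) * coord F j k x := by
  cases j
  · simpa [coord, confWeight] using (modeOne_coeff x k).1
  · simpa [coord, confWeight] using (modeOne_coeff x k).2

/-- A value involves finitely many monomials and powers of ∂; this is what bounds the weights in a
cochain. -/
theorem exists_degree_le {σ : Type*} (y : MvPolynomial σ F ⊗[F] WSpace F) :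
    ∃ B : ℕ, ∀ m j k, coord F j k (varCoeff _ m y) ≠ 0 → m.degree + k ≤ B := by
  induction y with
  | zero => exact ⟨0, fun m j k h => absurd (by simp) h⟩
  | add x y hx hy =>
    obtain ⟨B, hB⟩ := hx
    obtain ⟨B', hB'⟩ := hy
    refine ⟨max B B', fun m j k h => ?_⟩
    by_cases hm : coord F j k (varCoeff _ m x) = 0
    · exact (hB' m j k (by rw [map_add, map_add, hm, zero_add] at h; exact h)).trans
        (le_max_right _ _)
    · exact (hB m j k hm).trans (le_max_left _ _)
  | tmul p x =>
    refine ⟨p.totalDegree + max x.1.natDegree x.2.natDegree, fun m j k h => ?_⟩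
    rw [varCoeff_tmul, map_smul] at h
    have h1 := left_ne_zero_of_smul h
    have h2 := right_ne_zero_of_smul h
    refine add_le_add (MvPolynomial.le_totalDegree (MvPolynomial.mem_support_iff.mpr h1)) ?_
    cases j
    · exact (Polynomial.le_natDegree_of_ne_zero h2).trans (le_max_left _ _)
    · exact (Polynomial.le_natDegree_of_ne_zero h2).trans (le_max_right _ _)

end WSpace

open WSpace

/-! ### Coefficients of cochains on generators, and the weight decomposition -/

section WeightOperator

variable {F : Type*} [Field F]

/-- The exponents of a family of generators and exponents. -/
noncomputable def exponents {q : ℕ} (z : Fin q → Bool × ℕ) : Fin q →₀ ℕ :=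
  Finsupp.equivFunOnFinite.symm fun i => (z i).2

/-- The coefficient of `λ_1 ^ {m_1} ⋯ λ_q ^ {m_q}` in the value of a cochain on generators. -/
noncomputable def genCoeff {q : ℕ} (z : Fin q → Bool × ℕ) :
    (adjW F 1).cochains q →ₗ[F] WSpace F where
  toFun f := varCoeff _ (exponents z) (f.1 fun i => gen F (z i).1)
  map_add' f g := by
    rw [← map_add]; rfl
  map_smul' c f := by
    rw [RingHom.id_apply, ← map_smul]; rfl

theorem genCoeff_apply {q : ℕ} (z : Fin q → Bool × ℕ) (f : (adjW F 1).cochains q) :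
    genCoeff z f = varCoeff _ (exponents z) (f.1 fun i => gen F (z i).1) := rfl

/-- Conformal antilinearity determines a cochain by its values on generators. -/
theorem cochain_ext {q : ℕ} {f g : (adjW F 1).cochains q}
    (h : ∀ b : Fin q → Bool, f.1 (fun i => gen F (b i)) = g.1 fun i => gen F (b i)) : f = g := by
  -- `s` is the set of slots allowed to hold arbitrary elements; it is enlarged one slot at a time.
  have key : ∀ (s : Finset (Fin q)) (a : Fin q → WSpace F),
      (∀ i ∉ s, a i = L F ∨ a i = H F) → f.1 a = g.1 a := by
    intro s
    induction s using Finset.induction_on with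
    | empty =>
      intro a ha
      choose b hb using fun i => show ∃ b, a i = gen F b by
        rcases ha i (by simp) with h | h
        exacts [⟨false, h⟩, ⟨true, h⟩]
      rw [show a = fun i => gen F (b i) from funext hb]
      exact h b
    | insert i s hi ih =>
      intro a ha
      have h1 : ∀ x, f.1 (Function.update a i x) = g.1 (Function.update a i x) := by
        intro x
        have hgen : ∀ y, y = L F ∨ y = H F →
            f.1 (Function.update a i y) = g.1 (Function.update a i y) := by
          intro y hy
          refine ih _ fun j hj => ?_
          rcases eq_or_ne j i with rfl | hji
          · simpa using hy
          · rw [Function.update_of_ne hji]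
            exact ha j (by simp [hji, hj])
        induction x using WSpace.induct with
        | hL => exact hgen _ (Or.inl rfl)
        | hH => exact hgen _ (Or.inr rfl)
        | hadd x y hx hy => rw [MultilinearMap.map_update_add, MultilinearMap.map_update_add, hx, hy]
        | hsmul c x hx => rw [MultilinearMap.map_update_smul, MultilinearMap.map_update_smul, hx]
        | hD x hx =>
          have hf := LCModule.cochains_D f.2 (Function.update a i x) i
          have hg := LCModule.cochains_D g.2 (Function.update a i x) i
          simp only [Function.update_self, Function.update_idem] at hf hg
          exact (hf.trans (congrArg (fun y => -((MvPolynomial.X i : MvPolynomial (Fin q) F) • y))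
            hx)).trans hg.symm
      simpa using h1 (a i)
  exact Subtype.ext (MultilinearMap.ext fun a => key Finset.univ a (by simp))

theorem genCoeff_injective {q : ℕ} {f g : (adjW F 1).cochains q}
    (h : ∀ z j k, coord F j k (genCoeff z f) = coord F j k (genCoeff z g)) : f = g := by
  refine cochain_ext fun b => varCoeff_injective fun m => coord_injective fun j k => ?_
  have := h (fun i => (b i, m i)) j k
  simpa only [genCoeff_apply, exponents, Finsupp.equivFunOnFinite_symm_coe] using this

theorem genCoeff_comp_perm {q : ℕ} (z : Fin q → Bool × ℕ) (σ : Equiv.Perm (Fin q))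
    (f : (adjW F 1).cochains q) :
    genCoeff (z ∘ σ) f = ((Equiv.Perm.sign σ : ℤ) : F) • genCoeff z f := by
  have h := congrArg (varCoeff _ (exponents z))
    (LCModule.cochains_skew f.2 σ fun i => gen F (z i).1)
  rw [map_smul] at h
  rw [genCoeff_apply z, ← h, genCoeff_apply]
  have : exponents z = (exponents (z ∘ σ)).mapDomain σ := by
    ext i
    obtain ⟨i, rfl⟩ := σ.surjective i
    rw [Finsupp.mapDomain_apply σ.injective]
    simp [exponents]
  rw [this, varCoeff_rename σ.injective]
  rfl

/-- Swapping two equal pairs (generator, exponent) fixes the coefficient and also changes its sign,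
and 2 is invertible. -/
theorem genCoeff_eq_zero_of_eq [CharZero F] {q : ℕ} {z : Fin q → Bool × ℕ}
    (hz : ¬ Function.Injective z) (f : (adjW F 1).cochains q) : genCoeff z f = 0 := by
  simp only [Function.Injective, not_forall] at hz
  obtain ⟨i, j, hij, hne⟩ := hz
  have h := genCoeff_comp_perm z (Equiv.swap i j) f
  rw [Equiv.comp_swap_eq_update, hij, Function.update_eq_self, ← hij, Function.update_eq_self,
    Equiv.Perm.sign_swap hne] at h
  simp only [Units.val_neg, Units.val_one, Int.cast_neg, Int.cast_one, neg_smul, one_smul] at h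
  exact self_eq_neg.mp h

/-- The contribution of a generator and an exponent to the weight. -/
def modeWeight (z : Bool × ℕ) : ℤ := z.2 + 1 - confWeight z.1

/-- The eigenvalue of the weight operator. -/
def totalWeight {q : ℕ} (j : Bool) (k : ℕ) (z : Fin q → Bool × ℕ) : ℤ :=
  k + confWeight j + ∑ i, modeWeight (z i)

theorem prodAt_L_gen (t : F) (b : Bool) : prodAt (bracket 1) t (L F) (gen F b) =
    D F (gen F b) + ((confWeight b : F) * t) • gen F b := by
  rw [prodAt_apply]
  cases b
  · simp [gen, bracket_L_L, evalVar_tmul, confWeight]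
  · simp [gen, bracket_L_H, evalVar_tmul, confWeight]

theorem exists_abs_totalWeight_le {q : ℕ} (f : (adjW F 1).cochains q) :
    ∃ B : ℤ, ∀ j k z, coord F j k (genCoeff z f) ≠ 0 → |totalWeight j k z| ≤ B := by
  choose B hB using fun b : Fin q → Bool => exists_degree_le (f.1 fun i => gen F (b i))
  have hB0 : ∀ b, B b ≤ ∑ b, B b := fun b =>
    Finset.single_le_sum (fun _ _ => Nat.zero_le _) (Finset.mem_univ b)
  -- The 2 bounds the weight of the generator in the value, `q` the constants `1 - confWeight` in
  -- `[-1, 1]` over the arguments, and the sum the degrees over all choices of generators.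
  refine ⟨2 + q + ∑ b, B b, fun j k z h => ?_⟩
  have h1 := (hB _ _ j k h).trans (hB0 _)
  have h2 : (exponents z).degree = ∑ i, (z i).2 := by
    rw [Finsupp.degree_eq_sum]; rfl
  have h3 : ∀ b : Bool, 0 ≤ confWeight b ∧ confWeight b ≤ 2 := by
    intro b; cases b <;> simp [confWeight]
  have h4 : |∑ i, (1 - confWeight (z i).1)| ≤ q := by
    refine (Finset.abs_sum_le_sum_abs _ _).trans ?_
    refine (Finset.sum_le_sum (g := fun _ => (1 : ℤ)) fun i _ => ?_).trans (by simp)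
    have := h3 (z i).1
    rw [abs_le]; constructor <;> linarith
  have h5 : totalWeight j k z = k + confWeight j + (∑ i, (z i).2 : ℕ) +
      ∑ i, (1 - confWeight (z i).1) := by
    rw [totalWeight]
    push_cast
    rw [add_assoc (_ + _), ← Finset.sum_add_distrib]
    congr 1
    exact Finset.sum_congr rfl fun i _ => by rw [modeWeight]; ring
  rw [h5]
  rw [abs_le] at h4 ⊢
  have := h3 j
  rw [h2] at h1
  zify at h1
  push_cast
  constructor <;> linarith

variable [CharZero F]

/-- The weight operator on cochains. -/
noncomputable def weightOp (F : Type*) [Field F] [CharZero F] (q : ℕ) :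
    Module.End F ((adjW F 1).cochains q) :=
  (adjW F 1).cartan (L F) 1 q

/-- By Cartan's formula W is the coefficient of `t` in the Lie derivative along `(L, t)`. On values
this gives `modeOne`, in each slot the operator from `hasCoeff_smul_evalVars_update`. -/
theorem weightOp_apply_gen {q : ℕ} (f : (adjW F 1).cochains q) (b : Fin q → Bool) :
    (weightOp F q f).1 (fun i => gen F (b i)) =
      LinearMap.lTensor _ (modeOne F) (f.1 fun i => gen F (b i)) +
        ∑ i, (((1 - confWeight (b i) : ℤ) : F) • (f.1 fun i => gen F (b i)) +
          (MvPolynomial.X i : MvPolynomial (Fin q) F) •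
            partialDeriv i (f.1 fun i => gen F (b i))) := by
  refine evalVars_injective fun v => ?_
  have h1 := (adjW F 1).hasCoeff_lieDeriv (L F) 1 q f fun i => (gen F (b i), v i)
  refine h1.unique ?_
  rw [map_add, map_sum, evalVars_lTensor, ← sub_neg_eq_add, ← Finset.sum_neg_distrib]
  refine HasCoeff.sub (hasCoeff_evalVar 1 (bracket 1 (L F) _)) (HasCoeff.sum _ fun i _ => ?_)
  convert (hasCoeff_smul_evalVars_update _ v i (f.1 fun i => gen F (b i))).neg using 2 with t
  have h2 := LCModule.pointEval_D f.2 (fun i => (gen F (b i), v i)) i (gen F (b i)) (t + v i)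
  have h3 : LCModule.pointEval f.1
      (Function.update (fun i => (gen F (b i), v i)) i (gen F (b i), t + v i)) =
      evalVars _ (Function.update v i (t + v i)) (f.1 fun i => gen F (b i)) := by
    rw [LCModule.pointEval_update, Function.update_eq_self]
  have h4 : LCModule.pointEval f.1 (Function.update (fun i => (gen F (b i), v i)) i
      (prodAt (bracket 1) t (L F) (gen F (b i)), t + v i)) =
      LCModule.pointEval f.1 (Function.update (fun i => (gen F (b i), v i)) i
      (D F (gen F (b i)), t + v i)) + ((confWeight (b i) : F) * t) •
      LCModule.pointEval f.1 (Function.update (fun i => (gen F (b i), v i)) i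
      (gen F (b i), t + v i)) := by
    simp only [LCModule.pointEval_update, prodAt_L_gen, MultilinearMap.map_update_add,
      MultilinearMap.map_update_smul, map_add, map_smul]
  refine h4.trans ?_
  refine (congrArg (· + _) h2).trans ?_
  rw [h3]
  push_cast
  module

/-- Every summand in `weightOp_apply_gen` is diagonal: `modeOne` on powers of ∂ times generators,
the Euler operators on monomials, the rest scalars. -/
theorem coord_genCoeff_weightOp {q : ℕ} (j : Bool) (k : ℕ) (z : Fin q → Bool × ℕ)
    (f : (adjW F 1).cochains q) :
    coord F j k (genCoeff z (weightOp F q f)) =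
      (totalWeight j k z : F) * coord F j k (genCoeff z f) := by
  rw [genCoeff_apply, weightOp_apply_gen f fun i => (z i).1]
  simp only [map_add, map_sum, map_smul, varCoeff_lTensor, varCoeff_X_smul_partialDeriv,
    coord_modeOne, ← genCoeff_apply, totalWeight, modeWeight, smul_eq_mul, ← add_mul,
    ← Finset.sum_mul]
  congr 1
  push_cast
  congr 1
  refine Finset.sum_congr rfl fun i _ => ?_
  simp only [exponents, Finsupp.equivFunOnFinite_symm_apply_apply]
  ring

theorem weightOp_d {q : ℕ} (f : (adjW F 1).cochains q) :
    weightOp F (q + 1) ((adjW F 1).d q f) = (adjW F 1).d q (weightOp F q f) :=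
  (adjW F 1).cartan_d _ _ _ _

theorem aeval_weightOp_d {q : ℕ} (p : F[X]) (f : (adjW F 1).cochains q) :
    Polynomial.aeval (weightOp F (q + 1)) p ((adjW F 1).d q f) =
      (adjW F 1).d q (Polynomial.aeval (weightOp F q) p f) := by
  induction p using Polynomial.induction_on generalizing f with
  | C a => simp [Module.algebraMap_end_apply]
  | add p r hp hr => simp only [map_add, LinearMap.add_apply, hp, hr]
  | monomial n a h =>
    rw [pow_succ, ← mul_assoc, map_mul _ (_ * _) Polynomial.X, map_mul _ (_ * _) Polynomial.X,
      Module.End.mul_apply, Module.End.mul_apply, Polynomial.aeval_X, Polynomial.aeval_X,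
      weightOp_d, h]

theorem coord_genCoeff_aeval {q : ℕ} (j : Bool) (k : ℕ) (z : Fin q → Bool × ℕ) (p : F[X])
    (f : (adjW F 1).cochains q) :
    coord F j k (genCoeff z (Polynomial.aeval (weightOp F q) p f)) =
      p.eval (totalWeight j k z : F) * coord F j k (genCoeff z f) := by
  induction p using Polynomial.induction_on generalizing f with
  | C a => simp [Module.algebraMap_end_apply]
  | add p r hp hr => simp only [map_add, LinearMap.add_apply, hp, hr, Polynomial.eval_add, add_mul]
  | monomial n a h =>
    rw [pow_succ, ← mul_assoc, map_mul, Module.End.mul_apply,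
      Polynomial.aeval_X, h, coord_genCoeff_weightOp, Polynomial.eval_mul (q := Polynomial.X),
      Polynomial.eval_X, mul_assoc]

/-- Every cochain is the sum of one of weight zero and one in the image of the weight operator,
both of which are given by polynomials in the weight operator. -/
theorem exists_weight_decomposition {q : ℕ} (f : (adjW F 1).cochains q) :
    ∃ p r : F[X], p + Polynomial.X * r = 1 ∧
      weightOp F q (Polynomial.aeval (weightOp F q) p f) = 0 := by
  obtain ⟨B, hB⟩ := exists_abs_totalWeight_le f
  -- `p₀` vanishes at every possible nonzero weight of `f`. Normalised to 1 at zero, it becomes the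
  -- polynomial in W that projects `f` onto weight zero.
  set s : Finset ℤ := (Finset.Icc (-B) B).erase 0
  set p₀ : F[X] := ∏ n ∈ s, (Polynomial.X - Polynomial.C (n : F)) with hp₀
  have h0 : p₀.eval 0 ≠ 0 := by
    rw [hp₀, Polynomial.eval_prod, Finset.prod_ne_zero_iff]
    intro n hn
    simpa using Finset.ne_of_mem_erase hn
  obtain ⟨r, hr⟩ : Polynomial.X ∣ 1 - Polynomial.C (p₀.eval 0)⁻¹ * p₀ := by
    rw [Polynomial.X_dvd_iff, Polynomial.coeff_zero_eq_eval_zero]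
    simp [h0]
  refine ⟨Polynomial.C (p₀.eval 0)⁻¹ * p₀, r, by rw [← hr]; ring, ?_⟩
  refine genCoeff_injective fun z j k => ?_
  rw [coord_genCoeff_weightOp, coord_genCoeff_aeval, map_zero, map_zero]
  by_cases hz : coord F j k (genCoeff z f) = 0
  · simp [hz]
  by_cases hw : totalWeight j k z = 0
  · simp [hw]
  have : p₀.eval (totalWeight j k z : F) = 0 := by
    rw [hp₀, Polynomial.eval_prod]
    refine Finset.prod_eq_zero (i := totalWeight j k z) ?_ (by simp)
    exact Finset.mem_erase.mpr ⟨hw, Finset.mem_Icc.mpr (abs_le.mp (hB j k z hz))⟩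
  simp [this]

/-- On cocycles the term ι_1 d drops out and W = d ι_1; in degree 0 nothing is left. -/
theorem weightOp_mem_coboundaries {q : ℕ} {f : (adjW F 1).cochains q}
    (hf : (adjW F 1).d q f = 0) : weightOp F q f ∈ (adjW F 1).coboundaries q := by
  cases q with
  | zero =>
    rw [weightOp, LCModule.cartan, LinearMap.comp_apply, hf, map_zero]
    exact Submodule.zero_mem _
  | succ q =>
    rw [weightOp, LCModule.cartan, LinearMap.add_apply, LinearMap.comp_apply, LinearMap.comp_apply,
      hf, map_zero, add_zero]
    exact LinearMap.mem_range_self _ _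

/-- Every cocycle is cohomologous to one of weight zero. -/
theorem exists_weight_zero_cocycle {q : ℕ} {f : (adjW F 1).cochains q}
    (hf : (adjW F 1).d q f = 0) : ∃ g, weightOp F q g = 0 ∧ (adjW F 1).d q g = 0 ∧
      f - g ∈ (adjW F 1).coboundaries q := by
  obtain ⟨p, r, hpr, hp⟩ := exists_weight_decomposition f
  refine ⟨_, hp, by rw [← aeval_weightOp_d, hf, map_zero], ?_⟩
  -- f = p(W) f + W (r(W) f), and the last term is W of a cocycle, hence a coboundary.
  have h1 := congrArg (fun p => Polynomial.aeval (weightOp F q) p f) hpr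
  simp only [map_add, map_mul, Polynomial.aeval_X, map_one, LinearMap.add_apply,
    Module.End.mul_apply, Module.End.one_apply] at h1
  have h2 : (adjW F 1).d q (Polynomial.aeval (weightOp F q) r f) = 0 := by
    rw [← aeval_weightOp_d, hf, map_zero]
  have h3 := weightOp_mem_coboundaries h2
  rwa [eq_sub_of_add_eq' h1] at h3

/-- A coboundary of weight zero is the differential of a cochain of weight zero. -/
theorem exists_weight_zero_of_d {q : ℕ} {u : (adjW F 1).cochains q}
    (hu : weightOp F (q + 1) ((adjW F 1).d q u) = 0) :
    ∃ g, weightOp F q g = 0 ∧ (adjW F 1).d q g = (adjW F 1).d q u := by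
  obtain ⟨p, r, hpr, hp⟩ := exists_weight_decomposition u
  refine ⟨_, hp, ?_⟩
  -- Since W kills du, the identity p + X r = 1 gives p(W) du = du.
  have h1 := congrArg (fun p => Polynomial.aeval (weightOp F (q + 1)) p ((adjW F 1).d q u)) hpr
  rw [mul_comm Polynomial.X r] at h1
  simp only [map_add, map_mul, Polynomial.aeval_X, map_one, LinearMap.add_apply,
    Module.End.mul_apply, Module.End.one_apply, hu, map_zero, add_zero] at h1
  rw [← aeval_weightOp_d, h1]

end WeightOperator

end LieConformal

namespace LieConformal

open WSpace

/-! ## Cochains given by determinants -/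

section DetCochain

variable {F : Type*} [Field F]

/-- The coefficient of a generator. -/
noncomputable def genComp (F : Type*) [Field F] : Bool → WSpace F →ₗ[F] F[X]
  | false => LinearMap.fst F F[X] F[X]
  | true => LinearMap.snd F F[X] F[X]

/-- The rows of the determinant in `preDetCochain`. -/
noncomputable def detRow {q : ℕ} (z : Fin q → Bool × ℕ) (i : Fin q) :
    WSpace F →ₗ[F] Fin q → MvPolynomial (Fin q) F :=
  LinearMap.pi fun j => LinearMap.mulRight F (MvPolynomial.X i ^ (z j).2) ∘ₗ
    (Polynomial.aeval (-MvPolynomial.X i : MvPolynomial (Fin q) F)).toLinearMap ∘ₗ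
      genComp F (z j).1

theorem detRow_apply {q : ℕ} (z : Fin q → Bool × ℕ) (i j : Fin q) (x : WSpace F) :
    detRow z i x j = Polynomial.aeval (-MvPolynomial.X i : MvPolynomial (Fin q) F)
      (genComp F (z j).1 x) * MvPolynomial.X i ^ (z j).2 := rfl

/-- The cochain with values in multiples of `H` that antisymmetrizes a monomial in the dual basis
to the generators. -/
noncomputable def preDetCochain {q : ℕ} (z : Fin q → Bool × ℕ) :
    PreCochain F (WSpace F) (WSpace F) q :=
  ((TensorProduct.mk F (MvPolynomial (Fin q) F) (WSpace F)).flip (H F)).compMultilinearMap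
    (((Matrix.detRowAlternating (n := Fin q)
      (R := MvPolynomial (Fin q) F)).toMultilinearMap.restrictScalars F).compLinearMap (detRow z))

theorem preDetCochain_apply {q : ℕ} (z : Fin q → Bool × ℕ) (a : Fin q → WSpace F) :
    preDetCochain z a = (Matrix.of fun i j => detRow z i (a i) j).det ⊗ₜ H F := rfl

theorem detRow_D {q : ℕ} (z : Fin q → Bool × ℕ) (i : Fin q) (x : WSpace F) :
    detRow z i (D F x) = (-MvPolynomial.X i : MvPolynomial (Fin q) F) • detRow z i x := by
  funext j
  rw [Pi.smul_apply, detRow_apply, detRow_apply, D_apply]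
  have : genComp F (z j).1 ((Polynomial.X : F[X]) • x) =
      Polynomial.X * genComp F (z j).1 x := by
    cases (z j).1 <;> rfl
  rw [this, map_mul, Polynomial.aeval_X, smul_eq_mul, mul_assoc]

theorem rename_detRow {q : ℕ} (z : Fin q → Bool × ℕ) (σ : Fin q → Fin q) (i j : Fin q)
    (x : WSpace F) : MvPolynomial.rename σ (detRow z i x j) = detRow z (σ i) x j := by
  rw [detRow_apply, detRow_apply, map_mul, map_pow, MvPolynomial.rename_X]
  congr 1
  rw [← Polynomial.aeval_algHom_apply, map_neg, MvPolynomial.rename_X]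

theorem preDetCochain_mem {q : ℕ} (z : Fin q → Bool × ℕ) :
    preDetCochain z ∈ (adjW F 1).cochains q := by
  constructor
  · intro a i
    have h1 : (Matrix.of fun i' j => detRow z i' (Function.update a i (D F (a i)) i') j) =
        (Matrix.of fun i' j => detRow z i' (a i') j).updateRow i
          ((-MvPolynomial.X i : MvPolynomial (Fin q) F) • fun j => detRow z i (a i) j) := by
      ext1 i' j
      rcases eq_or_ne i' i with rfl | h
      · simp [detRow_D]
      · simp [h]
    have h2 : (Matrix.of fun i' j => detRow z i' (a i') j).updateRow i
        (fun j => detRow z i (a i) j) = Matrix.of fun i' j => detRow z i' (a i') j := by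
      ext1 i' j
      rcases eq_or_ne i' i with rfl | h
      · simp
      · simp [h]
    refine (preDetCochain_apply z _).trans ?_
    refine (congrArg (fun M => Matrix.det M ⊗ₜ[F] H F) h1).trans ?_
    rw [Matrix.det_updateRow_smul, h2, preDetCochain_apply, TensorProduct.smul_tmul', smul_eq_mul,
      neg_mul, TensorProduct.neg_tmul]
  · intro σ a
    rw [preDetCochain_apply, preDetCochain_apply, substVars_tmul, AlgHom.map_det]
    have : (MvPolynomial.rename σ).mapMatrix
        (Matrix.of fun i j => detRow z i ((a ∘ σ) i) j) =
        (Matrix.of fun i j => detRow z i (a i) j).submatrix σ id := by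
      ext1 i j
      simp [rename_detRow]
    rw [this, Matrix.det_permute, TensorProduct.smul_tmul']
    rw [MvPolynomial.smul_eq_C_mul]
    congr 2

/-- `preDetCochain` as a cochain. -/
noncomputable def detCochain (F : Type*) [Field F] {q : ℕ} (z : Fin q → Bool × ℕ) :
    (adjW F 1).cochains q :=
  ⟨preDetCochain z, preDetCochain_mem z⟩

theorem detCochain_apply {q : ℕ} (z : Fin q → Bool × ℕ) (a : Fin q → WSpace F) :
    (detCochain F z).1 a = (Matrix.of fun i j => detRow z i (a i) j).det ⊗ₜ H F := rfl

theorem detRow_gen {q : ℕ} (z : Fin q → Bool × ℕ) (i j : Fin q) (b : Bool) :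
    detRow z i (gen F b) j = if b = (z j).1 then MvPolynomial.X i ^ (z j).2 else 0 := by
  rw [detRow_apply]
  cases b <;> cases (z j).1 <;> simp [gen, genComp, L, H]

/-- Leibniz expansion: each σ contributes a single signed monomial, and only when the generators
match column by column. -/
theorem genCoeff_detCochain {q : ℕ} (z w : Fin q → Bool × ℕ) :
    genCoeff w (detCochain F z) = (∑ σ : Equiv.Perm (Fin q),
      if w ∘ σ = z then ((Equiv.Perm.sign σ : ℤ) : F) else 0) • H F := by
  rw [genCoeff_apply, detCochain_apply, varCoeff_tmul, Matrix.det_apply', MvPolynomial.coeff_sum]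
  congr 1
  refine Finset.sum_congr rfl fun σ _ => ?_
  have h1 : ((Equiv.Perm.sign σ : ℤ) : MvPolynomial (Fin q) F) =
      MvPolynomial.C ((Equiv.Perm.sign σ : ℤ) : F) := by simp
  rw [h1, MvPolynomial.coeff_C_mul]
  simp only [Matrix.of_apply, detRow_gen]
  by_cases hb : ∀ j, (w (σ j)).1 = (z j).1
  · have h2 : (∏ j, if (w (σ j)).1 = (z j).1 then
        (MvPolynomial.X (σ j) ^ (z j).2 : MvPolynomial (Fin q) F) else 0) =
        MvPolynomial.monomial (exponents (z ∘ σ.symm)) 1 := by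
      rw [MvPolynomial.monomial_eq, map_one, one_mul, Finsupp.prod_fintype _ _ (by simp),
        ← Equiv.prod_comp σ (fun i => _ ^ _)]
      refine Finset.prod_congr rfl fun j _ => ?_
      rw [if_pos (hb j)]
      simp [exponents]
    rw [h2, MvPolynomial.coeff_monomial]
    have h3 : exponents (z ∘ σ.symm) = exponents w ↔ w ∘ σ = z := by
      constructor
      · intro h
        funext j
        refine Prod.ext (hb j) ?_
        have := DFunLike.congr_fun h (σ j)
        simpa [exponents] using this.symm
      · rintro rfl
        congr 1
        funext j
        simp
    simp [h3]
  · have h2 : w ∘ σ ≠ z := by rintro rfl; exact hb fun j => rfl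
    obtain ⟨j, hj⟩ := not_forall.mp hb
    rw [if_neg h2, Finset.prod_eq_zero (Finset.mem_univ j) (if_neg hj), MvPolynomial.coeff_zero,
      mul_zero]

theorem genCoeff_detCochain_self {q : ℕ} {z : Fin q → Bool × ℕ} (hz : Function.Injective z) :
    genCoeff z (detCochain F z) = H F := by
  rw [genCoeff_detCochain, Finset.sum_eq_single 1]
  · simp
  · intro σ _ hσ
    rw [if_neg]
    intro h
    refine hσ (Equiv.ext fun i => hz (congrFun h i))
  · simp

theorem genCoeff_detCochain_of_ne {q : ℕ} {z w : Fin q → Bool × ℕ}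
    (hz : ∀ σ : Equiv.Perm (Fin q), w ∘ σ ≠ z) : genCoeff w (detCochain F z) = 0 := by
  rw [genCoeff_detCochain, Finset.sum_eq_zero (fun σ _ => if_neg (hz σ)), zero_smul]

theorem coord_H (j : Bool) (k : ℕ) :
    coord F j k (H F) = if j = true ∧ k = 0 then 1 else 0 := by
  cases j <;> simp [coord, H, Polynomial.coeff_one]

variable [CharZero F]

/-- Only rearrangements of `z` have nonzero coefficients, and the weight is symmetric in its pairs.
-/
theorem weightOp_detCochain {q : ℕ} {z : Fin q → Bool × ℕ} (hz : totalWeight true 0 z = 0) :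
    weightOp F q (detCochain F z) = 0 := by
  refine genCoeff_injective fun w j k => ?_
  rw [coord_genCoeff_weightOp, map_zero, map_zero]
  by_cases h : ∃ σ : Equiv.Perm (Fin q), w ∘ σ = z
  · obtain ⟨σ, hσ⟩ := h
    rw [genCoeff_detCochain, map_smul, coord_H]
    split_ifs with hjk
    · obtain ⟨rfl, rfl⟩ := hjk
      have : totalWeight true 0 w = totalWeight true 0 z := by
        rw [totalWeight, totalWeight, ← hσ, ← Equiv.sum_comp σ]
        rfl
      simp [this, hz]
    · simp
  · rw [genCoeff_detCochain_of_ne (fun σ hσ => h ⟨σ, hσ⟩)]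
    simp

end DetCochain

/-! ## Cochains of weight zero -/

section WeightZero

variable {F : Type*} [Field F]

/-- Coefficients of a contracted cochain are thus coefficients of the original, so vanishing and
weights transfer without computing values. -/
theorem genCoeff_contract {q : ℕ} (z : Fin q → Bool × ℕ) (n : ℕ)
    (f : (adjW F 1).cochains (q + 1)) :
    genCoeff z ((adjW F 1).contract (L F) n q f) = genCoeff (Fin.cons (false, n) z) f := by
  have h1 : (fun i => gen F ((Fin.cons (false, n) z : Fin (q + 1) → Bool × ℕ) i).1) =
      Fin.cons (L F) fun i => gen F (z i).1 := by
    funext i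
    refine Fin.cases ?_ (fun i => ?_) i <;> simp [gen]
  have h2 : exponents (Fin.cons (false, n) z : Fin (q + 1) → Bool × ℕ) =
      (exponents z).cons n := by
    ext i
    refine Fin.cases ?_ (fun i => ?_) i <;> simp [exponents]
  rw [genCoeff_apply, genCoeff_apply, LCModule.contract_apply, h1, h2]
  generalize f.1 _ = y
  induction y with
  | zero => simp
  | add x y hx hy => simp only [map_add, hx, hy]
  | tmul p x => rw [firstCoeff_tmul, varCoeff_tmul, varCoeff_tmul,
      MvPolynomial.finSuccEquiv_coeff_coeff]

/-- Every pair has weight at least 1, except (L, 0) of weight -1 and (L, 1) of weight 0. Each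
exception occurs at most once, so the sum over the arguments is at least `q - 3`. -/
theorem card_add_le_of_totalWeight {q : ℕ} {j : Bool} {k : ℕ} {z : Fin q → Bool × ℕ}
    (hz : Function.Injective z) (h : totalWeight j k z = 0) :
    (q : ℤ) + k + confWeight j ≤ 3 := by
  have h1 : ∀ c : Bool × ℕ, ∑ i, (if z i = c then (1 : ℤ) else 0) ≤ 1 := by
    intro c
    rw [Finset.sum_boole]
    have : (Finset.univ.filter fun i => z i = c).card ≤ 1 := by
      rw [Finset.card_le_one]
      intro a ha b hb
      exact hz ((Finset.mem_filter.mp ha).2.trans (Finset.mem_filter.mp hb).2.symm)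
    exact_mod_cast this
  -- The defect `1 - modeWeight` is `2 - m` for `L` and `-m` for `H`, hence 2 at (L, 0), 1 at (L, 1)
  -- and at most 0 elsewhere.
  have h2 : ∀ c : Bool × ℕ, 1 - modeWeight c ≤ 2 * (if c = (false, 0) then (1 : ℤ) else 0) +
      (if c = (false, 1) then (1 : ℤ) else 0) := by
    rintro ⟨b, m⟩
    rcases b with _ | _
    · rcases m with _ | _ | m <;> simp [modeWeight, confWeight]
      omega
    · simp [modeWeight, confWeight]
  have h3 := Finset.sum_le_sum fun i (_ : i ∈ Finset.univ) => h2 (z i)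
  rw [Finset.sum_add_distrib, ← Finset.mul_sum, Finset.sum_sub_distrib] at h3
  simp only [Finset.sum_const, Finset.card_univ, Fintype.card_fin, nsmul_eq_mul, mul_one] at h3
  have h4 := h1 (false, 0)
  have h5 := h1 (false, 1)
  rw [totalWeight] at h
  linarith

theorem exists_perm_of_mem_range {ι T : Type*} [Finite ι] {z c : ι → T}
    (hz : Function.Injective z) (h : ∀ i, ∃ j, c j = z i) :
    ∃ σ : Equiv.Perm ι, z = c ∘ σ := by
  choose σ hσ using h
  have : Function.Injective σ := fun i j hij => hz (by rw [← hσ, ← hσ, hij])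
  exact ⟨Equiv.ofBijective σ (Finite.injective_iff_bijective.mp this), funext fun i => (hσ i).symm⟩

variable [CharZero F]

/-- Only coefficients at distinct pairs of total weight zero can survive, and reordering the pairs
costs a sign. So one ordering `c` of each possible set of pairs suffices. -/
theorem weight_zero_ext {q : ℕ} {f : (adjW F 1).cochains q} (hf : weightOp F q f = 0)
    (h : ∀ j k (z : Fin q → Bool × ℕ), Function.Injective z → totalWeight j k z = 0 → (q : ℤ) + k + confWeight j ≤ 3 →
      ∃ c : Fin q → Bool × ℕ, (∀ i, ∃ i', c i' = z i) ∧ coord F j k (genCoeff c f) = 0) : f = 0 := by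
  refine genCoeff_injective fun z j k => ?_
  rw [map_zero, map_zero]
  by_contra hne
  have hz : Function.Injective z := by
    by_contra hz
    exact hne (by rw [genCoeff_eq_zero_of_eq hz, map_zero])
  have hw : totalWeight j k z = 0 := by
    have := coord_genCoeff_weightOp j k z f
    rw [hf, map_zero, map_zero, eq_comm, mul_eq_zero] at this
    exact_mod_cast this.resolve_right hne
  obtain ⟨c, hc, hc0⟩ := h j k z hz hw (card_add_le_of_totalWeight hz hw)
  obtain ⟨σ, rfl⟩ := exists_perm_of_mem_range hz hc
  rw [genCoeff_comp_perm, map_smul, hc0, smul_zero] at hne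
  exact hne rfl

theorem weight_zero_eq_zero {q : ℕ} (hq : 4 ≤ q) {f : (adjW F 1).cochains q}
    (hf : weightOp F q f = 0) : f = 0 := by
  refine weight_zero_ext hf fun j k z _ _ h => ?_
  have : 0 ≤ confWeight j := by cases j <;> simp [confWeight]
  omega

/-- The bound forces the value to be a multiple of `H` without ∂. Three distinct pairs of total
weight zero are then {L0, L1, H0} or {L0, L1, L2}, with the exponent written after the generator. -/
theorem weight_zero_three_ext {f : (adjW F 1).cochains 3} (hf : weightOp F 3 f = 0)
    (h1 : coord F true 0 (genCoeff ![(false, 1), (false, 0), (true, 0)] f) = 0)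
    (h2 : coord F true 0 (genCoeff ![(false, 2), (false, 1), (false, 0)] f) = 0) : f = 0 := by
  refine weight_zero_ext hf fun j k z hz hw h => ?_
  cases j
  · simp [confWeight] at h; omega
  obtain rfl : k = 0 := by simp [confWeight] at h; omega
  have h01 := hz.ne (show (0 : Fin 3) ≠ 1 by decide)
  have h02 := hz.ne (show (0 : Fin 3) ≠ 2 by decide)
  have h12 := hz.ne (show (1 : Fin 3) ≠ 2 by decide)
  rw [totalWeight, Fin.sum_univ_three] at hw
  simp only [Fin.forall_fin_succ (n := 2), Fin.forall_fin_two, Fin.succ_zero_eq_one,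
    Fin.succ_one_eq_two]
  generalize z 0 = z₀ at hw h01 h02 ⊢
  generalize z 1 = z₁ at hw h01 h12 ⊢
  generalize z 2 = z₂ at hw h02 h12 ⊢
  obtain ⟨b₀, m₀⟩ := z₀
  obtain ⟨b₁, m₁⟩ := z₁
  obtain ⟨b₂, m₂⟩ := z₂
  have hc1 : ∀ b m, (b = false ∧ m ≤ 1 ∨ b = true ∧ m = 0) →
      ∃ i, (![(false, 1), (false, 0), (true, 0)] : Fin 3 → Bool × ℕ) i = (b, m) := by
    rintro b m (⟨rfl, hm⟩ | ⟨rfl, rfl⟩)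
    · interval_cases m
      exacts [⟨1, rfl⟩, ⟨0, rfl⟩]
    · exact ⟨2, rfl⟩
  have hc2 : ∀ m ≤ 2,
      ∃ i, (![(false, 2), (false, 1), (false, 0)] : Fin 3 → Bool × ℕ) i = (false, m) := by
    intro m hm
    interval_cases m
    exacts [⟨2, rfl⟩, ⟨1, rfl⟩, ⟨0, rfl⟩]
  cases b₀ <;> cases b₁ <;> cases b₂ <;>
    simp [modeWeight, confWeight] at hw h01 h02 h12
  · exact ⟨_, ⟨hc2 _ (by omega), hc2 _ (by omega), hc2 _ (by omega)⟩, h2⟩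
  all_goals
    exact ⟨_, ⟨hc1 _ _ (by simp; omega), hc1 _ _ (by simp; omega), hc1 _ _ (by simp; omega)⟩, h1⟩

/-- A value `∂H` needs pairs of total weight -1, so {L0, L1}. A value `H` needs total weight 0, so
{L0, L2} or {L0, H0}. The bound excludes the rest. -/
theorem weight_zero_two_ext {f : (adjW F 1).cochains 2} (hf : weightOp F 2 f = 0)
    (h1 : coord F true 1 (genCoeff ![(false, 1), (false, 0)] f) = 0)
    (h2 : coord F true 0 (genCoeff ![(false, 2), (false, 0)] f) = 0)
    (h3 : coord F true 0 (genCoeff ![(false, 0), (true, 0)] f) = 0) : f = 0 := by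
  refine weight_zero_ext hf fun j k z hz hw h => ?_
  cases j
  · simp [confWeight] at h; omega
  have hk : k ≤ 1 := by simp [confWeight] at h; omega
  have h01 := hz.ne (show (0 : Fin 2) ≠ 1 by decide)
  rw [totalWeight, Fin.sum_univ_two] at hw
  simp only [Fin.forall_fin_two]
  generalize z 0 = z₀ at hw h01 ⊢
  generalize z 1 = z₁ at hw h01 ⊢
  obtain ⟨b₀, m₀⟩ := z₀
  obtain ⟨b₁, m₁⟩ := z₁
  have hc1 : ∀ m ≤ 1, ∃ i, (![(false, 1), (false, 0)] : Fin 2 → Bool × ℕ) i = (false, m) := by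
    intro m hm
    interval_cases m
    exacts [⟨1, rfl⟩, ⟨0, rfl⟩]
  have hc2 : ∀ m, m = 0 ∨ m = 2 →
      ∃ i, (![(false, 2), (false, 0)] : Fin 2 → Bool × ℕ) i = (false, m) := by
    rintro m (rfl | rfl)
    exacts [⟨1, rfl⟩, ⟨0, rfl⟩]
  have hc3 : ∀ b m, m = 0 → ∃ i, (![(false, 0), (true, 0)] : Fin 2 → Bool × ℕ) i = (b, m) := by
    rintro b m rfl
    cases b
    exacts [⟨0, rfl⟩, ⟨1, rfl⟩]
  interval_cases k <;> cases b₀ <;> cases b₁ <;> simp [modeWeight, confWeight] at hw h01 <;> first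
    | exact ⟨_, ⟨hc1 _ (by omega), hc1 _ (by omega)⟩, h1⟩
    | exact ⟨_, ⟨hc2 _ (by omega), hc2 _ (by omega)⟩, h2⟩
    | exact ⟨_, ⟨hc3 _ _ (by omega), hc3 _ _ (by omega)⟩, h3⟩
    | omega

/-- The possibilities are `∂H` at (L, 0) and `H` at (L, 1). -/
theorem weight_zero_one_ext {f : (adjW F 1).cochains 1} (hf : weightOp F 1 f = 0)
    (h1 : coord F true 1 (genCoeff ![(false, 0)] f) = 0)
    (h2 : coord F true 0 (genCoeff ![(false, 1)] f) = 0) : f = 0 := by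
  refine weight_zero_ext hf fun j k z hz hw h => ?_
  rw [totalWeight, Fin.sum_univ_one] at hw
  simp only [Fin.forall_fin_one]
  generalize z 0 = z₀ at hw ⊢
  obtain ⟨b, m⟩ := z₀
  cases j <;> cases b <;> simp [modeWeight, confWeight] at hw
  · omega
  · omega
  · obtain ⟨rfl, rfl⟩ | ⟨rfl, rfl⟩ : (k = 1 ∧ m = 0) ∨ (k = 0 ∧ m = 1) := by omega
    exacts [⟨_, ⟨0, rfl⟩, h1⟩, ⟨_, ⟨0, rfl⟩, h2⟩]
  · omega

theorem weight_zero_zero_ext {f : (adjW F 1).cochains 0} (hf : weightOp F 0 f = 0)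
    (h : coord F true 0 (genCoeff ![] f) = 0) : f = 0 := by
  refine weight_zero_ext hf fun j k z hz hw _ => ?_
  rw [totalWeight, Fin.sum_univ_zero] at hw
  cases j <;> simp [confWeight] at hw
  · omega
  · subst hw
    exact ⟨_, fun i => i.elim0, h⟩

end WeightZero

end LieConformal

namespace LieConformal

open WSpace

/-! ## Bases of cohomology -/

/-- Spanning and independence are stated in `V` modulo `T`, which spares the later arguments any
work inside the quotient. -/
theorem exists_basis_quotient_submoduleOf {K V ι : Type*} [Field K] [AddCommGroup V] [Module K V]
    [Fintype ι] (S T : Submodule K V) (v : ι → V) (hv : ∀ i, v i ∈ S)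
    (hspan : ∀ x ∈ S, ∃ c : ι → K, x - ∑ i, c i • v i ∈ T)
    (hindep : ∀ c : ι → K, ∑ i, c i • v i ∈ T → c = 0) :
    ∃ b : Module.Basis ι K (S ⧸ T.submoduleOf S),
      ∀ i, b i = Submodule.Quotient.mk ⟨v i, hv i⟩ := by
  set w : ι → S ⧸ T.submoduleOf S := fun i => Submodule.Quotient.mk ⟨v i, hv i⟩ with hw
  have hsum : ∀ c : ι → K, ∑ i, c i • w i =
      (T.submoduleOf S).mkQ (∑ i, c i • ⟨v i, hv i⟩) := by
    intro c
    rw [map_sum]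
    rfl
  have hli : LinearIndependent K w := by
    rw [Fintype.linearIndependent_iff]
    intro c hc
    rw [hsum, Submodule.mkQ_apply, Submodule.Quotient.mk_eq_zero, Submodule.submoduleOf, Submodule.mem_comap] at hc
    refine congrFun (hindep c ?_)
    simpa using hc
  have hsp : ⊤ ≤ Submodule.span K (Set.range w) := by
    rintro x -
    obtain ⟨x, rfl⟩ := Submodule.Quotient.mk_surjective _ x
    obtain ⟨c, hc⟩ := hspan x.1 x.2
    have h1 : (Submodule.Quotient.mk x : S ⧸ T.submoduleOf S) = ∑ i, c i • w i := by
      rw [hsum, Submodule.mkQ_apply, Submodule.Quotient.eq, Submodule.submoduleOf, Submodule.mem_comap]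
      simpa using hc
    rw [h1]
    exact Submodule.sum_mem _ fun i _ =>
      Submodule.smul_mem _ _ (Submodule.subset_span ⟨i, rfl⟩)
  exact ⟨Module.Basis.mk hli hsp, fun i => Module.Basis.mk_apply hli hsp i⟩

/-! ### From basic to reduced cohomology -/

namespace LCModule

variable {F : Type*} [Field F] [CharZero F] {A : Type*} [AddCommGroup A] [Module F A]
  {𝒜 : LieConformalAlgebra F A} {M : Type*} [AddCommGroup M] [Module F M]

/-- The `B i` are cocycles whose classes form a basis of the basic cohomology. -/
structure IsCohomologyBasis (ℳ : LCModule 𝒜 M) {q : ℕ} {ι : Type*} [Fintype ι]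
    (B : ι → ℳ.cochains q) : Prop where
  d_eq_zero : ∀ i, ℳ.d q (B i) = 0
  span : ∀ f, ℳ.d q f = 0 → ∃ c : ι → F, f - ∑ i, c i • B i ∈ ℳ.coboundaries q
  indep : ∀ c : ι → F, ∑ i, c i • B i ∈ ℳ.coboundaries q → c = 0

theorem IsCohomologyBasis.exists_basis {ℳ : LCModule 𝒜 M} {q : ℕ} {ι : Type*} [Fintype ι]
    {B : ι → ℳ.cochains q} (h : ℳ.IsCohomologyBasis B) :
    ∃ b : Module.Basis ι F (ℳ.BasicCohomology q), ∀ i, ℳ.HasBasicClass (B i) (b i) := by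
  obtain ⟨b, hb⟩ := exists_basis_quotient_submoduleOf (LinearMap.ker (ℳ.d q)) (ℳ.coboundaries q) B
    h.d_eq_zero h.span h.indep
  exact ⟨b, fun i => ⟨h.d_eq_zero i, (hb i).symm⟩⟩

theorem d_of_mem_coboundaries {ℳ : LCModule 𝒜 M} {q : ℕ} {f : ℳ.cochains q}
    (hf : f ∈ ℳ.coboundaries q) : ℳ.d q f = 0 := by
  cases q with
  | zero => rw [(Submodule.mem_bot F).mp hf, map_zero]
  | succ q =>
    obtain ⟨u, rfl⟩ := hf
    exact ℳ.d_d q u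

theorem mk_mem_coboundariesRed {ℳ : LCModule 𝒜 M} {q : ℕ} {f : ℳ.cochains q} :
    (Submodule.Quotient.mk f : ℳ.ReducedCochains q) ∈ ℳ.coboundariesRed q ↔
      ∃ g ∈ ℳ.coboundaries q, ∃ u, f - g = ℳ.del q u := by
  cases q with
  | zero =>
    simp only [coboundariesRed, coboundaries, Submodule.mem_bot, exists_eq_left, sub_zero,
      Submodule.Quotient.mk_eq_zero, LinearMap.mem_range]
    exact exists_congr fun u => eq_comm
  | succ q =>
    constructor
    · rintro ⟨x, hx⟩
      obtain ⟨x, rfl⟩ := Submodule.Quotient.mk_surjective _ x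
      rw [dRed, Submodule.mapQ_apply, eq_comm, Submodule.Quotient.eq] at hx
      obtain ⟨u, hu⟩ := hx
      exact ⟨_, ⟨x, rfl⟩, u, hu.symm⟩
    · rintro ⟨_, ⟨x, rfl⟩, u, hu⟩
      refine ⟨Submodule.Quotient.mk x, ?_⟩
      rw [dRed, Submodule.mapQ_apply, eq_comm, Submodule.Quotient.eq]
      exact ⟨u, hu.symm⟩

/-- ∂ = d ι_0 + ι_0 d, and the second term vanishes on a cocycle. Hence ι_0 sends basic cocycles to
reduced cocycles one degree lower. -/
theorem d_contract_zero {ℳ : LCModule 𝒜 M} {a : A} (ha : ∀ q, ℳ.cartan a 0 q = ℳ.del q) {q : ℕ}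
    {f : ℳ.cochains (q + 1)} (hf : ℳ.d (q + 1) f = 0) :
    ℳ.d q (ℳ.contract a 0 q f) = ℳ.del (q + 1) f := by
  rw [← ha, cartan, LinearMap.add_apply, LinearMap.comp_apply, LinearMap.comp_apply, hf, map_zero,
    add_zero]

theorem del_mem_coboundaries {ℳ : LCModule 𝒜 M} {a : A} (ha : ∀ q, ℳ.cartan a 0 q = ℳ.del q)
    {q : ℕ} {f : ℳ.cochains q} (hf : ℳ.d q f = 0) : ℳ.del q f ∈ ℳ.coboundaries q := by
  cases q with
  | zero =>
    rw [← ha, cartan, LinearMap.comp_apply, hf, map_zero]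
    exact Submodule.zero_mem _
  | succ q =>
    rw [← d_contract_zero ha hf]
    exact LinearMap.mem_range_self _ _

/-- If a mode of `a` acts as `∂` and `∂` is injective on cochains, then the reduced cohomology
of degree `q` is built from the basic cohomology of degrees `q` and `q + 1`. -/
theorem IsCohomologyBasis.exists_basis_reduced {ℳ : LCModule 𝒜 M} {a : A}
    (ha : ∀ q, ℳ.cartan a 0 q = ℳ.del q) (hinj : ∀ q (f : ℳ.cochains q), ℳ.del q f = 0 → f = 0)
    {q : ℕ} {ι ι' : Type*} [Fintype ι] [Fintype ι'] {B : ι → ℳ.cochains q}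
    {B' : ι' → ℳ.cochains (q + 1)} (h : ℳ.IsCohomologyBasis B) (h' : ℳ.IsCohomologyBasis B') :
    ∃ b : Module.Basis (ι ⊕ ι') F (ℳ.ReducedCohomology q),
      (∀ i, ℳ.HasReducedClass (B i) (b (Sum.inl i))) ∧
      ∀ i, ℳ.HasReducedClass (ℳ.contract a 0 q (B' i)) (b (Sum.inr i)) := by
  set C : ι ⊕ ι' → ℳ.cochains q := Sum.elim B fun i => ℳ.contract a 0 q (B' i) with hC
  have hdC : ∀ i, ℳ.d q (ℳ.contract a 0 q (B' i)) = ℳ.del (q + 1) (B' i) :=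
    fun i => d_contract_zero ha (h'.d_eq_zero i)
  have hv : ∀ i, (Submodule.Quotient.mk (C i) : ℳ.ReducedCochains q) ∈
      LinearMap.ker (ℳ.dRed q) := by
    rintro (i | i)
    · rw [LinearMap.mem_ker, dRed, Submodule.mapQ_apply, hC, Sum.elim_inl, h.d_eq_zero,
        Submodule.Quotient.mk_zero]
    · rw [LinearMap.mem_ker, dRed, Submodule.mapQ_apply, hC, Sum.elim_inr, hdC,
        Submodule.Quotient.mk_eq_zero]
      exact LinearMap.mem_range_self _ _
  have hmk : ∀ c : ι ⊕ ι' → F, ∑ i, c i • (Submodule.Quotient.mk (C i) : ℳ.ReducedCochains q) =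
      Submodule.Quotient.mk (∑ i, c i • C i) := by
    intro c
    exact (map_sum (LinearMap.range (ℳ.del q)).mkQ (fun i => c i • C i) _).symm
  have hsplit : ∀ c : ι ⊕ ι' → F, ∑ i, c i • C i = ∑ i, c (Sum.inl i) • B i +
      ∑ i, c (Sum.inr i) • ℳ.contract a 0 q (B' i) := by
    intro c
    rw [Fintype.sum_sum_type]
    rfl
  have hdsum : ∀ c : ι' → F, ℳ.d q (∑ i, c i • ℳ.contract a 0 q (B' i)) =
      ℳ.del (q + 1) (∑ i, c i • B' i) := by
    intro c
    simp only [map_sum, map_smul, hdC]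
  have hspan : ∀ x ∈ LinearMap.ker (ℳ.dRed q), ∃ c : ι ⊕ ι' → F,
      x - ∑ i, c i • (Submodule.Quotient.mk (C i) : ℳ.ReducedCochains q) ∈
        ℳ.coboundariesRed q := by
    intro x hx
    obtain ⟨f, rfl⟩ := Submodule.Quotient.mk_surjective _ x
    rw [LinearMap.mem_ker, dRed, Submodule.mapQ_apply, Submodule.Quotient.mk_eq_zero] at hx
    obtain ⟨g, hg⟩ := hx
    -- A lift `f` of a reduced cocycle has df = ∂g, and ∂dg = ddf = 0 with ∂ injective. The class of
    -- `g` is the image under the connecting map.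
    have hdg : ℳ.d (q + 1) g = 0 := hinj _ _ (by rw [← d_del, hg, d_d])
    -- If g = Σ c' B' + du, then subtracting ∂u and Σ c' ι_0 B' from `f` leaves a basic cocycle.
    obtain ⟨c', u, hu⟩ := h'.span g hdg
    obtain ⟨c, hc⟩ := h.span (f - ℳ.del q u - ∑ i, c' i • ℳ.contract a 0 q (B' i)) (by
      rw [map_sub, map_sub, hdsum, d_del, hu, ← hg, map_sub]
      abel)
    refine ⟨Sum.elim c c', ?_⟩
    rw [hmk, ← Submodule.Quotient.mk_sub, mk_mem_coboundariesRed]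
    refine ⟨_, hc, u, ?_⟩
    rw [hsplit]
    simp only [Sum.elim_inl, Sum.elim_inr]
    abel
  have hindep : ∀ c : ι ⊕ ι' → F,
      ∑ i, c i • (Submodule.Quotient.mk (C i) : ℳ.ReducedCochains q) ∈ ℳ.coboundariesRed q →
        c = 0 := by
    intro c hc
    rw [hmk, mk_mem_coboundariesRed, hsplit] at hc
    obtain ⟨g, hg, u, hu⟩ := hc
    -- Applying d kills the `B` part and the coboundary, leaving ∂(Σ c B') = ∂du. Cancelling ∂ makes
    -- Σ c B' a coboundary, so these coefficients vanish.
    have h1 := congrArg (ℳ.d q) hu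
    rw [map_sub, map_add, hdsum, d_of_mem_coboundaries hg, sub_zero, map_sum] at h1
    simp only [map_smul, h.d_eq_zero, smul_zero, Finset.sum_const_zero, zero_add, d_del] at h1
    have h2 : ∑ i, c (Sum.inr i) • B' i = ℳ.d q u := by
      rw [← sub_eq_zero]
      exact hinj _ _ (by rw [map_sub, h1, sub_self])
    have h3 := h'.indep _ (by rw [h2]; exact LinearMap.mem_range_self _ _)
    have h4 : ∀ i, c (Sum.inr i) = 0 := congrFun h3
    simp only [h4, zero_smul, Finset.sum_const_zero, add_zero] at hu h2
    -- Now du = 0, so ∂u is a coboundary by `del_mem_coboundaries`, and the remaining combination of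
    -- the `B i` is one too.
    have h5 := h.indep (fun i => c (Sum.inl i)) (by
      rw [eq_add_of_sub_eq hu]
      exact Submodule.add_mem _ (del_mem_coboundaries ha h2.symm) hg)
    funext i
    rcases i with i | i
    exacts [congrFun h5 i, h4 i]
  obtain ⟨b, hb⟩ := exists_basis_quotient_submoduleOf _ _ _ hv hspan hindep
  exact ⟨b, fun i => ⟨hv (Sum.inl i), (hb (Sum.inl i)).symm⟩,
    fun i => ⟨hv (Sum.inr i), (hb (Sum.inr i)).symm⟩⟩

end LCModule

end LieConformal

namespace LieConformal

open WSpace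

/-! ## Cohomology of `W(1)` with coefficients in the adjoint module -/

section Bases

variable {F : Type*} [Field F]

variable (F)

/-- The cochain `L ↦ λ_1 H`. -/
noncomputable def cochainU : (adjW F 1).cochains 1 := detCochain F ![(false, 1)]

/-- The cochain `L ⊗ L ⊗ H ↦ (λ_1 - λ_2) H`. -/
noncomputable def cochain31 : (adjW F 1).cochains 3 :=
  detCochain F ![(false, 1), (false, 0), (true, 0)]

/-- The cochain `L ⊗ L ⊗ L ↦ (λ_1 - λ_2) (λ_1 - λ_3) (λ_2 - λ_3) H`. -/
noncomputable def cochain32 : (adjW F 1).cochains 3 :=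
  detCochain F ![(false, 2), (false, 1), (false, 0)]

/-- The cochain `L ⊗ H ↦ H`. -/
noncomputable def cochain21 : (adjW F 1).cochains 2 :=
  (adjW F 1).contract (L F) 1 2 (cochain31 F)

/-- The cochain `L ⊗ L ↦ (λ_1 ^ 2 - λ_2 ^ 2) H`. -/
noncomputable def cochain22 : (adjW F 1).cochains 2 :=
  -(adjW F 1).contract (L F) 1 2 (cochain32 F)

variable {F}

theorem coord_D_H : coord F true 1 (D F (H F)) = 1 := by
  simp [coord, D_apply, H]

theorem cochainU_apply (a : Fin 1 → WSpace F) :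
    (cochainU F).1 a = detRow ![(false, 1)] 0 (a 0) 0 ⊗ₜ H F := by
  rw [cochainU, detCochain_apply, Matrix.det_fin_one]
  rfl

theorem genCoeff_cochain31 :
    genCoeff ![(false, 1), (false, 0), (true, 0)] (cochain31 F) = H F :=
  genCoeff_detCochain_self (by decide)

theorem genCoeff_cochain32 :
    genCoeff ![(false, 2), (false, 1), (false, 0)] (cochain32 F) = H F :=
  genCoeff_detCochain_self (by decide)

theorem genCoeff_cochain31' :
    genCoeff ![(false, 2), (false, 1), (false, 0)] (cochain31 F) = 0 :=
  genCoeff_detCochain_of_ne (by decide)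

theorem genCoeff_cochain32' :
    genCoeff ![(false, 1), (false, 0), (true, 0)] (cochain32 F) = 0 :=
  genCoeff_detCochain_of_ne (by decide)

theorem genCoeff_cochain22_two : genCoeff ![(false, 2), (false, 0)] (cochain22 F) = H F := by
  have h : (Fin.cons (false, 1) ![(false, 2), (false, 0)] : Fin 3 → Bool × ℕ) =
      ![(false, 2), (false, 1), (false, 0)] ∘ Equiv.swap 0 1 := by decide
  rw [cochain22, map_neg, genCoeff_contract, h, genCoeff_comp_perm, genCoeff_cochain32,
    Equiv.Perm.sign_swap (by decide)]
  simp

theorem genCoeff_cochain21_two : genCoeff ![(false, 2), (false, 0)] (cochain21 F) = 0 :=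
  (genCoeff_contract _ _ _).trans (genCoeff_detCochain_of_ne (by decide))

theorem genCoeff_cochain21_three : genCoeff ![(false, 0), (true, 0)] (cochain21 F) = H F :=
  (genCoeff_contract _ _ _).trans genCoeff_cochain31

theorem genCoeff_cochain22_three : genCoeff ![(false, 0), (true, 0)] (cochain22 F) = 0 := by
  rw [cochain22, map_neg, neg_eq_zero]
  exact (genCoeff_contract _ _ _).trans genCoeff_cochain32'

variable [CharZero F]

theorem cartan_zero_adjW (q : ℕ) : (adjW F 1).cartan (L F) 0 q = (adjW F 1).del q :=
  (adjW F 1).cartan_zero_eq_del (prodAt_zero_L 1) (prodAt_zero_L 1) q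

/-- At scalar values of the variables ∂ becomes multiplication by `X + s`, with `s` the sum of the
scalars, on the torsion-free `F[X]`-module `W(1)`. -/
theorem del_eq_zero (q : ℕ) (f : (adjW F 1).cochains q) (hf : (adjW F 1).del q f = 0) :
    f = 0 := by
  refine Subtype.ext (MultilinearMap.ext fun a => evalVars_injective fun v => ?_)
  have h1 : (adjW F 1).preDel q f.1 a = 0 := congrArg (fun g => g.1 a) hf
  have h2 := congrArg (evalVars _ v) h1
  rw [LCModule.preDel_apply, map_add, evalVars_baseChange, evalVars_smul, map_zero] at h2
  generalize evalVars _ v (f.1 a) = x at h2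
  generalize MvPolynomial.eval v _ = s at h2
  have h3 : (Polynomial.X + Polynomial.C s) • x = 0 := by
    rw [add_smul, ← h2]
    congr 1
    ext1 <;> simp [Polynomial.smul_eq_C_mul]
  exact (smul_eq_zero.mp h3).resolve_left (Polynomial.X_add_C_ne_zero s)

theorem isCohomologyBasis_of_weight_zero {q : ℕ} {ι : Type*} [Fintype ι]
    {B : ι → (adjW F 1).cochains q} (hB : ∀ i, (adjW F 1).d q (B i) = 0)
    (hspan : ∀ f, weightOp F q f = 0 → (adjW F 1).d q f = 0 →
      ∃ c : ι → F, f - ∑ i, c i • B i ∈ (adjW F 1).coboundaries q)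
    (hindep : ∀ c : ι → F, ∑ i, c i • B i ∈ (adjW F 1).coboundaries q → c = 0) :
    (adjW F 1).IsCohomologyBasis B := by
  refine ⟨hB, fun f hf => ?_, hindep⟩
  obtain ⟨g, hg, hdg, hfg⟩ := exists_weight_zero_cocycle hf
  obtain ⟨c, hc⟩ := hspan g hg hdg
  exact ⟨c, by simpa using Submodule.add_mem _ hfg hc⟩

theorem weightOp_cochainU : weightOp F 1 (cochainU F) = 0 :=
  weightOp_detCochain (by simp [totalWeight, modeWeight, confWeight])

theorem weightOp_cochain31 : weightOp F 3 (cochain31 F) = 0 :=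
  weightOp_detCochain (by simp [totalWeight, modeWeight, confWeight, Fin.sum_univ_three])

theorem weightOp_cochain32 : weightOp F 3 (cochain32 F) = 0 :=
  weightOp_detCochain (by simp [totalWeight, modeWeight, confWeight, Fin.sum_univ_three])

theorem d_three_of_weight_zero {f : (adjW F 1).cochains 3} (hf : weightOp F 3 f = 0) :
    (adjW F 1).d 3 f = 0 :=
  weight_zero_eq_zero le_rfl (by rw [weightOp_d, hf, map_zero])

/-- In degree 3 and weight zero df = 0, so 0 = W f = d ι_1 f. The pair (L, 1) has weight zero, so
ι_1 preserves the weight. Cocycles of degree 2 thus come without computing a differential. -/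
theorem weightOp_contract {f : (adjW F 1).cochains 3} (hf : weightOp F 3 f = 0) :
    (adjW F 1).d 2 ((adjW F 1).contract (L F) 1 2 f) = 0 ∧
      weightOp F 2 ((adjW F 1).contract (L F) 1 2 f) = 0 := by
  have h1 : (adjW F 1).d 2 ((adjW F 1).contract (L F) 1 2 f) = 0 := by
    have := hf
    rwa [weightOp, LCModule.cartan, LinearMap.add_apply, LinearMap.comp_apply,
      LinearMap.comp_apply, d_three_of_weight_zero hf, map_zero, add_zero] at this
  refine ⟨h1, ?_⟩
  refine genCoeff_injective fun z j k => ?_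
  have h2 := coord_genCoeff_weightOp j k (Fin.cons (false, 1) z) f
  have h3 : totalWeight j k (Fin.cons (false, 1) z : Fin 3 → Bool × ℕ) = totalWeight j k z := by
    simp [totalWeight, Fin.sum_univ_succ, modeWeight, confWeight]
  rw [hf, map_zero, map_zero, ← genCoeff_contract, h3] at h2
  rw [coord_genCoeff_weightOp, ← h2, map_zero, map_zero]

theorem d_cochain21 : (adjW F 1).d 2 (cochain21 F) = 0 := (weightOp_contract weightOp_cochain31).1

theorem d_cochain22 : (adjW F 1).d 2 (cochain22 F) = 0 := by
  rw [cochain22, map_neg, (weightOp_contract weightOp_cochain32).1, neg_zero]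

theorem weightOp_cochain21 : weightOp F 2 (cochain21 F) = 0 :=
  (weightOp_contract weightOp_cochain31).2

theorem weightOp_cochain22 : weightOp F 2 (cochain22 F) = 0 := by
  rw [cochain22, map_neg, (weightOp_contract weightOp_cochain32).2, neg_zero]

/-- `detCochain F ![]` is the element `H`, and its differential sends `L` to `[L_λ H] = ∂H`. -/
theorem coord_d_detCochain_zero :
    coord F true 1 (genCoeff ![(false, 0)] ((adjW F 1).d 0 (detCochain F ![]))) = 1 := by
  rw [genCoeff_apply]
  change coord F true 1 (varCoeff _ _ ((adjW F 1).preD 0 (detCochain F ![]).1 _)) = 1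
  rw [LCModule.preD]
  have h : (adjW F 1).act (gen F false) (H F) = _ := bracket_L_H (F := F) 1
  have h2 : exponents ![((false, 0) : Bool × ℕ)] = 0 := by
    refine Finsupp.ext fun i => ?_
    fin_cases i; rfl
  simp [LCModule.bracketSum, LCModule.actTerm_apply, detCochain_apply, substVars_tmul, evalAt_tmul,
    varCoeff_tmul, actAt_tmul, h, h2, coord_D_H]

/-- On `L ⊗ L` the action terms give `(λ_2 - λ_1) ∂H`, while the bracket term gives multiples of `H`
without ∂. So the coefficient of `λ_1` at `∂H` is -1. -/
theorem coord_d_cochainU :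
    coord F true 1 (genCoeff ![(false, 1), (false, 0)] ((adjW F 1).d 1 (cochainU F))) = -1 := by
  rw [genCoeff_apply]
  change coord F true 1 (varCoeff _ _ ((adjW F 1).preD 1 (cochainU F).1 _)) = -1
  rw [LCModule.preD]
  have h : (adjW F 1).act (gen F false) (H F) = _ := bracket_L_H (F := F) 1
  have h' : (WAlg F 1).bracket (gen F false) (gen F false) = _ := bracket_L_L (F := F) 1
  have h2 : exponents ![((false, 1) : Bool × ℕ), (false, 0)] = Finsupp.single 0 1 := by
    ext i; fin_cases i <;> simp [exponents]
  simp [LCModule.bracketSum, LCModule.actTerm_apply, LCModule.bracketTerm_apply, cochainU_apply,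
    h', substVars_tmul, evalAt_tmul, LCModule.insertAt_tmul, Fin.tail, Fin.removeNth, detRow_gen,
    varCoeff_tmul, TensorProduct.smul_tmul', coord_H, actAt_tmul, h, h2, coord_D_H,
    MvPolynomial.coeff_X, Finsupp.single_left_inj]

/-- The contraction prepends (L, 1), producing a repeated pair. -/
theorem genCoeff_cochain21_one : genCoeff ![(false, 1), (false, 0)] (cochain21 F) = 0 :=
  (genCoeff_contract _ _ _).trans (genCoeff_eq_zero_of_eq (by decide) _)

theorem genCoeff_cochain22_one : genCoeff ![(false, 1), (false, 0)] (cochain22 F) = 0 := by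
  rw [cochain22, map_neg, genCoeff_contract, genCoeff_eq_zero_of_eq (by decide), neg_zero]

theorem weightOp_detCochain_zero : weightOp F 0 (detCochain F ![]) = 0 :=
  weightOp_detCochain (by simp [totalWeight, confWeight])

theorem isCohomologyBasis_zero :
    (adjW F 1).IsCohomologyBasis (fun i : Fin 0 => (i.elim0 : (adjW F 1).cochains 0)) := by
  refine isCohomologyBasis_of_weight_zero (fun i => i.elim0) (fun f hf hdf => ?_)
    (fun c _ => Subsingleton.elim _ _)
  refine ⟨0, ?_⟩
  set c := coord F true 0 (genCoeff ![] f)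
  have h1 : f - c • detCochain F ![] = 0 := by
    refine weight_zero_zero_ext (by simp [hf, weightOp_detCochain_zero]) ?_
    rw [map_sub, map_sub, map_smul, map_smul,
      genCoeff_detCochain_self (Function.injective_of_subsingleton _), coord_H]
    simp [c]
  have h2 : coord F true 1 (genCoeff ![(false, 0)] ((adjW F 1).d 0 f)) = c := by
    rw [sub_eq_zero.mp h1, map_smul, map_smul, map_smul, coord_d_detCochain_zero]
    simp
  rw [hdf, map_zero, map_zero] at h2
  rw [← h2, zero_smul, sub_zero] at h1
  simp [h1]

/-- Weight-zero 1-cochains have two coefficients; `dH` has 1 at the first, `cochainU` has 0 there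
and 1 at the second, so the system is triangular. -/
theorem exists_eq_of_weight_zero_one {f : (adjW F 1).cochains 1} (hf : weightOp F 1 f = 0) :
    ∃ a b : F, f = a • (adjW F 1).d 0 (detCochain F ![]) + b • cochainU F := by
  set h₀ := (adjW F 1).d 0 (detCochain F ![]) with hh₀
  set a := coord F true 1 (genCoeff ![(false, 0)] f)
  -- The correction by `a` removes whatever `dH` contributes at (L, 1), so that coefficient need not
  -- be computed.
  set b := coord F true 0 (genCoeff ![(false, 1)] f) -
    a * coord F true 0 (genCoeff ![(false, 1)] h₀)
  refine ⟨a, b, ?_⟩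
  rw [← sub_eq_zero, ← sub_sub]
  refine weight_zero_one_ext ?_ ?_ ?_
  · rw [map_sub, map_sub, map_smul, map_smul, hf, hh₀, weightOp_d, weightOp_detCochain_zero,
      weightOp_cochainU]
    simp
  · simp only [map_sub, map_smul, smul_eq_mul]
    rw [hh₀, coord_d_detCochain_zero, cochainU, genCoeff_detCochain_of_ne (by decide)]
    simp [a]
  · simp only [map_sub, map_smul, smul_eq_mul]
    rw [cochainU, genCoeff_detCochain_self (Function.injective_of_subsingleton _), coord_H]
    simp [b]

theorem exists_d_eq_of_weight_zero_one {f : (adjW F 1).cochains 1} (hf : weightOp F 1 f = 0) :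
    ∃ b : F, (adjW F 1).d 1 f = b • (adjW F 1).d 1 (cochainU F) := by
  obtain ⟨a, b, rfl⟩ := exists_eq_of_weight_zero_one hf
  exact ⟨b, by rw [map_add, map_smul, map_smul, LCModule.d_d, smul_zero, zero_add]⟩

/-- A weight-zero cocycle is a dH + b U with b dU = 0; as dU ≠ 0, it is the coboundary a dH. -/
theorem isCohomologyBasis_one :
    (adjW F 1).IsCohomologyBasis (fun i : Fin 0 => (i.elim0 : (adjW F 1).cochains 1)) := by
  refine isCohomologyBasis_of_weight_zero (fun i => i.elim0) (fun f hf hdf => ?_)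
    (fun c _ => Subsingleton.elim _ _)
  refine ⟨0, ?_⟩
  obtain ⟨a, b, rfl⟩ := exists_eq_of_weight_zero_one hf
  rw [map_add, map_smul, map_smul, LCModule.d_d, smul_zero, zero_add] at hdf
  have h2 := congrArg (fun g => coord F true 1 (genCoeff ![(false, 1), (false, 0)] g)) hdf
  simp only [map_smul, coord_d_cochainU, map_zero, smul_eq_mul, mul_neg, mul_one,
    neg_eq_zero] at h2
  rw [Finset.univ_eq_empty, Finset.sum_empty, sub_zero, h2, zero_smul, add_zero, ← map_smul]
  exact LinearMap.mem_range_self _ _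

/-- Of the three possible coefficients, the one at `∂H` vanishes on `cochain21` and `cochain22` and
equals -1 on dU; the other two separate `cochain21` from `cochain22`. -/
theorem exists_eq_of_weight_zero_two {f : (adjW F 1).cochains 2} (hf : weightOp F 2 f = 0) :
    ∃ a b c : F, f = a • cochain21 F + b • cochain22 F + c • (adjW F 1).d 1 (cochainU F) := by
  set u := (adjW F 1).d 1 (cochainU F) with hu
  -- The sign compensates the coefficient -1 of dU.
  set c := -coord F true 1 (genCoeff ![(false, 1), (false, 0)] f)
  obtain ⟨g, hg⟩ : ∃ g, g = f - c • u := ⟨_, rfl⟩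
  have hg1 : weightOp F 2 g = 0 := by
    rw [hg, map_sub, map_smul, hf, hu, weightOp_d, weightOp_cochainU]
    simp
  have hg2 : coord F true 1 (genCoeff ![(false, 1), (false, 0)] g) = 0 := by
    simp only [hg, map_sub, map_smul, hu, coord_d_cochainU]
    simp [c]
  set a := coord F true 0 (genCoeff ![(false, 0), (true, 0)] g)
  set b := coord F true 0 (genCoeff ![(false, 2), (false, 0)] g)
  have h1 : g - a • cochain21 F - b • cochain22 F = 0 := by
    refine weight_zero_two_ext ?_ ?_ ?_ ?_
    · simp [hg1, weightOp_cochain21, weightOp_cochain22]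
    · simp [hg2, genCoeff_cochain21_one, genCoeff_cochain22_one]
    · simp [b, genCoeff_cochain21_two, genCoeff_cochain22_two, coord_H]
    · simp [a, genCoeff_cochain21_three, genCoeff_cochain22_three, coord_H]
  refine ⟨a, b, c, ?_⟩
  rw [← sub_eq_zero, ← h1, hg]
  abel

theorem isCohomologyBasis_two :
    (adjW F 1).IsCohomologyBasis ![cochain21 F, cochain22 F] := by
  refine isCohomologyBasis_of_weight_zero ?_ (fun f hf _ => ?_) (fun c hc => ?_)
  · rw [Fin.forall_fin_two]
    exact ⟨d_cochain21, d_cochain22⟩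
  · obtain ⟨a, b, c, rfl⟩ := exists_eq_of_weight_zero_two hf
    refine ⟨![a, b], ?_⟩
    rw [Fin.sum_univ_two]
    simp only [Matrix.cons_val_zero, Matrix.cons_val_one, add_sub_cancel_left]
    rw [← map_smul]
    exact LinearMap.mem_range_self _ _
  · obtain ⟨u, hu⟩ := hc
    simp only [Fin.sum_univ_two, Matrix.cons_val_zero, Matrix.cons_val_one] at hu
    -- The coboundary has weight zero, so it is the differential of a weight-zero 1-cochain, a
    -- multiple of dU. The coefficient at `∂H` shows the multiple is zero.
    obtain ⟨g, hg, hgu⟩ := exists_weight_zero_of_d (u := u) (by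
      rw [hu, map_add, map_smul, map_smul, weightOp_cochain21, weightOp_cochain22]
      simp)
    obtain ⟨b, hb⟩ := exists_d_eq_of_weight_zero_one hg
    rw [← hgu, hb] at hu
    have h1 := congrArg (fun g => coord F true 1 (genCoeff ![(false, 1), (false, 0)] g)) hu
    have h2 := congrArg (fun g => coord F true 0 (genCoeff ![(false, 2), (false, 0)] g)) hu
    have h3 := congrArg (fun g => coord F true 0 (genCoeff ![(false, 0), (true, 0)] g)) hu
    simp only [map_add, map_smul, coord_d_cochainU, genCoeff_cochain21_one,
      genCoeff_cochain22_one, genCoeff_cochain21_two, genCoeff_cochain22_two,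
      genCoeff_cochain21_three, genCoeff_cochain22_three, coord_H] at h1 h2 h3
    simp at h1 h2 h3
    simp [h1] at h2 h3
    funext i
    fin_cases i
    exacts [h3.symm, h2.symm]

theorem isCohomologyBasis_three :
    (adjW F 1).IsCohomologyBasis ![cochain31 F, cochain32 F] := by
  refine isCohomologyBasis_of_weight_zero ?_ (fun f hf _ => ?_) (fun c hc => ?_)
  · rw [Fin.forall_fin_two]
    exact ⟨d_three_of_weight_zero weightOp_cochain31, d_three_of_weight_zero weightOp_cochain32⟩
  · refine ⟨![coord F true 0 (genCoeff ![(false, 1), (false, 0), (true, 0)] f),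
      coord F true 0 (genCoeff ![(false, 2), (false, 1), (false, 0)] f)], ?_⟩
    convert Submodule.zero_mem _
    refine weight_zero_three_ext ?_ ?_ ?_
    · simp [Fin.sum_univ_two, hf, weightOp_cochain31, weightOp_cochain32]
    · simp [Fin.sum_univ_two, genCoeff_cochain31, genCoeff_cochain32', coord_H]
    · simp [Fin.sum_univ_two, genCoeff_cochain31', genCoeff_cochain32, coord_H]
  · obtain ⟨u, hu⟩ := hc
    simp only [Fin.sum_univ_two, Matrix.cons_val_zero, Matrix.cons_val_one] at hu
    obtain ⟨g, hg, hgu⟩ := exists_weight_zero_of_d (u := u) (by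
      rw [hu, map_add, map_smul, map_smul, weightOp_cochain31, weightOp_cochain32]
      simp)
    -- All weight-zero 2-cochains are closed, so the only weight-zero coboundary in degree 3 is 0.
    obtain ⟨a, b, e, rfl⟩ := exists_eq_of_weight_zero_two hg
    rw [← hgu, map_add, map_add, map_smul, map_smul, map_smul, d_cochain21, d_cochain22,
      LCModule.d_d] at hu
    have h1 := congrArg (fun g =>
      coord F true 0 (genCoeff ![(false, 1), (false, 0), (true, 0)] g)) hu
    have h2 := congrArg (fun g =>
      coord F true 0 (genCoeff ![(false, 2), (false, 1), (false, 0)] g)) hu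
    simp [genCoeff_cochain31, genCoeff_cochain31', genCoeff_cochain32, genCoeff_cochain32',
      coord_H] at h1 h2
    funext i
    fin_cases i
    exacts [h1.symm, h2.symm]

theorem isCohomologyBasis_of_four_le {q : ℕ} (hq : 4 ≤ q) :
    (adjW F 1).IsCohomologyBasis (fun i : Fin 0 => (i.elim0 : (adjW F 1).cochains q)) := by
  refine isCohomologyBasis_of_weight_zero (fun i => i.elim0) (fun f hf hdf => ?_)
    (fun c _ => Subsingleton.elim _ _)
  refine ⟨0, ?_⟩
  rw [weight_zero_eq_zero hq hf, Finset.univ_eq_empty, Finset.sum_empty, sub_zero]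
  exact Submodule.zero_mem _

end Bases

end LieConformal

namespace LieConformal

open WSpace

/-! ### Values of the representatives on generators -/

section Values

variable {F : Type*} [Field F]

open MvPolynomial

theorem detRow_L {q : ℕ} (z : Fin q → Bool × ℕ) (i j : Fin q) :
    detRow z i (L F) j = if (z j).1 = false then X i ^ (z j).2 else 0 := by
  exact (detRow_gen z i j false).trans (if_congr eq_comm rfl rfl)

theorem detRow_H {q : ℕ} (z : Fin q → Bool × ℕ) (i j : Fin q) :
    detRow z i (H F) j = if (z j).1 = true then X i ^ (z j).2 else 0 := by
  exact (detRow_gen z i j true).trans (if_congr eq_comm rfl rfl)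

theorem cochain31_values :
    (cochain31 F).1 ![L F, L F, L F] = 0 ∧
    (cochain31 F).1 ![L F, L F, H F] = (X 0 - X 1) ⊗ₜ H F ∧
    (cochain31 F).1 ![L F, H F, H F] = 0 ∧ (cochain31 F).1 ![H F, H F, H F] = 0 := by
  simp [cochain31, detCochain_apply, Matrix.det_fin_three, detRow_L, detRow_H]

theorem cochain32_values :
    (cochain32 F).1 ![L F, L F, L F] = ((X 0 - X 1) * (X 0 - X 2) * (X 1 - X 2)) ⊗ₜ H F ∧
    (cochain32 F).1 ![L F, L F, H F] = 0 ∧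
    (cochain32 F).1 ![L F, H F, H F] = 0 ∧ (cochain32 F).1 ![H F, H F, H F] = 0 := by
  simp [cochain32, detCochain_apply, Matrix.det_fin_three, detRow_L, detRow_H]
  congr 1
  ring

theorem contract_L_apply_one (n : ℕ) (f : (adjW F 1).cochains 2) (x : WSpace F) :
    ((adjW F 1).contract (L F) n 1 f).1 ![x] = firstCoeff _ n (f.1 ![L F, x]) := rfl

theorem contract_L_apply_two (n : ℕ) (f : (adjW F 1).cochains 3) (x y : WSpace F) :
    ((adjW F 1).contract (L F) n 2 f).1 ![x, y] = firstCoeff _ n (f.1 ![L F, x, y]) := rfl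

theorem cochain21_values :
    (cochain21 F).1 ![L F, L F] = 0 ∧ (cochain21 F).1 ![L F, H F] = 1 ⊗ₜ H F ∧
    (cochain21 F).1 ![H F, H F] = 0 := by
  obtain ⟨h1, h2, h3, -⟩ := cochain31_values (F := F)
  have hX : finSuccEquiv F 2 (X 1) = Polynomial.C (X 0) := finSuccEquiv_X_succ (j := 0)
  refine ⟨?_, ?_, ?_⟩
  · rw [cochain21, contract_L_apply_two, h1, map_zero]
  · rw [cochain21, contract_L_apply_two, h2, firstCoeff_tmul, map_sub, finSuccEquiv_X_zero, hX]
    simp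
  · rw [cochain21, contract_L_apply_two, h3, map_zero]

/-- The coefficient of `λ_1` in the Vandermonde product is `-(λ_2 ^ 2 - λ_3 ^ 2)`, which accounts
for the minus sign in `cochain22`; renumbering the variables gives the value. -/
theorem cochain22_values :
    (cochain22 F).1 ![L F, L F] = (X 0 ^ 2 - X 1 ^ 2) ⊗ₜ H F ∧ (cochain22 F).1 ![L F, H F] = 0 ∧
    (cochain22 F).1 ![H F, H F] = 0 := by
  obtain ⟨h1, h2, h3, -⟩ := cochain32_values (F := F)
  have hX1 : finSuccEquiv F 2 (X 1) = Polynomial.C (X 0) := finSuccEquiv_X_succ (j := 0)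
  have hX2 : finSuccEquiv F 2 (X 2) = Polynomial.C (X 1) := finSuccEquiv_X_succ (j := 1)
  have h : ∀ x y, (cochain22 F).1 ![x, y] = -firstCoeff _ 1 ((cochain32 F).1 ![L F, x, y]) :=
    fun x y => rfl
  refine ⟨?_, ?_, ?_⟩
  · rw [h, h1, firstCoeff_tmul]
    simp only [map_mul, map_sub, finSuccEquiv_X_zero, hX1, hX2]
    rw [← TensorProduct.neg_tmul]
    congr 1
    simp [Polynomial.mul_coeff_one, Polynomial.coeff_C]
    ring
  · rw [h, h2, map_zero, neg_zero]
  · rw [h, h3, map_zero, neg_zero]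

theorem contract_cochain21_values :
    ((adjW F 1).contract (L F) 0 1 (cochain21 F)).1 ![L F] = 0 ∧
    ((adjW F 1).contract (L F) 0 1 (cochain21 F)).1 ![H F] = 1 ⊗ₜ H F := by
  obtain ⟨h1, h2, -⟩ := cochain21_values (F := F)
  rw [contract_L_apply_one, contract_L_apply_one, h1, h2, map_zero, firstCoeff_tmul]
  simp

theorem contract_cochain22_values :
    ((adjW F 1).contract (L F) 0 1 (cochain22 F)).1 ![L F] = (-X 0 ^ 2) ⊗ₜ H F ∧
    ((adjW F 1).contract (L F) 0 1 (cochain22 F)).1 ![H F] = 0 := by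
  obtain ⟨h1, h2, -⟩ := cochain22_values (F := F)
  have hX : finSuccEquiv F 1 (X 1) = Polynomial.C (X 0) := finSuccEquiv_X_succ (j := 0)
  rw [contract_L_apply_one, contract_L_apply_one, h1, h2, map_zero, firstCoeff_tmul, map_sub,
    map_pow, map_pow, finSuccEquiv_X_zero, hX]
  simp [← map_pow]

/-- On `L ⊗ H` the contraction gives `-λ_1 H` and `∂f₂₁` gives `(∂ + λ_1 + λ_2) H`. The added term
is chosen to reach the stated representative, and it vanishes in the reduced complex. -/
theorem contract_cochain31_add_del_values :
    ((adjW F 1).contract (L F) 0 2 (cochain31 F) + (adjW F 1).del 2 (cochain21 F)).1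
      ![L F, L F] = 0 ∧
    ((adjW F 1).contract (L F) 0 2 (cochain31 F) + (adjW F 1).del 2 (cochain21 F)).1
      ![L F, H F] = 1 ⊗ₜ D F (H F) + X 1 ⊗ₜ H F ∧
    ((adjW F 1).contract (L F) 0 2 (cochain31 F) + (adjW F 1).del 2 (cochain21 F)).1
      ![H F, H F] = 0 := by
  obtain ⟨h1, h2, h3, -⟩ := cochain31_values (F := F)
  obtain ⟨k1, k2, k3⟩ := cochain21_values (F := F)
  have hX : finSuccEquiv F 2 (X 1) = Polynomial.C (X 0) := finSuccEquiv_X_succ (j := 0)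
  have h : ∀ x y, ((adjW F 1).contract (L F) 0 2 (cochain31 F) +
      (adjW F 1).del 2 (cochain21 F)).1 ![x, y] = firstCoeff _ 0 ((cochain31 F).1 ![L F, x, y]) +
      (adjW F 1).preDel 2 (cochain21 F).1 ![x, y] := fun x y => rfl
  refine ⟨?_, ?_, ?_⟩
  · rw [h, h1, LCModule.preDel_apply, k1]
    simp
  · rw [h, h2, LCModule.preDel_apply, k2, firstCoeff_tmul, map_sub, finSuccEquiv_X_zero, hX,
      Fin.sum_univ_two, LinearMap.baseChange_tmul, TensorProduct.smul_tmul', add_left_comm,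
      ← TensorProduct.add_tmul]
    simp
    rfl
  · rw [h, h3, LCModule.preDel_apply, k3]
    simp

theorem contract_cochain32_values :
    ((adjW F 1).contract (L F) 0 2 (cochain32 F)).1 ![L F, L F] =
      (X 0 * X 1 * (X 0 - X 1)) ⊗ₜ H F ∧
    ((adjW F 1).contract (L F) 0 2 (cochain32 F)).1 ![L F, H F] = 0 ∧
    ((adjW F 1).contract (L F) 0 2 (cochain32 F)).1 ![H F, H F] = 0 := by
  obtain ⟨h1, h2, h3, -⟩ := cochain32_values (F := F)
  have hX1 : finSuccEquiv F 2 (X 1) = Polynomial.C (X 0) := finSuccEquiv_X_succ (j := 0)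
  have hX2 : finSuccEquiv F 2 (X 2) = Polynomial.C (X 1) := finSuccEquiv_X_succ (j := 1)
  refine ⟨?_, ?_, ?_⟩
  · rw [contract_L_apply_two, h1, firstCoeff_tmul]
    simp only [map_mul, map_sub, finSuccEquiv_X_zero, hX1, hX2]
    congr 1
    simp
  · rw [contract_L_apply_two, h2, map_zero]
  · rw [contract_L_apply_two, h3, map_zero]

end Values

/-! ### Bases and dimensions of the cohomology spaces -/

section Reduced

variable {F : Type*} [Field F] [CharZero F]

theorem exists_basis_reduced {q n m : ℕ} {B : Fin n → (adjW F 1).cochains q}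
    {B' : Fin m → (adjW F 1).cochains (q + 1)} (h : (adjW F 1).IsCohomologyBasis B)
    (h' : (adjW F 1).IsCohomologyBasis B') :
    ∃ b : Module.Basis (Fin (n + m)) F ((adjW F 1).ReducedCohomology q),
      (∀ i, (adjW F 1).HasReducedClass (B i) (b (Fin.castAdd m i))) ∧
      ∀ i, (adjW F 1).HasReducedClass ((adjW F 1).contract (L F) 0 q (B' i))
        (b (Fin.natAdd n i)) := by
  obtain ⟨b, hb, hb'⟩ := h.exists_basis_reduced cartan_zero_adjW del_eq_zero h'
  refine ⟨b.reindex finSumFinEquiv, fun i => ?_, fun i => ?_⟩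
  · simpa using hb i
  · simpa using hb' i

end Reduced

theorem hasReducedClass_add_del {F : Type*} [Field F] [CharZero F] {A M : Type*} [AddCommGroup A]
    [Module F A] {𝒜 : LieConformalAlgebra F A} [AddCommGroup M] [Module F M] {ℳ : LCModule 𝒜 M}
    {q : ℕ} {f : ℳ.cochains q} {x : ℳ.ReducedCohomology q} (h : ℳ.HasReducedClass f x)
    (g : ℳ.cochains q) : ℳ.HasReducedClass (f + ℳ.del q g) x := by
  have : (Submodule.Quotient.mk (f + ℳ.del q g) : ℳ.ReducedCochains q) =
      Submodule.Quotient.mk f := by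
    rw [Submodule.Quotient.eq, add_sub_cancel_left]
    exact LinearMap.mem_range_self _ _
  rw [LCModule.HasReducedClass] at h ⊢
  simpa only [this] using h

section Rank

variable {F : Type*} [Field F] [CharZero F]

theorem rank_basicCohomology {q n : ℕ} {B : Fin n → (adjW F 1).cochains q}
    (h : (adjW F 1).IsCohomologyBasis B) :
    Module.rank F ((adjW F 1).BasicCohomology q) = n := by
  obtain ⟨b, -⟩ := h.exists_basis
  rw [rank_eq_card_basis b, Fintype.card_fin]

theorem rank_reducedCohomology {q n m : ℕ} {B : Fin n → (adjW F 1).cochains q}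
    {B' : Fin m → (adjW F 1).cochains (q + 1)} (h : (adjW F 1).IsCohomologyBasis B)
    (h' : (adjW F 1).IsCohomologyBasis B') :
    Module.rank F ((adjW F 1).ReducedCohomology q) = (n + m : ℕ) := by
  obtain ⟨b, -⟩ := exists_basis_reduced h h'
  rw [rank_eq_card_basis b, Fintype.card_fin]

variable (F)

theorem exists_basis_basicCohomology_two :
    ∃ B : Module.Basis (Fin 2) F ((adjW F 1).BasicCohomology 2),
      (adjW F 1).HasBasicClass (cochain21 F) (B 0) ∧
      (adjW F 1).HasBasicClass (cochain22 F) (B 1) := by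
  obtain ⟨b, hb⟩ := (isCohomologyBasis_two (F := F)).exists_basis
  exact ⟨b, hb 0, hb 1⟩

theorem exists_basis_basicCohomology_three :
    ∃ B : Module.Basis (Fin 2) F ((adjW F 1).BasicCohomology 3),
      (adjW F 1).HasBasicClass (cochain31 F) (B 0) ∧
      (adjW F 1).HasBasicClass (cochain32 F) (B 1) := by
  obtain ⟨b, hb⟩ := (isCohomologyBasis_three (F := F)).exists_basis
  exact ⟨b, hb 0, hb 1⟩

/-- The basic cohomology vanishes in degree 1, so only the contractions of the degree 2 classes
contribute. -/
theorem exists_basis_reducedCohomology_one :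
    ∃ B : Module.Basis (Fin 2) F ((adjW F 1).ReducedCohomology 1),
      (adjW F 1).HasReducedClass ((adjW F 1).contract (L F) 0 1 (cochain21 F)) (B 0) ∧
      (adjW F 1).HasReducedClass ((adjW F 1).contract (L F) 0 1 (cochain22 F)) (B 1) := by
  obtain ⟨r, -, hr⟩ := exists_basis_reduced (F := F) isCohomologyBasis_one isCohomologyBasis_two
  exact ⟨r, hr 0, hr 1⟩

theorem exists_basis_reducedCohomology_two :
    ∃ B : Module.Basis (Fin 4) F ((adjW F 1).ReducedCohomology 2),
      (adjW F 1).HasReducedClass (cochain21 F) (B 0) ∧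
      (adjW F 1).HasReducedClass (cochain22 F) (B 1) ∧
      (adjW F 1).HasReducedClass
        ((adjW F 1).contract (L F) 0 2 (cochain31 F) + (adjW F 1).del 2 (cochain21 F)) (B 2) ∧
      (adjW F 1).HasReducedClass ((adjW F 1).contract (L F) 0 2 (cochain32 F)) (B 3) := by
  obtain ⟨r, hr, hr'⟩ :=
    exists_basis_reduced (F := F) isCohomologyBasis_two isCohomologyBasis_three
  exact ⟨r, hr 0, hr 1, hasReducedClass_add_del (hr' 0) _, hr' 1⟩

/-- The basic cohomology vanishes in degree 4, so no contractions contribute. -/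
theorem exists_basis_reducedCohomology_three :
    ∃ B : Module.Basis (Fin 2) F ((adjW F 1).ReducedCohomology 3),
      (adjW F 1).HasReducedClass (cochain31 F) (B 0) ∧
      (adjW F 1).HasReducedClass (cochain32 F) (B 1) := by
  obtain ⟨r, hr, -⟩ := exists_basis_reduced (F := F) isCohomologyBasis_three
    (isCohomologyBasis_of_four_le le_rfl)
  exact ⟨r, hr 0, hr 1⟩

theorem rank_basicCohomology_eq (q : ℕ) :
    Module.rank F ((adjW F 1).BasicCohomology q) = if q = 2 ∨ q = 3 then 2 else 0 := by
  match q with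
  | 0 => exact (rank_basicCohomology isCohomologyBasis_zero).trans (by simp)
  | 1 => exact (rank_basicCohomology isCohomologyBasis_one).trans (by simp)
  | 2 => exact (rank_basicCohomology isCohomologyBasis_two).trans (by simp)
  | 3 => exact (rank_basicCohomology isCohomologyBasis_three).trans (by simp)
  | q + 4 =>
    rw [if_neg (by omega)]
    exact (rank_basicCohomology (isCohomologyBasis_of_four_le (by omega))).trans Nat.cast_zero

theorem rank_reducedCohomology_eq (q : ℕ) :
    Module.rank F ((adjW F 1).ReducedCohomology q) =
      if q = 1 ∨ q = 3 then 2 else if q = 2 then 4 else 0 := by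
  match q with
  | 0 =>
    exact (rank_reducedCohomology isCohomologyBasis_zero isCohomologyBasis_one).trans (by simp)
  | 1 =>
    exact (rank_reducedCohomology isCohomologyBasis_one isCohomologyBasis_two).trans (by simp)
  | 2 =>
    exact (rank_reducedCohomology isCohomologyBasis_two isCohomologyBasis_three).trans (by simp)
  | 3 =>
    exact (rank_reducedCohomology isCohomologyBasis_three
      (isCohomologyBasis_of_four_le le_rfl)).trans (by simp)
  | q + 4 =>
    rw [if_neg (by omega), if_neg (by omega)]
    exact (rank_reducedCohomology (isCohomologyBasis_of_four_le (by omega))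
      (isCohomologyBasis_of_four_le (by omega))).trans Nat.cast_zero

end Rank

end LieConformal

open LieConformal LieConformal.WSpace MvPolynomial in
/-- Basic and reduced cohomology of the Lie conformal algebra `W(1)` with coefficients in its
adjoint module: dimensions and explicit bases. The variable `λ_i` is `X (i - 1)`. -/
theorem mainTheorem6 (F : Type*) [Field F] [CharZero F] :
    -- the dimensions
    (∀ q : ℕ, Module.rank F ((adjW F 1).BasicCohomology q) = if q = 2 ∨ q = 3 then 2 else 0) ∧
    (∀ q : ℕ, Module.rank F ((adjW F 1).ReducedCohomology q) =
      if q = 1 ∨ q = 3 then 2 else if q = 2 then 4 else 0) ∧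
    -- the bases
    ∃ (f₁₁ f₁₂ : (adjW F 1).cochains 1) (f₂₁ f₂₂ f₂₃ f₂₄ : (adjW F 1).cochains 2)
      (f₃₁ f₃₂ : (adjW F 1).cochains 3),
      (f₁₁.1 ![L F] = 0 ∧ f₁₁.1 ![H F] = 1 ⊗ₜ H F) ∧
      (f₁₂.1 ![L F] = (-X 0 ^ 2) ⊗ₜ H F ∧ f₁₂.1 ![H F] = 0) ∧
      (f₂₁.1 ![L F, L F] = 0 ∧ f₂₁.1 ![L F, H F] = 1 ⊗ₜ H F ∧ f₂₁.1 ![H F, H F] = 0) ∧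
      (f₂₂.1 ![L F, L F] = (X 0 ^ 2 - X 1 ^ 2) ⊗ₜ H F ∧ f₂₂.1 ![L F, H F] = 0 ∧
        f₂₂.1 ![H F, H F] = 0) ∧
      (f₂₃.1 ![L F, L F] = 0 ∧ f₂₃.1 ![L F, H F] = 1 ⊗ₜ D F (H F) + X 1 ⊗ₜ H F ∧
        f₂₃.1 ![H F, H F] = 0) ∧
      (f₂₄.1 ![L F, L F] = (X 0 * X 1 * (X 0 - X 1)) ⊗ₜ H F ∧ f₂₄.1 ![L F, H F] = 0 ∧
        f₂₄.1 ![H F, H F] = 0) ∧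
      (f₃₁.1 ![L F, L F, L F] = 0 ∧ f₃₁.1 ![L F, L F, H F] = (X 0 - X 1) ⊗ₜ H F ∧
        f₃₁.1 ![L F, H F, H F] = 0 ∧ f₃₁.1 ![H F, H F, H F] = 0) ∧
      (f₃₂.1 ![L F, L F, L F] = ((X 0 - X 1) * (X 0 - X 2) * (X 1 - X 2)) ⊗ₜ H F ∧
        f₃₂.1 ![L F, L F, H F] = 0 ∧ f₃₂.1 ![L F, H F, H F] = 0 ∧
        f₃₂.1 ![H F, H F, H F] = 0) ∧
      (∃ B : Module.Basis (Fin 2) F ((adjW F 1).BasicCohomology 2),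
        (adjW F 1).HasBasicClass f₂₁ (B 0) ∧ (adjW F 1).HasBasicClass f₂₂ (B 1)) ∧
      (∃ B : Module.Basis (Fin 2) F ((adjW F 1).BasicCohomology 3),
        (adjW F 1).HasBasicClass f₃₁ (B 0) ∧ (adjW F 1).HasBasicClass f₃₂ (B 1)) ∧
      (∃ B : Module.Basis (Fin 2) F ((adjW F 1).ReducedCohomology 1),
        (adjW F 1).HasReducedClass f₁₁ (B 0) ∧ (adjW F 1).HasReducedClass f₁₂ (B 1)) ∧
      (∃ B : Module.Basis (Fin 4) F ((adjW F 1).ReducedCohomology 2),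
        (adjW F 1).HasReducedClass f₂₁ (B 0) ∧ (adjW F 1).HasReducedClass f₂₂ (B 1) ∧
        (adjW F 1).HasReducedClass f₂₃ (B 2) ∧ (adjW F 1).HasReducedClass f₂₄ (B 3)) ∧
      (∃ B : Module.Basis (Fin 2) F ((adjW F 1).ReducedCohomology 3),
        (adjW F 1).HasReducedClass f₃₁ (B 0) ∧ (adjW F 1).HasReducedClass f₃₂ (B 1)) := by
  refine ⟨rank_basicCohomology_eq F, rank_reducedCohomology_eq F,
    (adjW F 1).contract (L F) 0 1 (cochain21 F), (adjW F 1).contract (L F) 0 1 (cochain22 F),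
    cochain21 F, cochain22 F,
    (adjW F 1).contract (L F) 0 2 (cochain31 F) + (adjW F 1).del 2 (cochain21 F),
    (adjW F 1).contract (L F) 0 2 (cochain32 F), cochain31 F, cochain32 F, ?_⟩
  exact ⟨contract_cochain21_values, contract_cochain22_values, cochain21_values, cochain22_values,
    contract_cochain31_add_del_values, contract_cochain32_values, cochain31_values,
    cochain32_values, exists_basis_basicCohomology_two F, exists_basis_basicCohomology_three F,
    exists_basis_reducedCohomology_one F, exists_basis_reducedCohomology_two F,
    exists_basis_reducedCohomology_three F⟩
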